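/- Let $M$ be a compact smooth manifold (without boundary) of dimension $n\ge 3$, let $k\ge 1$ be an integer with $k\le n/2$ if $n$ is even, and let $g$ be a smooth Riemannian metric on $M$. Let $\Delta_g=-\mathrm{div}_g\nabla$, let $dv_g$ be the Riemannian volume measure, and let $P_g$ be the conformal GJMS operator of order $2k$ of $(M,g)$. That is, let $\tilde g=2\rho\,dt^2+2t\,dt\,d\rho+t^2h_\rho$ be a Fefferman–Graham ambient metric of $(M,g)$ in normal form, where $t>0$, $\rho$ is near $0$, and $h_\rho$ is a smooth one-parameter family of symmetric $2$-tensors on $M$ with $h_0=g$; its Ricci curvature satisfies $\mathrm{Ric}(\tilde g)=O(\rho^\infty)$ if $n$ is odd and $\mathrm{Ric}(\tilde g)=O^+(\rho^{n/2-1})$ if $n$ is even. Here $S=O^+(\rho^m)$ means that all components of $S$ are $O(\rho^m)$ and that $S_{tt}$, $S_{ti}$ and $g^{ij}S_{ij}$ are $O(\rho^{m+1})$. Then $P_gf=\Delta_{\tilde g}^k\big(t^{k-n/2}f\big)\big|_{t=1,\rho=0}$ for $f\in C^\infty(M)$, where $\Delta_{\tilde g}=-\mathrm{div}_{\tilde g}\nabla$.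 Then for every $l\in\{0,\dots,k-1\}$ there exists a smooth covariant tensor field $A_{(l)}(g)$ of rank $2l$ on $M$ such that the following hold. 1. $A_{(l)}(g)(X,Y)=A_{(l)}(g)(Y,X)$ at every point and for all contravariant tensors $X,Y$ of rank $l$, where $A_{(l)}(g)(X,Y)=A_{(l)}(g)_{i_1\dots i_lj_1\dots j_l}X^{i_1\dots i_l}Y^{j_1\dots j_l}$. 2. For all $u\in C^\infty(M)$, $$P_gu=\Delta_g^ku+\sum_{l=0}^{k-1}(-1)^l\,\nabla^{j_l\dots j_1}\!\left(A_{(l)}(g)_{i_1\dots i_lj_1\dots j_l}\nabla^{i_1\dots i_l}u\right),$$ where $\nabla$ is the Levi-Civita connection of $g$, $\nabla^{i_1\dots i_l}=\nabla^{i_1}\cdots\nabla^{i_l}$ and indices are raised with $g$. 3. For all $u,v\in C^\infty(M)$, both integrands below are integrable and $$\int_M u\,P_gv\,dv_g=\int_M\Big(\Delta_g^{k/2}u\,\Delta_g^{k/2}v+\sum_{l=0}^{k-1}A_{(l)}(g)(\nabla^lu,\nabla^lv)\Big)dv_g,$$ where the indices of $\nabla^lu$, $\nabla^lv$ are raised with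 $g$, and where for odd $k$ the expression $\Delta_g^{k/2}u\,\Delta_g^{k/2}v$ means $\big(\nabla\Delta_g^{(k-1)/2}u,\nabla\Delta_g^{(k-1)/2}v\big)_g$. -/

import Mathlib

open scoped Manifold ContDiff Topology
open MeasureTheory

noncomputable section

namespace GJMS

/-! ## Tensor calculus in coordinates

`G` is a field of symmetric invertible matrices, the components of a (pseudo-)Riemannian metric in
some coordinate system with coordinates indexed by `ι`. -/

section Coordinates

variable {ι : Type} [Fintype ι] [DecidableEq ι]

/-- The partial derivative `∂_i f`. -/
def pderiv (i : ι) (f : EuclideanSpace ℝ ι → ℝ) (y : EuclideanSpace ℝ ι) : ℝ :=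
  fderiv ℝ f y (EuclideanSpace.single i 1)

/-- The Christoffel symbol `Γ^m_{ij}` of the Levi-Civita connection. -/
def christoffel (G : EuclideanSpace ℝ ι → Matrix ι ι ℝ) (m i j : ι)
    (y : EuclideanSpace ℝ ι) : ℝ :=
  (1 / 2 : ℝ) * ∑ l, (G y)⁻¹ m l *
    (pderiv i (fun z => G z j l) y + pderiv j (fun z => G z i l) y - pderiv l (fun z => G z i j) y)

/-- The Ricci curvature
`R_{ij} = ∂_m Γ^m_{ij} - ∂_j Γ^m_{im} + Γ^m_{ml} Γ^l_{ij} - Γ^m_{jl} Γ^l_{im}`. -/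
def ricci (G : EuclideanSpace ℝ ι → Matrix ι ι ℝ) (i j : ι) (y : EuclideanSpace ℝ ι) : ℝ :=
  ∑ m, (pderiv m (christoffel G m i j) y - pderiv j (christoffel G m i m) y
    + ∑ l, (christoffel G m m l y * christoffel G l i j y
      - christoffel G m j l y * christoffel G l i m y))

/-- Components of a covariant tensor field of rank `q`. -/
abbrev LocalTensor (ι : Type) (q : ℕ) : Type :=
  EuclideanSpace ℝ ι → (Fin q → ι) → ℝ

/-- The covariant derivative `∇_{i_0} T_{i_1 … i_q}`; the index of differentiation comes first. -/
def covDeriv (G : EuclideanSpace ℝ ι → Matrix ι ι ℝ) {q : ℕ} (T : LocalTensor ι q) :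
    LocalTensor ι (q + 1) := fun y I =>
  pderiv (I 0) (fun z => T z (Fin.tail I)) y
    - ∑ s : Fin q, ∑ m, christoffel G m (I 0) (I s.succ) y *
        T y (Function.update (Fin.tail I) s m)

/-- The divergence `∇^{j_1} S_{j_1 j_2 …}`, contracted on the first index. -/
def divergence (G : EuclideanSpace ℝ ι → Matrix ι ι ℝ) {q : ℕ} (S : LocalTensor ι (q + 1)) :
    LocalTensor ι q := fun y J =>
  ∑ a, ∑ b, (G y)⁻¹ a b * covDeriv G S y (Fin.cons a (Fin.cons b J))

/-- `∇^l u`, that is `∇_{i_1} … ∇_{i_l} u`. -/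
def iterCovDeriv (G : EuclideanSpace ℝ ι → Matrix ι ι ℝ) (u : EuclideanSpace ℝ ι → ℝ) :
    (l : ℕ) → LocalTensor ι l
  | 0 => fun y _ => u y
  | l + 1 => covDeriv G (iterCovDeriv G u l)

/-- The `l`-fold divergence `∇^{j_l} … ∇^{j_1} S_{j_1 … j_l}`. -/
def iterDivergence (G : EuclideanSpace ℝ ι → Matrix ι ι ℝ) :
    (l : ℕ) → LocalTensor ι l → EuclideanSpace ℝ ι → ℝ
  | 0, S => fun y => S y Fin.elim0
  | l + 1, S => iterDivergence G l (divergence G S)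

/-- The (geometers') Laplace-Beltrami operator `-div ∇ u`. -/
def localLaplacian (G : EuclideanSpace ℝ ι → Matrix ι ι ℝ) (u : EuclideanSpace ℝ ι → ℝ) :
    EuclideanSpace ℝ ι → ℝ := fun y =>
  -iterDivergence G 1 (iterCovDeriv G u 1) y

/-- Raising all the indices of a covariant tensor at a point: `T^I`. -/
def raise (Gy : Matrix ι ι ℝ) {q : ℕ} (T : (Fin q → ι) → ℝ) : (Fin q → ι) → ℝ := fun I =>
  ∑ K : Fin q → ι, (∏ s, Gy⁻¹ (I s) (K s)) * T K

end Coordinates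

/-! ## Manifolds -/

/-- The model space `ℝⁿ`. -/
abbrev E (n : ℕ) : Type := EuclideanSpace ℝ (Fin n)

variable {n : ℕ} {M : Type*} [TopologicalSpace M] [ChartedSpace (E n) M]

/-- The coordinate vector field `∂_i` of the chart `φ`, at the point with coordinates `y`. -/
def coordVec (φ : OpenPartialHomeomorph M (E n)) (y : E n) (i : Fin n) :
    TangentSpace (𝓡 n) (φ.symm y) :=
  mfderiv (𝓡 n) (𝓡 n) φ.symm y (EuclideanSpace.single i (1 : ℝ) : E n)

/-- The components `b(∂_i, ∂_j)` in the chart `φ` of a field `b` of bilinear forms. -/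
def formMatrix
    (b : (x : M) → TangentSpace (𝓡 n) x →L[ℝ] TangentSpace (𝓡 n) x →L[ℝ] ℝ)
    (φ : OpenPartialHomeomorph M (E n)) (y : E n) : Matrix (Fin n) (Fin n) ℝ :=
  Matrix.of fun i j => b (φ.symm y) (coordVec φ y i) (coordVec φ y j)

/-- A smooth covariant tensor field of rank `q` on `M`. -/
structure CovTensorField (n : ℕ) (M : Type*) [TopologicalSpace M] [ChartedSpace (E n) M]
    (q : ℕ) where
  toFun : (x : M) → MultilinearMap ℝ (fun _ : Fin q => TangentSpace (𝓡 n) x) ℝ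
  smooth : ∀ φ ∈ atlas (E n) M, ∀ I : Fin q → Fin n,
    ContDiffOn ℝ ∞ (fun y => toFun (φ.symm y) fun s => coordVec φ y (I s)) φ.target

/-- The components of a tensor field in the chart `φ`. -/
def CovTensorField.comp {q : ℕ} (A : CovTensorField n M q)
    (φ : OpenPartialHomeomorph M (E n)) : LocalTensor (Fin n) q :=
  fun y I => A.toFun (φ.symm y) fun s => coordVec φ y (I s)

/-- `A(X, Y) = A_{i_1…i_l j_1…j_l} X^{i_1…i_l} Y^{j_1…j_l}`, at the point with coordinates `y` in
the chart `φ`, for contravariant tensors `X`, `Y` of rank `l` given by their components. -/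
def CovTensorField.pair {l : ℕ} (A : CovTensorField n M (l + l))
    (φ : OpenPartialHomeomorph M (E n)) (y : E n) (X Y : (Fin l → Fin n) → ℝ) : ℝ :=
  ∑ I : Fin l → Fin n, ∑ J : Fin l → Fin n, A.comp φ y (Fin.append I J) * X I * Y J

/-- `A(X, Y) = A(Y, X)` for all contravariant tensors `X`, `Y` of rank `l` at any point. -/
def CovTensorField.IsSymm {l : ℕ} (A : CovTensorField n M (l + l)) : Prop :=
  ∀ φ ∈ atlas (E n) M, ∀ y ∈ φ.target, ∀ X Y : (Fin l → Fin n) → ℝ,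
    A.pair φ y X Y = A.pair φ y Y X

section Riemannian

variable [IsManifold (𝓡 n) ∞ M]

/-- Smooth Riemannian metrics on `M`. -/
abbrev Metric (n : ℕ) (M : Type*) [TopologicalSpace M] [ChartedSpace (E n) M]
    [IsManifold (𝓡 n) ∞ M] : Type _ :=
  Bundle.ContMDiffRiemannianMetric (𝓡 n) ∞ (E n) (fun x : M => TangentSpace (𝓡 n) x)

/-- The components `g_{ij}` of the metric in the chart `φ`. -/
def coords (g : Metric n M) (φ : OpenPartialHomeomorph M (E n)) (y : E n) :
    Matrix (Fin n) (Fin n) ℝ :=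
  formMatrix g.inner φ y

/-- The Riemannian volume measure `dv_g`: in any chart it is `√(det g_{ij}) dy`. The measures given
by the charts agree on overlaps, and the supremum glues them. -/
def vol [MeasurableSpace M] (g : Metric n M) : Measure M :=
  ⨆ φ ∈ atlas (E n) M,
    ((volume.restrict φ.target).withDensity
      fun y => ENNReal.ofReal (√ (coords g φ y).det)).map φ.symm

/-- The Laplace-Beltrami operator `Δ_g = -div_g ∇` on functions on `M`. -/
def laplacian (g : Metric n M) (u : M → ℝ) (x : M) : ℝ :=
  localLaplacian (coords g (chartAt (E n) x)) (u ∘ (chartAt (E n) x).symm) (chartAt (E n) x x)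

/-- `(∇u, ∇v)_g`. -/
def gradInner (g : Metric n M) (u v : M → ℝ) (x : M) : ℝ :=
  let φ := chartAt (E n) x
  ∑ i, ∑ j, (coords g φ (φ x))⁻¹ i j *
    pderiv i (u ∘ φ.symm) (φ x) * pderiv j (v ∘ φ.symm) (φ x)

/-- `Δ_g^{k/2} u Δ_g^{k/2} v`, which for odd `k` means
`(∇ Δ_g^{(k-1)/2} u, ∇ Δ_g^{(k-1)/2} v)_g`. -/
def halfPowerProduct (g : Metric n M) (k : ℕ) (u v : M → ℝ) (x : M) : ℝ :=
  if Even k then (laplacian g)^[k / 2] u x * (laplacian g)^[k / 2] v x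
  else gradInner g ((laplacian g)^[(k - 1) / 2] u) ((laplacian g)^[(k - 1) / 2] v) x

/-- `∇^{j_l … j_1} (A_{i_1…i_l j_1…j_l} ∇^{i_1…i_l} u)`. -/
def divForm (g : Metric n M) {l : ℕ} (A : CovTensorField n M (l + l)) (u : M → ℝ) (x : M) : ℝ :=
  let φ := chartAt (E n) x
  iterDivergence (coords g φ) l
    (fun y J => ∑ I : Fin l → Fin n, A.comp φ y (Fin.append I J) *
      raise (coords g φ y) (iterCovDeriv (coords g φ) (u ∘ φ.symm) l y) I)
    (φ x)

/-- `A(∇^l u, ∇^l v)`, with the indices of `∇^l u` and `∇^l v` raised by the metric. -/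
def pairNabla (g : Metric n M) {l : ℕ} (A : CovTensorField n M (l + l)) (u v : M → ℝ)
    (x : M) : ℝ :=
  let φ := chartAt (E n) x
  A.pair φ (φ x)
    (raise (coords g φ (φ x)) (iterCovDeriv (coords g φ) (u ∘ φ.symm) l (φ x)))
    (raise (coords g φ (φ x)) (iterCovDeriv (coords g φ) (v ∘ φ.symm) l (φ x)))

/-! ## The ambient metric and the GJMS operators -/

/-- Index set for coordinates `(x, t, ρ)` on the ambient space: `Sum.inl i` stands for `x^i`,
`Sum.inr 0` for `t` and `Sum.inr 1` for `ρ`. -/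
abbrev AmbientIndex (n : ℕ) : Type := Fin n ⊕ Fin 2

/-- The point of the ambient space with coordinates `(y, t, ρ)`. -/
def ambientPoint (y : E n) (t ρ : ℝ) : EuclideanSpace ℝ (AmbientIndex n) :=
  WithLp.toLp 2 (Sum.elim (fun i => y i) ![t, ρ])

/-- The `M`-coordinates of a point of the ambient space. -/
def ambientBase (z : EuclideanSpace ℝ (AmbientIndex n)) : E n :=
  WithLp.toLp 2 fun i => z (Sum.inl i)

/-- The components of the metric `2ρ dt² + 2t dt dρ + t² h_ρ` on `ℝ₊ × M × ℝ`, in the coordinates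
given by a chart `φ` of `M`. -/
def ambientMatrix
    (h : ℝ → (x : M) → TangentSpace (𝓡 n) x →L[ℝ] TangentSpace (𝓡 n) x →L[ℝ] ℝ)
    (φ : OpenPartialHomeomorph M (E n)) (z : EuclideanSpace ℝ (AmbientIndex n)) :
    Matrix (AmbientIndex n) (AmbientIndex n) ℝ :=
  let t := z (Sum.inr 0)
  let ρ := z (Sum.inr 1)
  Matrix.fromBlocks (t ^ 2 • formMatrix (h ρ) φ (ambientBase z)) 0 0 !![2 * ρ, t; t, 0]

/-- A Fefferman-Graham ambient metric for `(M, g)`, in normal form relative to `g`: a metric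
`2ρ dt² + 2t dt dρ + t² h_ρ` on a neighbourhood of `ρ = 0` in `ℝ₊ × M × ℝ`, with `h_0 = g`, whose
Ricci curvature satisfies `Ric = O(ρ^∞)` if `n` is odd and `Ric = O⁺(ρ^{n/2-1})` if `n` is even.
The condition `S = O⁺(ρ^m)` means that all components are `O(ρ^m)` and that `S_{tt}`, `S_{ti}` and
the trace `g^{ij} S_{ij}` are `O(ρ^{m+1})`. Only the germ of `h` at `ρ = 0` matters. -/
structure AmbientMetric (g : Metric n M) where
  form : ℝ → (x : M) → TangentSpace (𝓡 n) x →L[ℝ] TangentSpace (𝓡 n) x →L[ℝ] ℝ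
  symm : ∀ ρ x v w, form ρ x v w = form ρ x w v
  smooth : ∀ φ ∈ atlas (E n) M, ∀ i j,
    ContDiffOn ℝ ∞ (fun p : ℝ × E n => formMatrix (form p.1) φ p.2 i j)
      (Set.univ ×ˢ φ.target)
  form_zero : ∀ x, form 0 x = g.inner x
  ricci_odd : Odd n → ∀ φ ∈ atlas (E n) M, ∀ y ∈ φ.target, ∀ t : ℝ, 0 < t → ∀ m : ℕ, ∀ a b,
    (fun ρ : ℝ => ricci (ambientMatrix form φ) a b (ambientPoint y t ρ)) =O[𝓝 0] fun ρ => ρ ^ m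
  ricci_even : Even n → ∀ φ ∈ atlas (E n) M, ∀ y ∈ φ.target, ∀ t : ℝ, 0 < t →
    (∀ a b, (fun ρ : ℝ => ricci (ambientMatrix form φ) a b (ambientPoint y t ρ))
      =O[𝓝 0] fun ρ => ρ ^ (n / 2 - 1)) ∧
    (fun ρ : ℝ => ricci (ambientMatrix form φ) (Sum.inr 0) (Sum.inr 0) (ambientPoint y t ρ))
      =O[𝓝 0] (fun ρ => ρ ^ (n / 2)) ∧
    (∀ i, (fun ρ : ℝ =>
        ricci (ambientMatrix form φ) (Sum.inr 0) (Sum.inl i) (ambientPoint y t ρ))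
      =O[𝓝 0] fun ρ => ρ ^ (n / 2)) ∧
    (fun ρ : ℝ => ∑ i, ∑ j, (coords g φ y)⁻¹ i j *
        ricci (ambientMatrix form φ) (Sum.inl i) (Sum.inl j) (ambientPoint y t ρ))
      =O[𝓝 0] fun ρ => ρ ^ (n / 2)

/-- The GJMS operator of order `2k`: `P_g f` is the restriction to `t = 1`, `ρ = 0` of
`Δ̃^k (t^{k - n/2} f)`, where `Δ̃` is the Laplacian (with the sign of `-div ∇`) of an ambient
metric of `g` and `f` is extended independently of `t` and `ρ`. -/
def gjms {g : Metric n M} (a : AmbientMetric g) (k : ℕ) (f : M → ℝ) (x : M) : ℝ :=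
  let φ := chartAt (E n) x
  (localLaplacian (ambientMatrix a.form φ))^[k]
    (fun z => z (Sum.inr 0) ^ ((k : ℝ) - (n : ℝ) / 2) * f (φ.symm (ambientBase z)))
    (ambientPoint (φ x) 1 0)

end Riemannian

end GJMS

end

/-!
The operator `P - Δ^k` is shown to be a formally self-adjoint differential operator of order at most
`2(k-1)`, and every such operator is put in divergence form; the integral identity then follows by
integration by parts.

**Self-adjointness.** On functions `t^γ w(ρ, y)`, the ambient Laplacian conjugated by
`(det h_ρ)^{1/4}` is, up to sign and a power of `t`, the operator
`D_s = -2ρ∂² + 2s∂ + M(ρ)` with `∂ = ∂_ρ`, `s = γ + n/2 - 1` and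
`M(ρ) = ∂_i (h_ρ^{ij} ∂_j) - V(ρ)` (`localLaplacian_ambient`). The Taylor coefficients `M_p` of `M(ρ)`
at `ρ = 0`, transplanted from half-densities to functions, are globally defined, of order at most
two and formally self-adjoint (`isOrd_coeffEnd`, `coeffEnd_selfAdjoint`). Since applying the ambient
Laplacian lowers the degree in `t` by two, `(-1)^k P u` is the value at `ρ = 0` of
`D_{1-k} ⋯ D_{k-3} D_{k-1}` applied to any extension of `u` in `ρ` (`gjms_eq_ladderCoeff`).

Consider the residue pairing `∮ ⟨f, g⟩ dρ` of Laurent polynomials in `ρ`. The adjoint of `D_s` is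
`D_{-s-2}` (`residuePairing_ladder`), so the adjoint of the chain is the chain of the `D_{s-2}`. On the
other hand a chain of `m` factors starting from `D_s` commutes with multiplication by `ρ` up to the
shift of `s` by two and an error proportional to `m(s - m + 1)` (`ladderChain_shift`), which vanishes
for `m = k`, `s = k - 1`. Together these give the self-adjointness of `P`
(`ladderChain_selfAdjoint`). In the expansion of the chain, `M_0^k` is the only term
without a factor `∂` that survives at `ρ = 0`; the others have at most `k - 1` factors `M_p`. As
`M_0 + Δ` is a function, `P - Δ^k` has order at most `2(k-1)` (`isOrd_gjmsEnd_sub`).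

**Divergence form.** Differential operators are handled through their action on the powers of the
maximal ideals of `C^∞(M)` (`IsOrd`). The principal symbol of an operator `Q` of order `2l` is a
symmetric tensor, smooth by `contDiffOn_symbolForm`; subtracting the divergence form operator with
this coefficient lowers the order. If `Q` is self-adjoint, so is the difference, and a self-adjoint
operator of odd order at most `2l - 1` has order at most `2l - 2` (`IsOrd.of_adjoint`). Induction on
`l` gives `exists_divergence_form`.

**Integration.** The integral identity combines `l2Pairing_divFormEnd`, which moves the divergences
onto the other function, with the corresponding identity for `Δ^k` (`integral_halfPowerProduct`).
-/

noncomputable section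

namespace GJMS

/-! ### Partial derivatives -/

set_option linter.unusedSectionVars false

section Coordinates

variable {ι : Type} [Fintype ι] [DecidableEq ι]

theorem _root_.ContDiffAt.pderiv {f : EuclideanSpace ℝ ι → ℝ} {y : EuclideanSpace ℝ ι}
    (hf : ContDiffAt ℝ ∞ f y) (i : ι) : ContDiffAt ℝ ∞ (pderiv i f) y :=
  (hf.fderiv_right (m := ∞) (by simp)).clm_apply contDiffAt_const

theorem diffAt {f : EuclideanSpace ℝ ι → ℝ} {y : EuclideanSpace ℝ ι}
    (hf : ContDiffAt ℝ ∞ f y) : DifferentiableAt ℝ f y :=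
  hf.differentiableAt (by simp)

theorem pderiv_congr {f g : EuclideanSpace ℝ ι → ℝ} {y : EuclideanSpace ℝ ι}
    (h : f =ᶠ[𝓝 y] g) (i : ι) : pderiv i f y = pderiv i g y := by
  simp only [pderiv, h.fderiv_eq]

theorem pderiv_eventuallyEq {f g : EuclideanSpace ℝ ι → ℝ} {y : EuclideanSpace ℝ ι}
    (h : f =ᶠ[𝓝 y] g) (i : ι) : pderiv i f =ᶠ[𝓝 y] pderiv i g :=
  h.eventuallyEq_nhds.mono fun _ hz => pderiv_congr hz i

variable {f g : EuclideanSpace ℝ ι → ℝ} {y : EuclideanSpace ℝ ι}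

@[simp] theorem pderiv_const (i : ι) (c : ℝ) : pderiv i (fun _ => c) y = 0 := by
  simp [pderiv]

theorem pderiv_add (hf : DifferentiableAt ℝ f y) (hg : DifferentiableAt ℝ g y) (i : ι) :
    pderiv i (fun z => f z + g z) y = pderiv i f y + pderiv i g y := by
  simp only [pderiv]; rw [fderiv_fun_add hf hg]; simp

theorem pderiv_sub (hf : DifferentiableAt ℝ f y) (hg : DifferentiableAt ℝ g y) (i : ι) :
    pderiv i (fun z => f z - g z) y = pderiv i f y - pderiv i g y := by
  simp only [pderiv]; rw [fderiv_fun_sub hf hg]; simp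

theorem pderiv_mul (hf : DifferentiableAt ℝ f y) (hg : DifferentiableAt ℝ g y) (i : ι) :
    pderiv i (fun z => f z * g z) y = pderiv i f y * g y + f y * pderiv i g y := by
  simp only [pderiv]; rw [fderiv_fun_mul hf hg]; simp; ring

theorem pderiv_const_mul (c : ℝ) (hf : DifferentiableAt ℝ f y) (i : ι) :
    pderiv i (fun z => c * f z) y = c * pderiv i f y := by
  rw [pderiv_mul (by fun_prop) hf]; simp

theorem pderiv_sum {α : Type*} (s : Finset α) {F : α → EuclideanSpace ℝ ι → ℝ}
    (hF : ∀ a ∈ s, DifferentiableAt ℝ (F a) y) (i : ι) :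
    pderiv i (fun z => ∑ a ∈ s, F a z) y = ∑ a ∈ s, pderiv i (F a) y := by
  simp only [pderiv]; rw [fderiv_fun_sum hF]; simp

theorem pderiv_pow (hf : DifferentiableAt ℝ f y) (m : ℕ) (i : ι) :
    pderiv i (fun z => f z ^ m) y = m * f y ^ (m - 1) * pderiv i f y := by
  simp only [pderiv]; rw [fderiv_fun_pow m hf]; simp

theorem pderiv_prod {α : Type*} [DecidableEq α] (s : Finset α)
    {F : α → EuclideanSpace ℝ ι → ℝ} (hF : ∀ a ∈ s, DifferentiableAt ℝ (F a) y) (i : ι) :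
    pderiv i (fun z => ∏ a ∈ s, F a z) y =
      ∑ a ∈ s, (∏ b ∈ s.erase a, F b y) * pderiv i (F a) y := by
  simp only [pderiv]; rw [fderiv_finsetProd hF]; simp

theorem pderiv_comp_deriv {φ : ℝ → ℝ} {φ' : ℝ} (hφ : HasDerivAt φ φ' (f y))
    (hf : DifferentiableAt ℝ f y) (i : ι) :
    pderiv i (fun z => φ (f z)) y = φ' * pderiv i f y := by
  simp only [pderiv]
  have := (hφ.comp_hasFDerivAt y hf.hasFDerivAt).fderiv
  simp only [Function.comp_def] at this
  rw [this]; simp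

theorem pderiv_comm (hf : ContDiffAt ℝ ∞ f y) (i j : ι) :
    pderiv i (pderiv j f) y = pderiv j (pderiv i f) y := by
  have h2 : IsSymmSndFDerivAt ℝ f y := hf.isSymmSndFDerivAt (by
    rw [minSmoothness_of_isRCLikeNormedField]; exact WithTop.coe_le_coe.2 le_top)
  have hd : DifferentiableAt ℝ (fderiv ℝ f) y :=
    (hf.fderiv_right (m := ∞) (by simp)).differentiableAt (by simp)
  have key : ∀ i j : ι, pderiv i (pderiv j f) y =
      fderiv ℝ (fderiv ℝ f) y (EuclideanSpace.single i 1) (EuclideanSpace.single j 1) := by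
    intro i j
    simp only [pderiv]
    change fderiv ℝ (fun z => fderiv ℝ f z (EuclideanSpace.single j 1)) y _ = _
    rw [fderiv_clm_apply hd (by fun_prop)]
    simp
  rw [key, key]
  exact h2 _ _

/-- The coordinate functions of a differentiable map into a Euclidean space. -/
theorem fderiv_apply_coord {κ : Type} [Fintype κ] [DecidableEq κ]
    {τ : EuclideanSpace ℝ ι → EuclideanSpace ℝ κ} (hτ : DifferentiableAt ℝ τ y) (i : ι) (a : κ) :
    fderiv ℝ τ y (EuclideanSpace.single i 1) a = pderiv i (fun z => τ z a) y := by
  have h : HasFDerivAt (fun z => τ z a) ((EuclideanSpace.proj a).comp (fderiv ℝ τ y)) y :=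
    (EuclideanSpace.proj (𝕜 := ℝ) a).hasFDerivAt.comp y hτ.hasFDerivAt
  simp only [pderiv, h.fderiv]
  rfl

theorem sum_single_smul {κ : Type} [Fintype κ] [DecidableEq κ] (v : EuclideanSpace ℝ κ) :
    v = ∑ a, v a • EuclideanSpace.single a (1 : ℝ) := by
  ext b
  simp [Finset.sum_apply, Pi.single_apply]

theorem pderiv_comp {κ : Type} [Fintype κ] [DecidableEq κ]
    {τ : EuclideanSpace ℝ ι → EuclideanSpace ℝ κ} {F : EuclideanSpace ℝ κ → ℝ}
    (hF : DifferentiableAt ℝ F (τ y)) (hτ : DifferentiableAt ℝ τ y) (i : ι) :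
    pderiv i (fun z => F (τ z)) y = ∑ a, pderiv i (fun z => τ z a) y * pderiv a F (τ y) := by
  have h := (hF.hasFDerivAt.comp y hτ.hasFDerivAt).fderiv
  simp only [Function.comp_def] at h
  simp only [pderiv, h, ContinuousLinearMap.comp_apply]
  conv_lhs => rw [sum_single_smul (fderiv ℝ τ y (EuclideanSpace.single i 1))]
  simp only [map_sum, map_smul, smul_eq_mul, fderiv_apply_coord hτ]
  rfl

theorem pderiv_coord (i j : ι) : pderiv i (fun z => z j) y = if j = i then 1 else 0 := by
  have : HasFDerivAt (fun z : EuclideanSpace ℝ ι => z j) (EuclideanSpace.proj (𝕜 := ℝ) j) y :=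
    (EuclideanSpace.proj (𝕜 := ℝ) j).hasFDerivAt
  simp [pderiv, this.fderiv]

/-! ### Smooth matrix fields -/

variable {G : EuclideanSpace ℝ ι → Matrix ι ι ℝ}

theorem contDiffAt_det {V : Type*} [NormedAddCommGroup V] [NormedSpace ℝ V]
    {G : V → Matrix ι ι ℝ} {y : V} (hG : ∀ i j, ContDiffAt ℝ ∞ (fun z => G z i j) y) :
    ContDiffAt ℝ ∞ (fun z => (G z).det) y := by
  simp only [Matrix.det_apply]
  refine ContDiffAt.sum fun σ _ => ?_
  refine ContDiffAt.const_smul _ ?_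
  exact contDiffAt_prod fun i _ => hG _ _

theorem contDiffAt_inv {V : Type*} [NormedAddCommGroup V] [NormedSpace ℝ V]
    {G : V → Matrix ι ι ℝ} {y : V} (hG : ∀ i j, ContDiffAt ℝ ∞ (fun z => G z i j) y)
    (h0 : (G y).det ≠ 0) (i j : ι) : ContDiffAt ℝ ∞ (fun z => (G z)⁻¹ i j) y := by
  simp only [Matrix.inv_def, Ring.inverse_eq_inv', Matrix.smul_apply, smul_eq_mul,
    Matrix.adjugate_apply]
  refine ((contDiffAt_det hG).inv h0).mul (contDiffAt_det fun a b => ?_)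
  by_cases h : a = j
  · subst h; simp only [Matrix.updateRow_self]; exact contDiffAt_const
  · simp only [Matrix.updateRow_ne h]; exact hG a b

/-- Jacobi's formula. -/
theorem pderiv_det (hG : ∀ i j, ContDiffAt ℝ ∞ (fun z => G z i j) y) (h0 : (G y).det ≠ 0)
    (l : ι) : pderiv l (fun z => (G z).det) y =
      (G y).det * ∑ i, ∑ j, (G y)⁻¹ j i * pderiv l (fun z => G z i j) y := by
  have h1 : pderiv l (fun z => (G z).det) y =
      ∑ j, ((G y).updateCol j fun i => pderiv l (fun z => G z i j) y).det := by
    simp only [Matrix.det_apply']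
    rw [pderiv_sum _ fun σ _ => diffAt (contDiffAt_const.mul (contDiffAt_prod fun i _ => hG _ _)),
      Finset.sum_comm]
    refine Finset.sum_congr rfl fun σ _ => ?_
    rw [pderiv_const_mul _ (diffAt (contDiffAt_prod fun i _ => hG _ _)),
      pderiv_prod _ (fun i _ => diffAt (hG _ _)), Finset.mul_sum]
    refine Finset.sum_congr rfl fun j _ => ?_
    rw [← Finset.mul_prod_erase _ _ (Finset.mem_univ j), Matrix.updateCol_self, mul_comm (pderiv _ _ _)]
    congr 2
    refine Finset.prod_congr rfl fun b hb => ?_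
    rw [Matrix.updateCol_ne (Finset.ne_of_mem_erase hb)]
  rw [h1, Finset.sum_comm, Finset.mul_sum]
  refine Finset.sum_congr rfl fun j _ => ?_
  rw [← Matrix.cramer_apply, Matrix.cramer_eq_adjugate_mulVec, Finset.mul_sum]
  refine Finset.sum_congr rfl fun i _ => ?_
  rw [Matrix.inv_def, Matrix.smul_apply, Ring.inverse_eq_inv', smul_eq_mul]
  field_simp

/-- `G` is a smooth field of symmetric invertible matrices on the open set `Ω`. -/
structure IsMetricOn (G : EuclideanSpace ℝ ι → Matrix ι ι ℝ) (Ω : Set (EuclideanSpace ℝ ι)) :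
    Prop where
  isOpen : IsOpen Ω
  smooth : ∀ y ∈ Ω, ∀ i j, ContDiffAt ℝ ∞ (fun z => G z i j) y
  symm : ∀ y ∈ Ω, ∀ i j, G y i j = G y j i
  det_ne : ∀ y ∈ Ω, (G y).det ≠ 0

namespace IsMetricOn

variable {Ω : Set (EuclideanSpace ℝ ι)} (hG : IsMetricOn G Ω)
include hG

theorem eventually (hy : y ∈ Ω) : ∀ᶠ z in 𝓝 y, z ∈ Ω := hG.isOpen.mem_nhds hy

theorem smooth_inv (hy : y ∈ Ω) (i j : ι) : ContDiffAt ℝ ∞ (fun z => (G z)⁻¹ i j) y :=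
  contDiffAt_inv (hG.smooth y hy) (hG.det_ne y hy) i j

theorem inv_symm (hy : y ∈ Ω) (i j : ι) : (G y)⁻¹ i j = (G y)⁻¹ j i := by
  have h : (G y).transpose = G y := by ext a b; exact hG.symm y hy b a
  conv_lhs => rw [← h, ← Matrix.transpose_nonsing_inv]
  rfl

theorem inv_mul (hy : y ∈ Ω) : (G y)⁻¹ * G y = 1 :=
  Matrix.nonsing_inv_mul _ (isUnit_iff_ne_zero.2 (hG.det_ne y hy))

theorem mul_inv (hy : y ∈ Ω) : G y * (G y)⁻¹ = 1 :=
  Matrix.mul_nonsing_inv _ (isUnit_iff_ne_zero.2 (hG.det_ne y hy))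

theorem pderiv_symm (hy : y ∈ Ω) (l i j : ι) :
    pderiv l (fun z => G z i j) y = pderiv l (fun z => G z j i) y :=
  pderiv_congr ((hG.eventually hy).mono fun z hz => hG.symm z hz i j) l

theorem pderiv_inv (hy : y ∈ Ω) (l i j : ι) : pderiv l (fun z => (G z)⁻¹ i j) y =
    -∑ a, ∑ b, (G y)⁻¹ i a * pderiv l (fun z => G z a b) y * (G y)⁻¹ b j := by
  have h1 : ∀ c, ∑ a, (pderiv l (fun z => (G z)⁻¹ i a) y * G y a c
      + (G y)⁻¹ i a * pderiv l (fun z => G z a c) y) = 0 := by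
    intro c
    have h2 : (fun z => ∑ a, (G z)⁻¹ i a * G z a c) =ᶠ[𝓝 y]
        fun _ => (1 : Matrix ι ι ℝ) i c := by
      filter_upwards [hG.eventually hy] with z hz
      rw [← hG.inv_mul hz, Matrix.mul_apply]
    have h3 := pderiv_congr h2 l
    rw [pderiv_const, pderiv_sum _ fun a _ =>
      diffAt ((hG.smooth_inv hy i a).mul (hG.smooth y hy a c))] at h3
    rw [← h3]
    exact Finset.sum_congr rfl fun a _ =>
      (pderiv_mul (diffAt (hG.smooth_inv hy i a)) (diffAt (hG.smooth y hy a c)) l).symm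
  have h4 : ∑ c, (∑ a, pderiv l (fun z => (G z)⁻¹ i a) y * G y a c) * (G y)⁻¹ c j =
      pderiv l (fun z => (G z)⁻¹ i j) y := by
    simp only [Finset.sum_mul]
    rw [Finset.sum_comm]
    simp only [mul_assoc, ← Finset.mul_sum]
    have : ∀ a, ∑ c, G y a c * (G y)⁻¹ c j = (1 : Matrix ι ι ℝ) a j := by
      intro a; rw [← hG.mul_inv hy, Matrix.mul_apply]
    simp [this, Matrix.one_apply]
  rw [← h4]
  simp only [Finset.sum_add_distrib] at h1
  simp only [fun c => eq_neg_of_add_eq_zero_left (h1 c)]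
  simp only [neg_mul, Finset.sum_neg_distrib, Finset.sum_mul]
  rw [Finset.sum_comm]

theorem christoffel_smooth (hy : y ∈ Ω) (m i j : ι) : ContDiffAt ℝ ∞ (christoffel G m i j) y := by
  unfold christoffel
  refine contDiffAt_const.mul (ContDiffAt.sum fun l _ => (hG.smooth_inv hy m l).mul ?_)
  exact (((hG.smooth y hy j l).pderiv i).add ((hG.smooth y hy i l).pderiv j)).sub
    ((hG.smooth y hy i j).pderiv l)

/-- The Christoffel symbols of the first kind. -/
theorem lower_christoffel (hy : y ∈ Ω) (l i j : ι) : ∑ m, G y l m * christoffel G m i j y =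
    (1 / 2 : ℝ) * (pderiv i (fun z => G z j l) y + pderiv j (fun z => G z i l) y
      - pderiv l (fun z => G z i j) y) := by
  simp only [christoffel, Finset.mul_sum]
  rw [Finset.sum_comm]
  have : ∀ k, ∑ m, G y l m * (G y)⁻¹ m k = (1 : Matrix ι ι ℝ) l k := fun k => by
    rw [← hG.mul_inv hy, Matrix.mul_apply]
  calc _ = ∑ k, (∑ m, G y l m * (G y)⁻¹ m k) * ((1 / 2 : ℝ) *
        (pderiv i (fun z => G z j k) y + pderiv j (fun z => G z i k) y
          - pderiv k (fun z => G z i j) y)) := by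
        refine Finset.sum_congr rfl fun k _ => ?_
        rw [Finset.sum_mul]
        exact Finset.sum_congr rfl fun m _ => by ring
    _ = _ := by simp [this, Matrix.one_apply]

/-- The inverse metric is parallel. -/
theorem pderiv_inv_eq_christoffel (hy : y ∈ Ω) (l i j : ι) :
    pderiv l (fun z => (G z)⁻¹ i j) y = -(∑ m, christoffel G i l m y * (G y)⁻¹ m j)
      - ∑ m, christoffel G j l m y * (G y)⁻¹ i m := by
  have h1 : ∀ a b, pderiv l (fun z => G z a b) y =
      ∑ k, G y a k * christoffel G k l b y + ∑ k, G y b k * christoffel G k l a y := by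
    intro a b
    rw [hG.lower_christoffel hy, hG.lower_christoffel hy, hG.pderiv_symm hy l b a,
      hG.pderiv_symm hy b l a, hG.pderiv_symm hy b a l]
    ring_nf
  have h2 : ∀ i k, ∑ a, (G y)⁻¹ i a * G y a k = if i = k then 1 else 0 := fun i k => by
    have := hG.inv_mul hy
    rw [← Matrix.mul_apply, this, Matrix.one_apply]
  have h3 : ∑ a, ∑ b, (G y)⁻¹ i a * (∑ k, G y a k * christoffel G k l b y) * (G y)⁻¹ b j =
      ∑ m, christoffel G i l m y * (G y)⁻¹ m j := by
    rw [Finset.sum_comm]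
    refine Finset.sum_congr rfl fun b _ => ?_
    rw [← Finset.sum_mul]
    congr 1
    simp only [Finset.mul_sum]
    rw [Finset.sum_comm]
    simp only [← mul_assoc, ← Finset.sum_mul, h2]
    simp
  have h4 : ∑ a, ∑ b, (G y)⁻¹ i a * (∑ k, G y b k * christoffel G k l a y) * (G y)⁻¹ b j =
      ∑ m, christoffel G j l m y * (G y)⁻¹ i m := by
    refine Finset.sum_congr rfl fun a _ => ?_
    have h5 : ∀ b, (G y)⁻¹ i a * (∑ k, G y b k * christoffel G k l a y) * (G y)⁻¹ b j =
        ∑ k, ((G y)⁻¹ j b * G y b k) * (christoffel G k l a y * (G y)⁻¹ i a) := by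
      intro b
      rw [hG.inv_symm hy b j, Finset.mul_sum, Finset.sum_mul]
      exact Finset.sum_congr rfl fun k _ => by ring
    simp only [h5]
    rw [Finset.sum_comm]
    simp only [← Finset.sum_mul, h2]
    simp
  rw [hG.pderiv_inv hy]
  simp only [h1, mul_add, add_mul, Finset.sum_add_distrib, h3, h4]
  ring

end IsMetricOn

/-- A density of `G`: a function with the logarithmic derivative of `√|det G|`. -/
def IsDensityOn (G : EuclideanSpace ℝ ι → Matrix ι ι ℝ) (Ω : Set (EuclideanSpace ℝ ι))
    (μ : EuclideanSpace ℝ ι → ℝ) : Prop :=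
  ∀ y ∈ Ω, ContDiffAt ℝ ∞ μ y ∧ 0 < μ y ∧
    ∀ l, pderiv l μ y = μ y * ((1 / 2 : ℝ) * ∑ i, ∑ j, (G y)⁻¹ i j * pderiv l (fun z => G z i j) y)

/-- A positive square root of a constant multiple of `det G` is a density. The constant `ε` covers
indefinite signatures, where `det G` may be negative. -/
theorem IsMetricOn.isDensityOn {Ω : Set (EuclideanSpace ℝ ι)} (hG : IsMetricOn G Ω) {ε : ℝ}
    {μ : EuclideanSpace ℝ ι → ℝ}
    (hμ : ∀ y ∈ Ω, ContDiffAt ℝ ∞ μ y ∧ 0 < μ y ∧ μ y ^ 2 = ε * (G y).det) :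
    IsDensityOn G Ω μ := by
  intro y hy
  obtain ⟨h1, h2, h3⟩ := hμ y hy
  refine ⟨h1, h2, fun l => ?_⟩
  have h4 : (fun z => μ z ^ 2) =ᶠ[𝓝 y] fun z => ε * (G z).det :=
    (hG.eventually hy).mono fun z hz => (hμ z hz).2.2
  have h5 := pderiv_congr h4 l
  rw [pderiv_pow (diffAt h1), pderiv_const_mul _ (diffAt (contDiffAt_det (hG.smooth y hy))),
    pderiv_det (hG.smooth y hy) (hG.det_ne y hy), ← mul_assoc, ← h3] at h5
  have h6 : ∑ i, ∑ j, (G y)⁻¹ j i * pderiv l (fun z => G z i j) y =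
      ∑ i, ∑ j, (G y)⁻¹ i j * pderiv l (fun z => G z i j) y :=
    Finset.sum_congr rfl fun i _ => Finset.sum_congr rfl fun j _ => by rw [hG.inv_symm hy]
  rw [h6] at h5
  have : μ y ≠ 0 := h2.ne'
  norm_num at h5
  field_simp
  apply mul_left_cancel₀ this
  linarith

/-- The contracted Christoffel symbols `G^{ab} Γ^m_{ab}` in terms of a density. -/
theorem IsMetricOn.contracted_christoffel {Ω : Set (EuclideanSpace ℝ ι)} (hG : IsMetricOn G Ω)
    {μ : EuclideanSpace ℝ ι → ℝ} (hμ : IsDensityOn G Ω μ) (hy : y ∈ Ω) (m : ι) :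
    μ y * ∑ a, ∑ b, (G y)⁻¹ a b * christoffel G m a b y =
      -∑ a, pderiv a (fun z => μ z * (G z)⁻¹ a m) y := by
  obtain ⟨h1, h2, h3⟩ := hμ y hy
  have h4 : ∀ a, pderiv a (fun z => μ z * (G z)⁻¹ a m) y =
      μ y * ((1 / 2 : ℝ) * ∑ i, ∑ j, (G y)⁻¹ i j * pderiv a (fun z => G z i j) y * (G y)⁻¹ a m) -
      μ y * ∑ i, ∑ j, (G y)⁻¹ a i * pderiv a (fun z => G z i j) y * (G y)⁻¹ j m := by
    intro a
    rw [pderiv_mul (diffAt h1) (diffAt (hG.smooth_inv hy a m)), h3, hG.pderiv_inv hy]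
    simp only [Finset.mul_sum, Finset.sum_mul, mul_neg, sub_eq_add_neg]
    congr 1
    exact Finset.sum_congr rfl fun i _ => Finset.sum_congr rfl fun j _ => by ring
  simp only [h4, Finset.sum_sub_distrib, ← Finset.mul_sum, ← mul_sub]
  set K := (G y)⁻¹ with hK
  have hKs : ∀ i j, K i j = K j i := hG.inv_symm hy
  set D : ι → ι → ι → ℝ := fun l i j => pderiv l (fun z => G z i j) y with hD
  have hDs : ∀ l i j, D l i j = D l j i := hG.pderiv_symm hy
  have e1 : ∑ a, ∑ b, K a b * christoffel G m a b y =
      (1 / 2) * ((∑ a, ∑ b, ∑ l, K a b * K m l * D a b l + ∑ a, ∑ b, ∑ l, K a b * K m l * D b a l)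
        - ∑ a, ∑ b, ∑ l, K a b * K m l * D l a b) := by
    simp only [christoffel, ← hK, Finset.mul_sum, ← Finset.sum_add_distrib,
      ← Finset.sum_sub_distrib]
    refine Finset.sum_congr rfl fun a _ => Finset.sum_congr rfl fun b _ =>
      Finset.sum_congr rfl fun l _ => ?_
    simp only [hD]; ring
  have e2 : ∑ a, ∑ b, ∑ l, K a b * K m l * D b a l = ∑ a, ∑ b, ∑ l, K a b * K m l * D a b l := by
    rw [Finset.sum_comm]
    exact Finset.sum_congr rfl fun a _ => Finset.sum_congr rfl fun b _ =>
      Finset.sum_congr rfl fun l _ => by rw [hKs]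
  have e3 : ∑ a, ∑ i, ∑ j, K a i * D a i j * K j m = ∑ a, ∑ b, ∑ l, K a b * K m l * D a b l :=
    Finset.sum_congr rfl fun a _ => Finset.sum_congr rfl fun b _ =>
      Finset.sum_congr rfl fun l _ => by rw [hKs l m]; ring
  have e4 : ∑ a, ∑ i, ∑ j, K i j * D a i j * K a m = ∑ a, ∑ b, ∑ l, K a b * K m l * D l a b := by
    rw [Finset.sum_comm]
    refine Finset.sum_congr rfl fun a _ => ?_
    rw [Finset.sum_comm]
    exact Finset.sum_congr rfl fun b _ => Finset.sum_congr rfl fun l _ => by rw [hKs l m]; ring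
  rw [e1, e2, e3, e4]
  ring

/-- The divergence of a one-form in terms of a density. -/
theorem IsMetricOn.divergence_eq {Ω : Set (EuclideanSpace ℝ ι)} (hG : IsMetricOn G Ω)
    {μ : EuclideanSpace ℝ ι → ℝ} (hμ : IsDensityOn G Ω μ) (hy : y ∈ Ω)
    {X : ι → EuclideanSpace ℝ ι → ℝ} (hX : ∀ b, ContDiffAt ℝ ∞ (X b) y) :
    μ y * ∑ a, ∑ b, (G y)⁻¹ a b * (pderiv a (X b) y - ∑ m, christoffel G m a b y * X m y) =
      ∑ a, pderiv a (fun z => ∑ b, μ z * (G z)⁻¹ a b * X b z) y := by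
  have h1 : ∀ a, pderiv a (fun z => ∑ b, μ z * (G z)⁻¹ a b * X b z) y =
      ∑ b, (pderiv a (fun z => μ z * (G z)⁻¹ a b) y * X b y +
        μ y * (G y)⁻¹ a b * pderiv a (X b) y) := by
    intro a
    have hs : ∀ b, ContDiffAt ℝ ∞ (fun z => μ z * (G z)⁻¹ a b) y := fun b =>
      (hμ y hy).1.mul (hG.smooth_inv hy a b)
    rw [pderiv_sum _ fun b _ => diffAt ((hs b).mul (hX b))]
    exact Finset.sum_congr rfl fun b _ => pderiv_mul (diffAt (hs b)) (diffAt (hX b)) a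
  simp only [h1, Finset.sum_add_distrib]
  have h2 : ∑ a, ∑ b, pderiv a (fun z => μ z * (G z)⁻¹ a b) y * X b y =
      -∑ m, (μ y * ∑ a, ∑ b, (G y)⁻¹ a b * christoffel G m a b y) * X m y := by
    rw [Finset.sum_comm, ← Finset.sum_neg_distrib]
    refine Finset.sum_congr rfl fun m _ => ?_
    rw [hG.contracted_christoffel hμ hy, ← Finset.sum_mul]; ring
  rw [h2]
  simp only [mul_sub, Finset.sum_sub_distrib, Finset.mul_sum, Finset.sum_mul]
  rw [neg_add_eq_sub]
  congr 1
  · exact Finset.sum_congr rfl fun a _ => Finset.sum_congr rfl fun b _ => by ring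
  · conv_rhs => rw [Finset.sum_comm]; enter [2, a]; rw [Finset.sum_comm]
    exact Finset.sum_congr rfl fun a _ => Finset.sum_congr rfl fun b _ =>
      Finset.sum_congr rfl fun m _ => by ring

theorem localLaplacian_eq_sum (G : EuclideanSpace ℝ ι → Matrix ι ι ℝ)
    (u : EuclideanSpace ℝ ι → ℝ) (y : EuclideanSpace ℝ ι) :
    localLaplacian G u y = -∑ a, ∑ b, (G y)⁻¹ a b *
      (pderiv a (pderiv b u) y - ∑ m, christoffel G m a b y * pderiv m u y) := by
  simp only [localLaplacian, iterDivergence, iterCovDeriv, divergence, covDeriv]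
  simp [Fin.tail, Function.update]

theorem localLaplacian_congr {u v : EuclideanSpace ℝ ι → ℝ} (h : u =ᶠ[𝓝 y] v) :
    localLaplacian G u y = localLaplacian G v y := by
  simp only [localLaplacian_eq_sum]
  congr 1
  refine Finset.sum_congr rfl fun a _ => Finset.sum_congr rfl fun b _ => ?_
  rw [pderiv_congr (pderiv_eventuallyEq h b)]
  simp only [pderiv_congr h]

/-- The Laplacian conjugated by the square root `θ` of a density becomes the formally self-adjoint
flat operator `∂_a (G^{ab} ∂_b ψ)` up to a term of order zero. -/
theorem IsMetricOn.localLaplacian_halfDensity {Ω : Set (EuclideanSpace ℝ ι)}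
    (hG : IsMetricOn G Ω) {θ : EuclideanSpace ℝ ι → ℝ} (hθ : IsDensityOn G Ω fun z => θ z ^ 2)
    (hθs : ∀ y ∈ Ω, ContDiffAt ℝ ∞ θ y ∧ 0 < θ y) (hy : y ∈ Ω)
    {ψ : EuclideanSpace ℝ ι → ℝ} (hψ : ContDiffAt ℝ ∞ ψ y) :
    θ y * localLaplacian G (fun z => (θ z)⁻¹ * ψ z) y =
      -(∑ a, ∑ b, pderiv a (fun z => (G z)⁻¹ a b * pderiv b ψ z) y
        - (∑ a, ∑ b, pderiv a (fun z => (G z)⁻¹ a b * pderiv b θ z) y) / θ y * ψ y) := by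
  obtain ⟨hs, hp⟩ := hθs y hy
  have hinv : ContDiffAt ℝ ∞ (fun z => (θ z)⁻¹ * ψ z) y := (hs.inv hp.ne').mul hψ
  have h1 := hG.divergence_eq hθ hy (X := fun b => pderiv b fun z => (θ z)⁻¹ * ψ z)
    fun b => hinv.pderiv b
  have hψe : ∀ᶠ z in 𝓝 y, DifferentiableAt ℝ ψ z :=
    ((hψ.of_le (m := 1) (by simp)).eventually (by simp)).mono
      fun z hz => hz.differentiableAt (by simp)
  have h2 : ∀ a b, (fun z => θ z ^ 2 * (G z)⁻¹ a b * pderiv b (fun z => (θ z)⁻¹ * ψ z) z) =ᶠ[𝓝 y]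
      fun z => θ z * ((G z)⁻¹ a b * pderiv b ψ z) - ψ z * ((G z)⁻¹ a b * pderiv b θ z) := by
    intro a b
    filter_upwards [hG.eventually hy, hψe] with z hz hz2
    obtain ⟨hs, hp⟩ := hθs z hz
    have hi : DifferentiableAt ℝ (fun z => (θ z)⁻¹) z := diffAt (hs.inv hp.ne')
    rw [pderiv_mul hi hz2, pderiv_comp_deriv (hasDerivAt_inv hp.ne') (diffAt hs)]
    field_simp
    ring
  have h3 : ∀ a b, pderiv a (fun z => θ z ^ 2 * (G z)⁻¹ a b *
      pderiv b (fun z => (θ z)⁻¹ * ψ z) z) y =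
      θ y * pderiv a (fun z => (G z)⁻¹ a b * pderiv b ψ z) y
      - ψ y * pderiv a (fun z => (G z)⁻¹ a b * pderiv b θ z) y
      + (pderiv a θ y * ((G y)⁻¹ a b * pderiv b ψ y)
        - pderiv a ψ y * ((G y)⁻¹ a b * pderiv b θ y)) := by
    intro a b
    have s1 : DifferentiableAt ℝ (fun z => (G z)⁻¹ a b * pderiv b ψ z) y :=
      diffAt ((hG.smooth_inv hy a b).mul (hψ.pderiv b))
    have s2 : DifferentiableAt ℝ (fun z => (G z)⁻¹ a b * pderiv b θ z) y :=
      diffAt ((hG.smooth_inv hy a b).mul (hs.pderiv b))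
    rw [pderiv_congr (h2 a b), pderiv_sub ((diffAt hs).fun_mul s1) ((diffAt hψ).fun_mul s2),
      pderiv_mul (diffAt hs) s1, pderiv_mul (diffAt hψ) s2]
    ring
  have h4 : ∑ a, ∑ b, (pderiv a θ y * ((G y)⁻¹ a b * pderiv b ψ y)
        - pderiv a ψ y * ((G y)⁻¹ a b * pderiv b θ y)) = 0 := by
    simp only [Finset.sum_sub_distrib]
    rw [sub_eq_zero, Finset.sum_comm]
    refine Finset.sum_congr rfl fun a _ => Finset.sum_congr rfl fun b _ => ?_
    rw [hG.inv_symm hy]; ring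
  have hs2 : ∀ a b, DifferentiableAt ℝ (fun z => θ z ^ 2 * (G z)⁻¹ a b *
      pderiv b (fun z => (θ z)⁻¹ * ψ z) z) y := fun a b =>
    diffAt (((hs.pow 2).mul (hG.smooth_inv hy a b)).mul (hinv.pderiv b))
  simp only [pderiv_sum _ fun b _ => hs2 _ b, h3, Finset.sum_add_distrib] at h1
  rw [h4, add_zero] at h1
  simp only [Finset.sum_sub_distrib, ← Finset.mul_sum] at h1
  rw [localLaplacian_eq_sum]
  simp only [Finset.sum_sub_distrib, mul_sub] at h1 ⊢
  apply mul_left_cancel₀ hp.ne'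
  have h5 : ∀ c d : ℝ, θ y * (-(c - d / θ y * ψ y)) = ψ y * d - θ y * c := fun c d => by
    field_simp
    ring
  rw [h5]
  linear_combination -h1

end Coordinates

section CoordinateChange

variable {ι : Type} [Fintype ι] [DecidableEq ι]

/-! ### Sums over multi-indices -/

theorem sum_cons {β : Type*} [AddCommMonoid β] {q : ℕ} (F : (Fin (q + 1) → ι) → β) :
    ∑ K, F K = ∑ a, ∑ K : Fin q → ι, F (Fin.cons a K) := by
  rw [← Fintype.sum_prod_type']
  exact (Fintype.sum_equiv (Fin.consEquiv fun _ => ι) _ _ fun x => rfl).symm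

theorem sum_append {β : Type*} [AddCommMonoid β] {p q : ℕ} (F : (Fin (p + q) → ι) → β) :
    ∑ K, F K = ∑ I : Fin p → ι, ∑ J : Fin q → ι, F (Fin.append I J) := by
  rw [← Fintype.sum_prod_type']
  exact (Fintype.sum_equiv (Fin.appendEquiv p q) _ _ fun x => rfl).symm

theorem prod_sum_multi {q : ℕ} (f : Fin q → ι → ℝ) :
    ∏ s, ∑ i, f s i = ∑ I : Fin q → ι, ∏ s, f s (I s) := by
  rw [Finset.prod_univ_sum, Fintype.piFinset_univ]

theorem prod_sum_multi₂ {q : ℕ} (f : Fin q → ι → ι → ℝ) :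
    ∏ s, ∑ i, ∑ j, f s i j = ∑ I : Fin q → ι, ∑ J : Fin q → ι, ∏ s, f s (I s) (J s) := by
  rw [prod_sum_multi]
  exact Finset.sum_congr rfl fun I _ => prod_sum_multi _

/-- Exchanging the entry `K s` of a multi-index with a further summation index. -/
theorem sum_update_swap {q : ℕ} (s : Fin q) (Φ : (Fin q → ι) → ι → ℝ) :
    ∑ K, ∑ c, Φ K c = ∑ K, ∑ m, Φ (Function.update K s m) (K s) := by
  rw [← Fintype.sum_prod_type', ← Fintype.sum_prod_type']
  have hinv : Function.Involutive
      (fun x : (Fin q → ι) × ι => (Function.update x.1 s x.2, x.1 s)) := by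
    rintro ⟨K, c⟩; simp
  exact Fintype.sum_equiv hinv.toPerm _ _ fun x => by
    simp [Function.Involutive.toPerm]

/-! ### Change of coordinates -/

/-- A tensor field whose components are smooth on `Ω`. -/
def SmoothTensorOn {q : ℕ} (T : LocalTensor ι q) (Ω : Set (EuclideanSpace ℝ ι)) : Prop :=
  ∀ y ∈ Ω, ∀ K, ContDiffAt ℝ ∞ (fun z => T z K) y

/-- The entry `∂_i τ^a` of the Jacobian matrix. -/
def jac (τ : EuclideanSpace ℝ ι → EuclideanSpace ℝ ι) (a i : ι) (y : EuclideanSpace ℝ ι) : ℝ :=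
  pderiv i (fun z => τ z a) y

/-- The pullback of a covariant tensor field. -/
def pullback (τ : EuclideanSpace ℝ ι → EuclideanSpace ℝ ι) {q : ℕ} (T : LocalTensor ι q) :
    LocalTensor ι q := fun y I => ∑ K, (∏ s, jac τ (K s) (I s) y) * T (τ y) K

/-- The map `τ` from `Ω'` to `Ω` pulls the metric `G` back to `G'`. -/
structure IsCoordChange (G G' : EuclideanSpace ℝ ι → Matrix ι ι ℝ)
    (Ω Ω' : Set (EuclideanSpace ℝ ι)) (τ : EuclideanSpace ℝ ι → EuclideanSpace ℝ ι) : Prop where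
  metric : IsMetricOn G Ω
  metric' : IsMetricOn G' Ω'
  mapsTo : ∀ y ∈ Ω', τ y ∈ Ω
  smooth : ∀ y ∈ Ω', ContDiffAt ℝ ∞ τ y
  pull : ∀ y ∈ Ω', ∀ i j, G' y i j = ∑ a, ∑ b, jac τ a i y * jac τ b j y * G (τ y) a b

namespace IsCoordChange

variable {G G' : EuclideanSpace ℝ ι → Matrix ι ι ℝ} {Ω Ω' : Set (EuclideanSpace ℝ ι)}
  {τ : EuclideanSpace ℝ ι → EuclideanSpace ℝ ι} (h : IsCoordChange G G' Ω Ω' τ)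
  {y : EuclideanSpace ℝ ι}
include h

theorem smooth_coord (hy : y ∈ Ω') (a : ι) : ContDiffAt ℝ ∞ (fun z => τ z a) y :=
  contDiffAt_euclidean.1 (h.smooth y hy) a

theorem smooth_jac (hy : y ∈ Ω') (a i : ι) : ContDiffAt ℝ ∞ (jac τ a i) y :=
  (h.smooth_coord hy a).pderiv i

theorem smooth_comp (hy : y ∈ Ω') {F : EuclideanSpace ℝ ι → ℝ} (hF : ContDiffAt ℝ ∞ F (τ y)) :
    ContDiffAt ℝ ∞ (fun z => F (τ z)) y :=
  hF.comp y (h.smooth y hy)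

theorem pderiv_comp' (hy : y ∈ Ω') {F : EuclideanSpace ℝ ι → ℝ} (hF : ContDiffAt ℝ ∞ F (τ y))
    (i : ι) : pderiv i (fun z => F (τ z)) y = ∑ a, jac τ a i y * pderiv a F (τ y) :=
  pderiv_comp (diffAt hF) ((h.smooth y hy).differentiableAt (by simp)) i

theorem jac_symm (hy : y ∈ Ω') (a i j : ι) :
    pderiv i (jac τ a j) y = pderiv j (jac τ a i) y :=
  pderiv_comm (h.smooth_coord hy a) i j

theorem pull_matrix (hy : y ∈ Ω') :
    G' y = (Matrix.of fun a i => jac τ a i y).transpose * G (τ y) *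
      (Matrix.of fun a i => jac τ a i y) := by
  ext i j
  rw [h.pull y hy]
  simp only [Matrix.mul_apply, Matrix.transpose_apply, Matrix.of_apply, Finset.sum_mul]
  rw [Finset.sum_comm]
  exact Finset.sum_congr rfl fun b _ => Finset.sum_congr rfl fun a _ => by ring

theorem inv_matrix (hy : y ∈ Ω') :
    (Matrix.of fun a i => jac τ a i y) * (G' y)⁻¹ *
      (Matrix.of fun a i => jac τ a i y).transpose = (G (τ y))⁻¹ := by
  set J : Matrix ι ι ℝ := Matrix.of fun a i => jac τ a i y with hJ
  have h1 := h.pull_matrix hy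
  rw [← hJ] at h1
  have h2 : (J.transpose * G (τ y)) * (J * (G' y)⁻¹) = 1 := by
    rw [← Matrix.mul_assoc, ← h1, h.metric'.mul_inv hy]
  have h3 := mul_eq_one_comm.1 h2
  rw [← Matrix.mul_assoc] at h3
  have h4 := congrArg (· * (G (τ y))⁻¹) h3
  simpa [Matrix.mul_assoc, h.metric.mul_inv (h.mapsTo y hy)] using h4

theorem inv_eq (hy : y ∈ Ω') (a b : ι) :
    ∑ i, ∑ j, jac τ a i y * (G' y)⁻¹ i j * jac τ b j y = (G (τ y))⁻¹ a b := by
  rw [← h.inv_matrix hy]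
  simp only [Matrix.mul_apply, Matrix.transpose_apply, Matrix.of_apply, Finset.sum_mul]
  rw [Finset.sum_comm]

theorem lower_eq_zero (hy : y ∈ Ω') (v : ι → ℝ)
    (hv : ∀ l, ∑ b, ∑ a, jac τ b l y * G (τ y) b a * v a = 0) : v = 0 := by
  set J : Matrix ι ι ℝ := Matrix.of fun a i => jac τ a i y with hJ
  have h1 : (J.transpose * G (τ y)).mulVec v = 0 := by
    ext l
    simp only [Matrix.mulVec, dotProduct, Matrix.mul_apply, Pi.zero_apply, Finset.sum_mul]
    rw [← hv l, Finset.sum_comm]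
    rfl
  have h2 : (J * (G' y)⁻¹) * (J.transpose * G (τ y)) = 1 := by
    rw [← Matrix.mul_assoc, h.inv_matrix hy, h.metric.inv_mul (h.mapsTo y hy)]
  have h3 := congrArg (Matrix.mulVec (J * (G' y)⁻¹)) h1
  rwa [Matrix.mulVec_mulVec, h2, Matrix.one_mulVec, Matrix.mulVec_zero] at h3

theorem pderiv_pull (hy : y ∈ Ω') (l i j : ι) : pderiv l (fun z => G' z i j) y =
    ∑ a, ∑ b, pderiv l (jac τ a i) y * jac τ b j y * G (τ y) a b
    + ∑ a, ∑ b, pderiv l (jac τ a j) y * jac τ b i y * G (τ y) a b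
    + ∑ c, ∑ a, ∑ b, jac τ c l y * jac τ a i y * jac τ b j y *
        pderiv c (fun z => G z a b) (τ y) := by
  have hτy := h.mapsTo y hy
  have e0 : (fun z => G' z i j) =ᶠ[𝓝 y]
      fun z => ∑ a, ∑ b, jac τ a i z * jac τ b j z * G (τ z) a b :=
    (h.metric'.eventually hy).mono fun z hz => h.pull z hz i j
  have s1 : ∀ a b, DifferentiableAt ℝ (fun z => jac τ a i z * jac τ b j z) y := fun a b =>
    (diffAt (h.smooth_jac hy a i)).fun_mul (diffAt (h.smooth_jac hy b j))
  have s2 : ∀ a b, DifferentiableAt ℝ (fun z => G (τ z) a b) y := fun a b =>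
    diffAt (h.smooth_comp hy (h.metric.smooth _ hτy a b))
  rw [pderiv_congr e0, pderiv_sum _ fun a _ =>
    DifferentiableAt.fun_sum fun b _ => (s1 a b).fun_mul (s2 a b)]
  simp only [pderiv_sum _ fun b _ => (s1 _ b).fun_mul (s2 _ b)]
  have e1 : ∀ a b, pderiv l (fun z => jac τ a i z * jac τ b j z * G (τ z) a b) y =
      pderiv l (jac τ a i) y * jac τ b j y * G (τ y) a b
      + pderiv l (jac τ b j) y * jac τ a i y * G (τ y) a b
      + ∑ c, jac τ c l y * jac τ a i y * jac τ b j y * pderiv c (fun z => G z a b) (τ y) := by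
    intro a b
    rw [pderiv_mul (s1 a b) (s2 a b), pderiv_mul (diffAt (h.smooth_jac hy a i))
      (diffAt (h.smooth_jac hy b j)), h.pderiv_comp' hy (h.metric.smooth _ hτy a b),
      Finset.mul_sum]
    have : ∀ A B C : ℝ, ∀ D E : ι → ℝ, A = B + C → (∀ c, D c = E c) →
      A + ∑ c, D c = B + C + ∑ c, E c := by
      intro A B C D E h1 h2; simp [h1, h2]
    exact this _ _ _ _ _ (by ring) fun c => by ring
  simp only [e1, Finset.sum_add_distrib]
  congr 1
  · congr 1
    rw [Finset.sum_comm]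
    exact Finset.sum_congr rfl fun a _ => Finset.sum_congr rfl fun b _ => by
      rw [h.metric.symm _ hτy]
  · conv_rhs => rw [Finset.sum_comm]; enter [2, a]; rw [Finset.sum_comm]

/-- The transformation law of the Christoffel symbols. -/
theorem christoffel_transform (hy : y ∈ Ω') (a i j : ι) :
    ∑ m, jac τ a m y * christoffel G' m i j y =
      (∑ b, ∑ c, jac τ b i y * jac τ c j y * christoffel G a b c (τ y))
        + pderiv i (jac τ a j) y := by
  have hτy := h.mapsTo y hy
  have key := h.lower_eq_zero hy (fun a => ∑ m, jac τ a m y * christoffel G' m i j y -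
    ((∑ b, ∑ c, jac τ b i y * jac τ c j y * christoffel G a b c (τ y))
        + pderiv i (jac τ a j) y)) ?_
  · exact sub_eq_zero.1 (congrFun key a)
  intro l
  have e1 : ∑ b, ∑ a, jac τ b l y * G (τ y) b a * ∑ m, jac τ a m y * christoffel G' m i j y =
      ∑ m, G' y l m * christoffel G' m i j y := by
    simp only [h.pull y hy, Finset.mul_sum, Finset.sum_mul]
    conv_rhs => rw [Finset.sum_comm]; enter [2, a]; rw [Finset.sum_comm]
    exact Finset.sum_congr rfl fun b _ => Finset.sum_congr rfl fun a _ =>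
      Finset.sum_congr rfl fun m _ => by ring
  have e2 : ∑ d, ∑ a, jac τ d l y * G (τ y) d a *
      ∑ b, ∑ c, jac τ b i y * jac τ c j y * christoffel G a b c (τ y) =
      ∑ b, ∑ c, ∑ d, jac τ b i y * jac τ c j y * jac τ d l y *
        ∑ a, G (τ y) d a * christoffel G a b c (τ y) := by
    simp only [Finset.mul_sum]
    have : ∀ F : ι → ι → ι → ι → ℝ, ∑ d, ∑ a, ∑ b, ∑ c, F d a b c =
        ∑ b, ∑ c, ∑ d, ∑ a, F d a b c := by
      intro F
      calc _ = ∑ d, ∑ b, ∑ a, ∑ c, F d a b c :=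
            Finset.sum_congr rfl fun d _ => Finset.sum_comm
        _ = ∑ b, ∑ d, ∑ a, ∑ c, F d a b c := Finset.sum_comm
        _ = ∑ b, ∑ d, ∑ c, ∑ a, F d a b c := Finset.sum_congr rfl fun b _ =>
            Finset.sum_congr rfl fun d _ => Finset.sum_comm
        _ = _ := Finset.sum_congr rfl fun b _ => Finset.sum_comm
    rw [this]
    exact Finset.sum_congr rfl fun b _ => Finset.sum_congr rfl fun c _ =>
      Finset.sum_congr rfl fun d _ => Finset.sum_congr rfl fun a _ => by ring
  simp only [mul_sub, mul_add, Finset.sum_sub_distrib, Finset.sum_add_distrib]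
  rw [e1, e2, h.metric'.lower_christoffel hy]
  simp only [h.metric.lower_christoffel hτy, h.pderiv_pull hy, h.jac_symm hy _ l i, h.jac_symm hy _ l j,
    h.jac_symm hy _ j i]
  have t1 : ∑ c, ∑ a, ∑ b, jac τ c j y * jac τ a i y * jac τ b l y *
      pderiv c (fun z => G z a b) (τ y) = ∑ b, ∑ c, ∑ d, jac τ b i y * jac τ c j y * jac τ d l y *
      pderiv c (fun z => G z b d) (τ y) := by
    rw [Finset.sum_comm]
    exact Finset.sum_congr rfl fun b _ => Finset.sum_congr rfl fun a _ =>
      Finset.sum_congr rfl fun m _ => by ring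
  have t2 : ∑ c, ∑ a, ∑ b, jac τ c l y * jac τ a i y * jac τ b j y *
      pderiv c (fun z => G z a b) (τ y) = ∑ b, ∑ c, ∑ d, jac τ b i y * jac τ c j y * jac τ d l y *
      pderiv d (fun z => G z b c) (τ y) := by
    rw [Finset.sum_comm]
    refine Finset.sum_congr rfl fun b _ => ?_
    rw [Finset.sum_comm]
    exact Finset.sum_congr rfl fun a _ => Finset.sum_congr rfl fun m _ => by ring
  have t3 : ∑ b, ∑ a, jac τ b l y * G (τ y) b a * pderiv i (jac τ a j) y =
      ∑ a, ∑ b, pderiv i (jac τ a j) y * jac τ b l y * G (τ y) a b := by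
    rw [Finset.sum_comm]
    exact Finset.sum_congr rfl fun b _ => Finset.sum_congr rfl fun a _ => by
      rw [h.metric.symm _ hτy]; ring
  rw [t1, t2, t3]
  have t4 : ∑ b, ∑ c, ∑ d, jac τ b i y * jac τ c j y * jac τ d l y * ((1 / 2 : ℝ) *
      (pderiv b (fun z => G z c d) (τ y) + pderiv c (fun z => G z b d) (τ y)
        - pderiv d (fun z => G z b c) (τ y))) = (1 / 2 : ℝ) *
      (∑ b, ∑ c, ∑ d, jac τ b i y * jac τ c j y * jac τ d l y * pderiv b (fun z => G z c d) (τ y)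
      + ∑ b, ∑ c, ∑ d, jac τ b i y * jac τ c j y * jac τ d l y * pderiv c (fun z => G z b d) (τ y)
      - ∑ b, ∑ c, ∑ d, jac τ b i y * jac τ c j y * jac τ d l y *
        pderiv d (fun z => G z b c) (τ y)) := by
    simp only [Finset.mul_sum, ← Finset.sum_add_distrib, ← Finset.sum_sub_distrib]
    exact Finset.sum_congr rfl fun b _ => Finset.sum_congr rfl fun a _ =>
      Finset.sum_congr rfl fun m _ => by ring
  rw [t4]
  ring

/-- Covariant differentiation commutes with pullback. -/
theorem covDeriv_pullback (hy : y ∈ Ω') {q : ℕ} {T : LocalTensor ι q}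
    (hT : ∀ K, ContDiffAt ℝ ∞ (fun z => T z K) (τ y)) (I : Fin (q + 1) → ι) :
    covDeriv G' (pullback τ T) y I = pullback τ (covDeriv G T) y I := by
  have hJ : ∀ (K I : Fin q → ι), ∀ s ∈ Finset.univ, DifferentiableAt ℝ
      (fun z => jac τ (K s) (I s) z) y := fun K I s _ => diffAt (h.smooth_jac hy _ _)
  have hJ' : ∀ (K I : Fin q → ι), DifferentiableAt ℝ (fun z => ∏ s, jac τ (K s) (I s) z) y :=
    fun K I => diffAt (contDiffAt_prod fun s _ => h.smooth_jac hy _ _)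
  have hTd : ∀ K, DifferentiableAt ℝ (fun z => T (τ z) K) y := fun K =>
    diffAt (h.smooth_comp hy (hT K))
  simp only [covDeriv, pullback, sum_cons (q := q), Fin.prod_univ_succ, Fin.cons_zero,
    Fin.cons_succ, Fin.tail_cons]
  obtain ⟨i, I, rfl⟩ : ∃ i I', I = Fin.cons i I' := ⟨I 0, Fin.tail I, by simp⟩
  simp only [Fin.cons_zero, Fin.cons_succ, Fin.tail_cons]
  rw [pderiv_sum _ fun K _ => (hJ' K I).fun_mul (hTd K)]
  set E : Fin q → (Fin q → ι) → ℝ := fun s K => ∏ b ∈ Finset.univ.erase s, jac τ (K b) (I b) y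
    with hE
  have hEp : ∀ s K, ∏ b, jac τ (K b) (I b) y = jac τ (K s) (I s) y * E s K := fun s K =>
    (Finset.mul_prod_erase _ _ (Finset.mem_univ s)).symm
  have hEu : ∀ s K m, E s (Function.update K s m) = E s K := fun s K m =>
    Finset.prod_congr rfl fun b hb => by rw [Function.update_of_ne (Finset.ne_of_mem_erase hb)]
  have e1 : ∀ K, pderiv i (fun z => (∏ s, jac τ (K s) (I s) z) * T (τ z) K) y =
      (∑ s, E s K * pderiv i (jac τ (K s) (I s)) y * T (τ y) K) +
      ∑ a, jac τ a i y * (∏ s, jac τ (K s) (I s) y) * pderiv a (fun z => T z K) (τ y) := by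
    intro K
    rw [pderiv_mul (hJ' K I) (hTd K), pderiv_prod _ (hJ K I), h.pderiv_comp' hy (hT K),
      Finset.sum_mul, Finset.mul_sum]
    congr 1
    exact Finset.sum_congr rfl fun a _ => by ring
  have e2 : ∀ s, ∑ m, christoffel G' m i (I s) y *
      ∑ K, (∏ b, jac τ (K b) (Function.update I s m b) y) * T (τ y) K =
      ∑ K, E s K * pderiv i (jac τ (K s) (I s)) y * T (τ y) K +
      ∑ a, ∑ K, ∑ c, jac τ a i y * jac τ c (I s) y * christoffel G (K s) a c (τ y) *
        E s K * T (τ y) K := by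
    intro s
    have : ∀ K m, ∏ b, jac τ (K b) (Function.update I s m b) y = jac τ (K s) m y * E s K := by
      intro K m
      rw [← Finset.mul_prod_erase _ _ (Finset.mem_univ s), Function.update_self]
      congr 1
      exact Finset.prod_congr rfl fun b hb => by
        rw [Function.update_of_ne (Finset.ne_of_mem_erase hb)]
    simp only [this, Finset.mul_sum]
    rw [Finset.sum_comm]
    have e3 : ∀ K : Fin q → ι, ∑ m, christoffel G' m i (I s) y *
        (jac τ (K s) m y * E s K * T (τ y) K) =
        E s K * pderiv i (jac τ (K s) (I s)) y * T (τ y) K +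
        ∑ a, ∑ c, jac τ a i y * jac τ c (I s) y * christoffel G (K s) a c (τ y) *
          E s K * T (τ y) K := by
      intro K
      have : ∑ m, christoffel G' m i (I s) y * (jac τ (K s) m y * E s K * T (τ y) K) =
          (∑ m, jac τ (K s) m y * christoffel G' m i (I s) y) * (E s K * T (τ y) K) := by
        rw [Finset.sum_mul]; exact Finset.sum_congr rfl fun m _ => by ring
      rw [this, h.christoffel_transform hy, add_comm, add_mul, Finset.sum_mul]
      congr 1
      · ring
      · refine Finset.sum_congr rfl fun a _ => ?_
        rw [Finset.sum_mul]
        exact Finset.sum_congr rfl fun c _ => by ring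
    simp only [e3, Finset.sum_add_distrib]
    rw [Finset.sum_comm (s := (Finset.univ : Finset (Fin q → ι)))]
  simp only [e1, e2, Finset.sum_add_distrib]
  rw [Finset.sum_comm (s := (Finset.univ : Finset (Fin q → ι)))
    (t := (Finset.univ : Finset (Fin q)))]
  rw [add_sub_add_left_eq_sub]
  rw [Finset.sum_comm (s := (Finset.univ : Finset (Fin q → ι)))]
  simp only [mul_sub, Finset.sum_sub_distrib]
  congr 1
  rw [Finset.sum_comm (s := (Finset.univ : Finset (Fin q)))]
  refine Finset.sum_congr rfl fun a _ => ?_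
  simp only [Finset.mul_sum]
  rw [Finset.sum_comm (s := (Finset.univ : Finset (Fin q → ι)))]
  refine Finset.sum_congr rfl fun s _ => ?_
  rw [sum_update_swap s]
  refine Finset.sum_congr rfl fun K _ => Finset.sum_congr rfl fun m _ => ?_
  rw [hEu, Function.update_self, hEp s K]
  ring

theorem divergence_pullback (hy : y ∈ Ω') {q : ℕ} {S : LocalTensor ι (q + 1)}
    (hS : ∀ K, ContDiffAt ℝ ∞ (fun z => S z K) (τ y)) (J : Fin q → ι) :
    divergence G' (pullback τ S) y J = pullback τ (divergence G S) y J := by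
  simp only [divergence, h.covDeriv_pullback hy hS]
  simp only [pullback, divergence, sum_cons (q := q + 1), sum_cons (q := q), Fin.prod_univ_succ,
    Fin.cons_zero, Fin.cons_succ, Finset.mul_sum, ← h.inv_eq hy, Finset.sum_mul]
  have : ∀ F : ι → ι → ι → ι → (Fin q → ι) → ℝ, ∑ i, ∑ j, ∑ a, ∑ b, ∑ K, F i j a b K =
      ∑ K, ∑ a, ∑ b, ∑ i, ∑ j, F i j a b K := by
    intro F
    simp only [← Fintype.sum_prod_type']
    exact Fintype.sum_equiv ⟨fun x => ⟨x.2.2.2.2, x.2.2.1, x.2.2.2.1, x.1, x.2.1⟩,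
      fun x => ⟨x.2.2.2.1, x.2.2.2.2, x.2.1, x.2.2.1, x.1⟩, fun x => rfl, fun x => rfl⟩
      _ _ fun x => rfl
  rw [this]
  refine Finset.sum_congr rfl fun K _ => Finset.sum_congr rfl fun a _ =>
    Finset.sum_congr rfl fun b _ => Finset.sum_congr rfl fun i _ =>
    Finset.sum_congr rfl fun j _ => by ring

/-- Raised tensors push forward. -/
theorem raise_pullback (hy : y ∈ Ω') {q : ℕ} (T : LocalTensor ι q) (K : Fin q → ι) :
    ∑ I : Fin q → ι, (∏ s, jac τ (K s) (I s) y) * raise (G' y) (pullback τ T y) I =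
      raise (G (τ y)) (T (τ y)) K := by
  simp only [raise, pullback, Finset.mul_sum, ← h.inv_eq hy, prod_sum_multi₂, Finset.sum_mul]
  have : ∀ F : (Fin q → ι) → (Fin q → ι) → (Fin q → ι) → ℝ, ∑ I, ∑ L, ∑ N, F I L N =
      ∑ N, ∑ I, ∑ L, F I L N := by
    intro F
    conv_rhs => rw [Finset.sum_comm]; enter [2, I]; rw [Finset.sum_comm]
  rw [this]
  refine Finset.sum_congr rfl fun N _ => Finset.sum_congr rfl fun I _ =>
    Finset.sum_congr rfl fun L _ => ?_
  simp only [Finset.prod_mul_distrib]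
  ring

end IsCoordChange

theorem covDeriv_congr {G : EuclideanSpace ℝ ι → Matrix ι ι ℝ} {y : EuclideanSpace ℝ ι} {q : ℕ}
    {T T' : LocalTensor ι q} (h : ∀ K, (fun z => T z K) =ᶠ[𝓝 y] fun z => T' z K) :
    covDeriv G T y = covDeriv G T' y := by
  ext I
  simp only [covDeriv, pderiv_congr (h _), (h _).eq_of_nhds]

theorem divergence_congr {G : EuclideanSpace ℝ ι → Matrix ι ι ℝ} {y : EuclideanSpace ℝ ι} {q : ℕ}
    {T T' : LocalTensor ι (q + 1)} (h : ∀ K, (fun z => T z K) =ᶠ[𝓝 y] fun z => T' z K) :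
    divergence G T y = divergence G T' y := by
  ext I
  simp only [divergence, covDeriv_congr h]

theorem iterDivergence_congr {G : EuclideanSpace ℝ ι → Matrix ι ι ℝ} {Ω : Set (EuclideanSpace ℝ ι)}
    (hΩ : IsOpen Ω) {l : ℕ} {T T' : LocalTensor ι l} (h : ∀ y ∈ Ω, T y = T' y) :
    ∀ y ∈ Ω, iterDivergence G l T y = iterDivergence G l T' y := by
  induction l with
  | zero => intro y hy; simp only [iterDivergence, h y hy]
  | succ l ih =>
    simp only [iterDivergence]
    refine ih fun y hy => divergence_congr fun K => ?_
    filter_upwards [hΩ.mem_nhds hy] with z hz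
    rw [h z hz]

theorem iterCovDeriv_congr {G : EuclideanSpace ℝ ι → Matrix ι ι ℝ} {Ω : Set (EuclideanSpace ℝ ι)}
    (hΩ : IsOpen Ω) {u v : EuclideanSpace ℝ ι → ℝ} (h : ∀ y ∈ Ω, u y = v y) (l : ℕ) :
    ∀ y ∈ Ω, iterCovDeriv G u l y = iterCovDeriv G v l y := by
  induction l with
  | zero => intro y hy; simp only [iterCovDeriv, h y hy]
  | succ l ih =>
    intro y hy
    simp only [iterCovDeriv]
    refine covDeriv_congr fun K => ?_
    filter_upwards [hΩ.mem_nhds hy] with z hz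
    rw [ih z hz]

section Smooth

variable {G : EuclideanSpace ℝ ι → Matrix ι ι ℝ} {Ω : Set (EuclideanSpace ℝ ι)}

theorem SmoothTensorOn.covDeriv (hG : IsMetricOn G Ω) {q : ℕ} {T : LocalTensor ι q}
    (hT : SmoothTensorOn T Ω) : SmoothTensorOn (covDeriv G T) Ω := by
  intro y hy K
  exact ((hT y hy _).pderiv _).sub (ContDiffAt.sum fun s _ => ContDiffAt.sum fun m _ =>
    (hG.christoffel_smooth hy _ _ _).mul (hT y hy _))

theorem SmoothTensorOn.divergence (hG : IsMetricOn G Ω) {q : ℕ} {S : LocalTensor ι (q + 1)}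
    (hS : SmoothTensorOn S Ω) : SmoothTensorOn (divergence G S) Ω := by
  intro y hy K
  exact ContDiffAt.sum fun s _ => ContDiffAt.sum fun m _ =>
    (hG.smooth_inv hy _ _).mul (hS.covDeriv hG y hy _)

theorem smoothTensorOn_iterCovDeriv (hG : IsMetricOn G Ω) {u : EuclideanSpace ℝ ι → ℝ}
    (hu : ∀ y ∈ Ω, ContDiffAt ℝ ∞ u y) (l : ℕ) : SmoothTensorOn (iterCovDeriv G u l) Ω := by
  induction l with
  | zero => exact fun y hy _ => hu y hy
  | succ l ih => exact ih.covDeriv hG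

theorem contDiffAt_iterDivergence (hG : IsMetricOn G Ω) {l : ℕ} {S : LocalTensor ι l}
    (hS : SmoothTensorOn S Ω) : ∀ y ∈ Ω, ContDiffAt ℝ ∞ (iterDivergence G l S) y := by
  induction l with
  | zero => exact fun y hy => hS y hy _
  | succ l ih => exact ih (hS.divergence hG)

theorem SmoothTensorOn.raise (hG : IsMetricOn G Ω) {q : ℕ} {T : LocalTensor ι q}
    (hT : SmoothTensorOn T Ω) : SmoothTensorOn (fun y => GJMS.raise (G y) (T y)) Ω := by
  intro y hy K
  exact ContDiffAt.sum fun L _ => (contDiffAt_prod fun s _ => hG.smooth_inv hy _ _).mul (hT y hy L)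

end Smooth

namespace IsCoordChange

variable {G G' : EuclideanSpace ℝ ι → Matrix ι ι ℝ} {Ω Ω' : Set (EuclideanSpace ℝ ι)}
  {τ : EuclideanSpace ℝ ι → EuclideanSpace ℝ ι} (h : IsCoordChange G G' Ω Ω' τ)
include h

theorem iterCovDeriv_comp {u : EuclideanSpace ℝ ι → ℝ} (hu : ∀ y ∈ Ω, ContDiffAt ℝ ∞ u y) (l : ℕ) :
    ∀ y ∈ Ω', iterCovDeriv G' (fun z => u (τ z)) l y = pullback τ (iterCovDeriv G u l) y := by
  induction l with
  | zero => intro y _; ext I; simp [iterCovDeriv, pullback]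
  | succ l ih =>
    intro y hy
    ext I
    simp only [iterCovDeriv]
    rw [← h.covDeriv_pullback hy
      (smoothTensorOn_iterCovDeriv h.metric hu l _ (h.mapsTo y hy))]
    refine congrFun (covDeriv_congr fun K => ?_) I
    filter_upwards [h.metric'.eventually hy] with z hz
    rw [ih z hz]

/-- The iterated divergence commutes with pullback. -/
theorem iterDivergence_pullback {l : ℕ} {S : LocalTensor ι l} (hS : SmoothTensorOn S Ω) :
    ∀ y ∈ Ω', iterDivergence G' l (pullback τ S) y = iterDivergence G l S (τ y) := by
  induction l with
  | zero =>
    intro y hy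
    simp only [iterDivergence, pullback]
    rw [Fintype.sum_unique]
    simp only [Finset.univ_eq_empty, Finset.prod_empty, one_mul]
    congr 1
  | succ l ih =>
    intro y hy
    simp only [iterDivergence]
    rw [← ih (hS.divergence h.metric) y hy]
    refine iterDivergence_congr h.metric'.isOpen (fun z hz => ?_) y hy
    ext K
    exact h.divergence_pullback hz (hS _ (h.mapsTo z hz)) K

/-- The Laplacian is natural under changes of coordinates. -/
theorem localLaplacian_comp {u : EuclideanSpace ℝ ι → ℝ} (hu : ∀ y ∈ Ω, ContDiffAt ℝ ∞ u y) :
    ∀ y ∈ Ω', localLaplacian G' (fun z => u (τ z)) y = localLaplacian G u (τ y) := by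
  intro y hy
  simp only [localLaplacian]
  rw [← h.iterDivergence_pullback (smoothTensorOn_iterCovDeriv h.metric hu 1) y hy]
  congr 1
  exact iterDivergence_congr h.metric'.isOpen (h.iterCovDeriv_comp hu 1) y hy

/-- Contracting the first half of the indices of a tensor with a vector-valued tensor. -/
theorem contract_pullback {l : ℕ} {y : EuclideanSpace ℝ ι} (B : LocalTensor ι (l + l))
    {X' X : (Fin l → ι) → ℝ}
    (hX : ∀ K, ∑ I : Fin l → ι, (∏ s, jac τ (K s) (I s) y) * X' I = X K) (J : Fin l → ι) :
    ∑ I, pullback τ B y (Fin.append I J) * X' I =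
      ∑ L : Fin l → ι, (∏ s, jac τ (L s) (J s) y) * ∑ K, B (τ y) (Fin.append K L) * X K := by
  simp only [pullback, sum_append (p := l) (q := l), Fin.prod_univ_add, Fin.append_left,
    Fin.append_right, ← hX, Finset.mul_sum, Finset.sum_mul]
  have : ∀ F : (Fin l → ι) → (Fin l → ι) → (Fin l → ι) → ℝ, ∑ I, ∑ K, ∑ L, F I K L =
      ∑ L, ∑ K, ∑ I, F I K L := by
    intro F
    rw [Finset.sum_comm]
    conv_rhs => rw [Finset.sum_comm]
    refine Finset.sum_congr rfl fun K _ => Finset.sum_comm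
  rw [this]
  exact Finset.sum_congr rfl fun L _ => Finset.sum_congr rfl fun K _ =>
    Finset.sum_congr rfl fun I _ => by ring

end IsCoordChange

end CoordinateChange

section LocalAnalysis

variable {ι : Type} [Fintype ι] [DecidableEq ι] {G : EuclideanSpace ℝ ι → Matrix ι ι ℝ}
  {Ω : Set (EuclideanSpace ℝ ι)} {y : EuclideanSpace ℝ ι}

/-! ### Metric compatibility -/

theorem covDeriv_cons (G : EuclideanSpace ℝ ι → Matrix ι ι ℝ) {q : ℕ} (T : LocalTensor ι q)
    (y : EuclideanSpace ℝ ι) (a : ι) (J : Fin q → ι) :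
    covDeriv G T y (Fin.cons a J) = pderiv a (fun z => T z J) y
      - ∑ s, ∑ m, christoffel G m a (J s) y * T y (Function.update J s m) := by
  simp [covDeriv]

/-- Metric compatibility: the Leibniz rule for the pairing `⟨T, S⟩` of tensors. -/
theorem IsMetricOn.pderiv_inner (hG : IsMetricOn G Ω) (hy : y ∈ Ω) {q : ℕ}
    {T S : LocalTensor ι q} (hT : ∀ K, ContDiffAt ℝ ∞ (fun z => T z K) y)
    (hS : ∀ K, ContDiffAt ℝ ∞ (fun z => S z K) y) (a : ι) :
    pderiv a (fun z => ∑ J, raise (G z) (T z) J * S z J) y =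
      ∑ J, raise (G y) (fun K => covDeriv G T y (Fin.cons a K)) J * S y J +
      ∑ J, raise (G y) (T y) J * covDeriv G S y (Fin.cons a J) := by
  set P : (Fin q → ι) → (Fin q → ι) → EuclideanSpace ℝ ι → ℝ :=
    fun J K z => ∏ s, (G z)⁻¹ (J s) (K s) with hP
  set E : Fin q → (Fin q → ι) → (Fin q → ι) → ℝ :=
    fun s J K => ∏ b ∈ Finset.univ.erase s, (G y)⁻¹ (J b) (K b) with hE
  have hPd : ∀ J K, DifferentiableAt ℝ (P J K) y := fun J K =>
    diffAt (contDiffAt_prod fun s _ => hG.smooth_inv hy _ _)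
  have hEp : ∀ s J K, P J K y = (G y)⁻¹ (J s) (K s) * E s J K := fun s J K =>
    (Finset.mul_prod_erase _ _ (Finset.mem_univ s)).symm
  have hEu : ∀ s J K m, E s (Function.update J s m) K = E s J K := fun s J K m =>
    Finset.prod_congr rfl fun b hb => by rw [Function.update_of_ne (Finset.ne_of_mem_erase hb)]
  have hEu' : ∀ s J K m, E s J (Function.update K s m) = E s J K := fun s J K m =>
    Finset.prod_congr rfl fun b hb => by rw [Function.update_of_ne (Finset.ne_of_mem_erase hb)]
  have hTS : ∀ J K, DifferentiableAt ℝ (fun z => T z K * S z J) y := fun J K =>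
    (diffAt (hT K)).fun_mul (diffAt (hS J))
  have e0 : (fun z => ∑ J, raise (G z) (T z) J * S z J) =
      fun z => ∑ J, ∑ K, P J K z * (T z K * S z J) := by
    ext z
    simp only [raise, Finset.sum_mul, hP]
    exact Finset.sum_congr rfl fun J _ => Finset.sum_congr rfl fun K _ => by ring
  have e1 : ∀ J K, pderiv a (fun z => P J K z * (T z K * S z J)) y =
      P J K y * pderiv a (fun z => T z K) y * S y J + P J K y * T y K * pderiv a (fun z => S z J) y
      - (∑ s, ∑ m, E s J K * (G y)⁻¹ m (K s) * christoffel G (J s) a m y * T y K * S y J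
        + ∑ s, ∑ m, E s J K * (G y)⁻¹ (J s) m * christoffel G (K s) a m y * T y K * S y J) := by
    intro J K
    rw [pderiv_mul (hPd J K) (hTS J K), pderiv_mul (diffAt (hT K)) (diffAt (hS J)), hP,
      pderiv_prod _ fun s _ => diffAt (hG.smooth_inv hy _ _)]
    simp only [hG.pderiv_inv_eq_christoffel hy]
    have : (∑ s, (∏ b ∈ Finset.univ.erase s, (G y)⁻¹ (J b) (K b)) *
        (-(∑ m, christoffel G (J s) a m y * (G y)⁻¹ m (K s)) -
          ∑ m, christoffel G (K s) a m y * (G y)⁻¹ (J s) m)) * (T y K * S y J) =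
        - (∑ s, ∑ m, E s J K * (G y)⁻¹ m (K s) * christoffel G (J s) a m y * T y K * S y J
        + ∑ s, ∑ m, E s J K * (G y)⁻¹ (J s) m * christoffel G (K s) a m y * T y K * S y J) := by
      rw [← Finset.sum_add_distrib, ← Finset.sum_neg_distrib, Finset.sum_mul]
      refine Finset.sum_congr rfl fun s _ => ?_
      have h1 : ∑ m, E s J K * (G y)⁻¹ m (K s) * christoffel G (J s) a m y * T y K * S y J =
          E s J K * (∑ m, christoffel G (J s) a m y * (G y)⁻¹ m (K s)) * (T y K * S y J) := by
        rw [Finset.mul_sum, Finset.sum_mul]; exact Finset.sum_congr rfl fun m _ => by ring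
      have h2 : ∑ m, E s J K * (G y)⁻¹ (J s) m * christoffel G (K s) a m y * T y K * S y J =
          E s J K * (∑ m, christoffel G (K s) a m y * (G y)⁻¹ (J s) m) * (T y K * S y J) := by
        rw [Finset.mul_sum, Finset.sum_mul]; exact Finset.sum_congr rfl fun m _ => by ring
      rw [h1, h2]; simp only [hE]; ring
    rw [this]
    ring
  rw [e0, pderiv_sum _ fun J _ => DifferentiableAt.fun_sum fun K _ => (hPd J K).fun_mul (hTS J K)]
  simp only [pderiv_sum _ fun K _ => (hPd _ K).fun_mul (hTS _ K), e1, covDeriv_cons]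
  have r1 : ∑ J, raise (G y) (fun K => pderiv a (fun z => T z K) y - ∑ s, ∑ m,
      christoffel G m a (K s) y * T y (Function.update K s m)) J * S y J =
      ∑ J, ∑ K, P J K y * pderiv a (fun z => T z K) y * S y J -
      ∑ J, ∑ K, ∑ s, ∑ m, E s J K * (G y)⁻¹ (J s) m * christoffel G (K s) a m y * T y K * S y J := by
    rw [← Finset.sum_sub_distrib]
    refine Finset.sum_congr rfl fun J _ => ?_
    have : ∑ K, ∑ s, ∑ m, E s J K * (G y)⁻¹ (J s) m * christoffel G (K s) a m y * T y K * S y J =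
        ∑ K, ∑ s, ∑ m, P J K y * christoffel G m a (K s) y * T y (Function.update K s m) * S y J := by
      rw [Finset.sum_comm]
      conv_rhs => rw [Finset.sum_comm]
      refine Finset.sum_congr rfl fun s _ => ?_
      conv_rhs => rw [sum_update_swap s]
      refine Finset.sum_congr rfl fun K _ => Finset.sum_congr rfl fun m _ => ?_
      rw [hEp s, hEu', Function.update_self, Function.update_idem, Function.update_eq_self]
      ring
    rw [this, ← Finset.sum_sub_distrib, raise, Finset.sum_mul]
    refine Finset.sum_congr rfl fun K _ => ?_
    simp only [mul_sub, sub_mul, Finset.mul_sum, Finset.sum_mul, hP]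
    congr 1
    exact Finset.sum_congr rfl fun s _ => Finset.sum_congr rfl fun m _ => by ring
  have r2 : ∑ J, raise (G y) (T y) J * (pderiv a (fun z => S z J) y - ∑ s, ∑ m,
      christoffel G m a (J s) y * S y (Function.update J s m)) =
      ∑ J, ∑ K, P J K y * T y K * pderiv a (fun z => S z J) y -
      ∑ J, ∑ K, ∑ s, ∑ m, E s J K * (G y)⁻¹ m (K s) * christoffel G (J s) a m y * T y K * S y J := by
    have : ∑ J, ∑ K, ∑ s, ∑ m, E s J K * (G y)⁻¹ m (K s) * christoffel G (J s) a m y * T y K * S y J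
        = ∑ J, ∑ K, ∑ s, ∑ m, P J K y * T y K * christoffel G m a (J s) y *
          S y (Function.update J s m) := by
      rw [Finset.sum_comm]
      conv_rhs => rw [Finset.sum_comm]
      refine Finset.sum_congr rfl fun K _ => ?_
      rw [Finset.sum_comm]
      conv_rhs => rw [Finset.sum_comm]
      refine Finset.sum_congr rfl fun s _ => ?_
      conv_rhs => rw [sum_update_swap s]
      refine Finset.sum_congr rfl fun J _ => Finset.sum_congr rfl fun m _ => ?_
      rw [hEp s, hEu, Function.update_self, Function.update_idem, Function.update_eq_self]
      ring
    rw [this, ← Finset.sum_sub_distrib]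
    refine Finset.sum_congr rfl fun J _ => ?_
    rw [← Finset.sum_sub_distrib, raise, Finset.sum_mul]
    refine Finset.sum_congr rfl fun K _ => ?_
    simp only [mul_sub, Finset.mul_sum, hP]
    congr 1
    exact Finset.sum_congr rfl fun s _ => Finset.sum_congr rfl fun m _ => by ring
  rw [r1, r2]
  simp only [Finset.sum_sub_distrib, Finset.sum_add_distrib]
  ring

/-- The Leibniz rule for the divergence of the one-form `⟨T, S_b⟩`. -/
theorem IsMetricOn.divergence_inner (hG : IsMetricOn G Ω) (hy : y ∈ Ω) {q : ℕ}
    {T : LocalTensor ι q} {S : LocalTensor ι (q + 1)}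
    (hT : ∀ K, ContDiffAt ℝ ∞ (fun z => T z K) y) (hS : ∀ K, ContDiffAt ℝ ∞ (fun z => S z K) y) :
    ∑ a, ∑ b, (G y)⁻¹ a b * (pderiv a (fun z => ∑ J, raise (G z) (T z) J * S z (Fin.cons b J)) y
        - ∑ m, christoffel G m a b y * ∑ J, raise (G y) (T y) J * S y (Fin.cons m J)) =
      ∑ K, raise (G y) (covDeriv G T y) K * S y K +
      ∑ J, raise (G y) (T y) J * divergence G S y J := by
  have e1 : ∀ a b J, covDeriv G (fun z J => S z (Fin.cons b J)) y (Fin.cons a J) =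
      covDeriv G S y (Fin.cons a (Fin.cons b J)) +
        ∑ m, christoffel G m a b y * S y (Fin.cons m J) := by
    intro a b J
    rw [covDeriv_cons, covDeriv_cons, Fin.sum_univ_succ]
    simp only [Fin.cons_zero, Fin.cons_succ, Fin.update_cons_zero, Fin.cons_update]
    ring
  have e2 : ∀ a b, pderiv a (fun z => ∑ J, raise (G z) (T z) J * S z (Fin.cons b J)) y
        - ∑ m, christoffel G m a b y * ∑ J, raise (G y) (T y) J * S y (Fin.cons m J) =
      ∑ J, raise (G y) (fun K => covDeriv G T y (Fin.cons a K)) J * S y (Fin.cons b J) +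
      ∑ J, raise (G y) (T y) J * covDeriv G S y (Fin.cons a (Fin.cons b J)) := by
    intro a b
    rw [hG.pderiv_inner hy (S := fun z J => S z (Fin.cons b J)) hT (fun K => hS _) a]
    simp only [e1, mul_add, Finset.sum_add_distrib, Finset.mul_sum]
    rw [Finset.sum_comm (s := (Finset.univ : Finset (Fin q → ι))) (t := (Finset.univ : Finset ι))]
    have : ∑ m, ∑ J, raise (G y) (T y) J * (christoffel G m a b y * S y (Fin.cons m J)) =
        ∑ m, ∑ J, christoffel G m a b y * (raise (G y) (T y) J * S y (Fin.cons m J)) :=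
      Finset.sum_congr rfl fun m _ => Finset.sum_congr rfl fun J _ => by ring
    rw [this]; ring
  simp only [e2, mul_add, Finset.sum_add_distrib]
  congr 1
  · rw [sum_cons, Finset.sum_comm]
    refine Finset.sum_congr rfl fun b _ => ?_
    simp only [Finset.mul_sum]
    rw [Finset.sum_comm]
    refine Finset.sum_congr rfl fun J _ => ?_
    simp only [raise, sum_cons (q := q), Fin.prod_univ_succ, Fin.cons_zero, Fin.cons_succ,
      Finset.sum_mul, Finset.mul_sum]
    refine Finset.sum_congr rfl fun a _ => Finset.sum_congr rfl fun K _ => ?_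
    rw [hG.inv_symm hy a b]; ring
  · simp only [divergence, Finset.mul_sum]
    conv_rhs => rw [Finset.sum_comm]; enter [2, a]; rw [Finset.sum_comm]
    exact Finset.sum_congr rfl fun a _ => Finset.sum_congr rfl fun b _ =>
      Finset.sum_congr rfl fun J _ => by ring

/-! ### Integration by parts in a coordinate domain -/

/-- A function on `Ω` that vanishes off a compact subset of `Ω` is, after extension by zero, near
each point equal to itself or to zero; hence the extension inherits local regularity. -/
theorem continuous_indicator_of_compact {f : EuclideanSpace ℝ ι → ℝ} (hΩ : IsOpen Ω)
    {C : Set (EuclideanSpace ℝ ι)} (hC : IsCompact C) (hCΩ : C ⊆ Ω)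
    (h0 : ∀ y ∈ Ω, y ∉ C → f y = 0) (y : EuclideanSpace ℝ ι) :
    (y ∈ Ω ∧ Ω.indicator f =ᶠ[𝓝 y] f) ∨ Ω.indicator f =ᶠ[𝓝 y] fun _ => 0 := by
  by_cases hy : y ∈ Ω
  · left
    refine ⟨hy, ?_⟩
    filter_upwards [hΩ.mem_nhds hy] with z hz
    simp [hz]
  · right
    filter_upwards [hC.isClosed.isOpen_compl.mem_nhds fun h => hy (hCΩ h)] with z hz
    by_cases hz' : z ∈ Ω
    · simp [hz', h0 z hz' hz]
    · simp [hz']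

theorem integrableOn_of_compact {f : EuclideanSpace ℝ ι → ℝ} (hΩ : IsOpen Ω)
    (hf : ∀ y ∈ Ω, ContinuousAt f y) {C : Set (EuclideanSpace ℝ ι)} (hC : IsCompact C)
    (hCΩ : C ⊆ Ω) (h0 : ∀ y ∈ Ω, y ∉ C → f y = 0) : IntegrableOn f Ω := by
  rw [← integrable_indicator_iff hΩ.measurableSet]
  refine Continuous.integrable_of_hasCompactSupport ?_ ?_
  · rw [continuous_iff_continuousAt]
    intro y
    rcases continuous_indicator_of_compact hΩ hC hCΩ h0 y with ⟨hy, h⟩ | h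
    · exact (hf y hy).congr h.symm
    · exact continuousAt_const.congr h.symm
  · refine HasCompactSupport.intro hC fun y hy => ?_
    by_cases hy' : y ∈ Ω
    · simp [hy', h0 y hy' hy]
    · simp [hy']

/-- The divergence theorem for a compactly supported function. -/
theorem setIntegral_pderiv_eq_zero {X : EuclideanSpace ℝ ι → ℝ} (hΩ : IsOpen Ω)
    (hX : ∀ y ∈ Ω, ContDiffAt ℝ ∞ X y) {C : Set (EuclideanSpace ℝ ι)} (hC : IsCompact C)
    (hCΩ : C ⊆ Ω) (h0 : ∀ y ∈ Ω, y ∉ C → X y = 0) (a : ι) : ∫ y in Ω, pderiv a X y = 0 := by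
  set Y := Ω.indicator X with hY
  have hYs : ContDiff ℝ ∞ Y := by
    rw [contDiff_iff_contDiffAt]
    intro y
    rcases continuous_indicator_of_compact hΩ hC hCΩ h0 y with ⟨hy, h⟩ | h
    · exact (hX y hy).congr_of_eventuallyEq h
    · exact contDiffAt_const.congr_of_eventuallyEq h
  have hYc : HasCompactSupport Y := by
    refine HasCompactSupport.intro hC fun y hy => ?_
    by_cases hy' : y ∈ Ω
    · simp [hY, hy', h0 y hy' hy]
    · simp [hY, hy']
  have hd : (fun y => fderiv ℝ Y y (EuclideanSpace.single a 1)) = Ω.indicator (pderiv a X) := by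
    ext y
    rcases continuous_indicator_of_compact hΩ hC hCΩ h0 y with ⟨hy, h⟩ | h
    · rw [Set.indicator_of_mem hy]
      exact pderiv_congr h a
    · have h1 : pderiv a Y y = 0 := by rw [pderiv_congr h a, pderiv_const]
      by_cases hy : y ∈ Ω
      · rw [Set.indicator_of_mem hy]
        refine pderiv_congr ?_ a
        filter_upwards [hΩ.mem_nhds hy] with z hz
        simp [hY, hz]
      · rw [Set.indicator_of_notMem hy]; exact h1
  have hYd : Integrable fun y => fderiv ℝ Y y (EuclideanSpace.single a 1) := by
    refine Continuous.integrable_of_hasCompactSupport ?_ ?_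
    · exact (hYs.continuous_fderiv (by simp)).clm_apply continuous_const
    · exact (hYc.fderiv ℝ).comp_left (g := fun L : EuclideanSpace ℝ ι →L[ℝ] ℝ =>
        L (EuclideanSpace.single a 1)) rfl
  have hYi : Integrable Y := hYs.continuous.integrable_of_hasCompactSupport hYc
  have key := integral_mul_fderiv_eq_neg_fderiv_mul_of_integrable (μ := volume)
    (f := fun _ : EuclideanSpace ℝ ι => (1 : ℝ)) (g := Y) (v := EuclideanSpace.single a 1)
    (by simp) (by simpa using hYd) (by simpa using hYi) (by fun_prop)
    (fun y _ => hYs.differentiable (by simp) y)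
  rw [← integral_indicator hΩ.measurableSet, ← hd]
  simpa using key

theorem covDeriv_eq_zero {q : ℕ} {T : LocalTensor ι q}
    (h : ∀ K, (fun z => T z K) =ᶠ[𝓝 y] fun _ => 0) (K : Fin (q + 1) → ι) :
    covDeriv G T y K = 0 := by
  simp only [covDeriv, pderiv_congr (h _), (h _).eq_of_nhds, pderiv_const]
  simp

theorem iterCovDeriv_eq_zero {u : EuclideanSpace ℝ ι → ℝ} {U : Set (EuclideanSpace ℝ ι)}
    (hU : IsOpen U) (h : ∀ y ∈ U, u y = 0) (l : ℕ) :
    ∀ y ∈ U, ∀ K, iterCovDeriv G u l y K = 0 := by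
  induction l with
  | zero => exact fun y hy _ => h y hy
  | succ l ih =>
    intro y hy K
    refine covDeriv_eq_zero (fun J => ?_) K
    filter_upwards [hU.mem_nhds hy] with z hz
    exact ih z hz J

theorem raise_zero (Gy : Matrix ι ι ℝ) {q : ℕ} {T : (Fin q → ι) → ℝ} (h : ∀ K, T K = 0)
    (K : Fin q → ι) : raise Gy T K = 0 := by
  simp [raise, h]

/-- Covariant differentiation is minus the adjoint of the divergence. -/
theorem IsMetricOn.integral_inner_divergence (hG : IsMetricOn G Ω)
    {μ : EuclideanSpace ℝ ι → ℝ} (hμ : IsDensityOn G Ω μ) {q : ℕ}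
    {T : LocalTensor ι q} {S : LocalTensor ι (q + 1)} (hT : SmoothTensorOn T Ω)
    (hS : SmoothTensorOn S Ω) {C : Set (EuclideanSpace ℝ ι)} (hC : IsCompact C) (hCΩ : C ⊆ Ω)
    (h0 : ∀ y ∈ Ω, y ∉ C → ∀ K, T y K = 0) :
    ∫ y in Ω, μ y * ∑ J, raise (G y) (T y) J * divergence G S y J =
      -∫ y in Ω, μ y * ∑ K, raise (G y) (covDeriv G T y) K * S y K := by
  have hμs : ∀ y ∈ Ω, ContDiffAt ℝ ∞ μ y := fun y hy => (hμ y hy).1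
  have hr := hT.raise hG
  have hcT := hT.covDeriv hG
  have hrc := hcT.raise hG
  have hdS := hS.divergence hG
  have hzero : ∀ y ∈ Ω, y ∉ C → ∀ K, covDeriv G T y K = 0 := by
    intro y hy hyC K
    refine covDeriv_eq_zero (fun J => ?_) K
    filter_upwards [hG.isOpen.mem_nhds hy, hC.isClosed.isOpen_compl.mem_nhds hyC] with z h1 h2
    exact h0 z h1 h2 J
  have i1 : IntegrableOn (fun y => μ y * ∑ J, raise (G y) (T y) J * divergence G S y J) Ω := by
    refine integrableOn_of_compact hG.isOpen (fun y hy => ?_) hC hCΩ fun y hy hyC => ?_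
    · exact ((hμs y hy).mul (ContDiffAt.sum fun J _ => (hr y hy J).mul (hdS y hy J))).continuousAt
    · simp [raise_zero _ (h0 y hy hyC)]
  have i2 : IntegrableOn (fun y => μ y * ∑ K, raise (G y) (covDeriv G T y) K * S y K) Ω := by
    refine integrableOn_of_compact hG.isOpen (fun y hy => ?_) hC hCΩ fun y hy hyC => ?_
    · exact ((hμs y hy).mul (ContDiffAt.sum fun J _ => (hrc y hy J).mul (hS y hy J))).continuousAt
    · simp [raise_zero _ (hzero y hy hyC)]
  rw [eq_neg_iff_add_eq_zero, add_comm, ← integral_add i2 i1]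
  have hX : ∀ b, ∀ y ∈ Ω, ContDiffAt ℝ ∞
      (fun z => ∑ J, raise (G z) (T z) J * S z (Fin.cons b J)) y := fun b y hy =>
    ContDiffAt.sum fun J _ => (hr y hy J).mul (hS y hy _)
  have hXa : ∀ a, ∀ y ∈ Ω, ContDiffAt ℝ ∞ (fun z => ∑ b, μ z * (G z)⁻¹ a b *
      ∑ J, raise (G z) (T z) J * S z (Fin.cons b J)) y := fun a y hy =>
    ContDiffAt.sum fun b _ => ((hμs y hy).mul (hG.smooth_inv hy a b)).mul (hX b y hy)
  have hXz : ∀ a, ∀ y ∈ Ω, y ∉ C → ∑ b, μ y * (G y)⁻¹ a b *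
      ∑ J, raise (G y) (T y) J * S y (Fin.cons b J) = 0 := fun a y hy hyC => by
    simp [raise_zero _ (h0 y hy hyC)]
  have e : ∀ y ∈ Ω, μ y * ∑ K, raise (G y) (covDeriv G T y) K * S y K +
      μ y * ∑ J, raise (G y) (T y) J * divergence G S y J =
      ∑ a, pderiv a (fun z => ∑ b, μ z * (G z)⁻¹ a b *
        ∑ J, raise (G z) (T z) J * S z (Fin.cons b J)) y := by
    intro y hy
    rw [← mul_add, ← hG.divergence_inner hy (hT y hy) (hS y hy)]
    exact hG.divergence_eq hμ hy fun b => hX b y hy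
  rw [setIntegral_congr_fun hG.isOpen.measurableSet e, integral_finsetSum]
  · exact Finset.sum_eq_zero fun a _ =>
      setIntegral_pderiv_eq_zero hG.isOpen (hXa a) hC hCΩ (hXz a) a
  · intro a _
    refine integrableOn_of_compact hG.isOpen (fun y hy => ((hXa a y hy).pderiv a).continuousAt)
      hC hCΩ fun y hy hyC => ?_
    rw [pderiv_congr (g := fun _ => 0), pderiv_const]
    filter_upwards [hG.isOpen.mem_nhds hy, hC.isClosed.isOpen_compl.mem_nhds hyC] with z h1 h2
    exact hXz a z h1 h2

/-- Iterated integration by parts: `∇^l` is `(-1)^l` times the adjoint of the `l`-fold divergence. -/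
theorem IsMetricOn.integral_mul_iterDivergence (hG : IsMetricOn G Ω)
    {μ : EuclideanSpace ℝ ι → ℝ} (hμ : IsDensityOn G Ω μ) {u : EuclideanSpace ℝ ι → ℝ}
    (hu : ∀ y ∈ Ω, ContDiffAt ℝ ∞ u y) {C : Set (EuclideanSpace ℝ ι)} (hC : IsCompact C)
    (hCΩ : C ⊆ Ω) (h0 : ∀ y ∈ Ω, y ∉ C → u y = 0) {l : ℕ} {S : LocalTensor ι l}
    (hS : SmoothTensorOn S Ω) :
    ∫ y in Ω, μ y * (u y * iterDivergence G l S y) =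
      (-1) ^ l * ∫ y in Ω, μ y * ∑ J, raise (G y) (iterCovDeriv G u l y) J * S y J := by
  induction l with
  | zero =>
    simp only [pow_zero, one_mul, iterDivergence, iterCovDeriv, raise]
    congr 1
    ext y
    rw [Fintype.sum_unique]
    simp only [Finset.univ_eq_empty, Finset.prod_empty, one_mul, Finset.sum_const,
      Finset.card_univ, Fintype.card_unique, one_smul]
    congr 3
  | succ l ih =>
    have hz : ∀ y ∈ Ω, y ∉ C → ∀ K, iterCovDeriv G u l y K = 0 := fun y hy hyC =>
      iterCovDeriv_eq_zero (U := Ω ∩ Cᶜ) (hG.isOpen.inter hC.isClosed.isOpen_compl)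
        (fun y hy => h0 y hy.1 hy.2) l y ⟨hy, hyC⟩
    simp only [iterDivergence]
    rw [ih (hS.divergence hG), hG.integral_inner_divergence hμ
      (smoothTensorOn_iterCovDeriv hG hu l) hS hC hCΩ hz]
    simp only [iterCovDeriv, pow_succ]
    ring

/-! ### Derivatives of powers -/

theorem covDeriv_pow_mul {f : EuclideanSpace ℝ ι → ℝ} (hf : ContDiffAt ℝ ∞ f y) {q : ℕ} {T : LocalTensor ι q}
    (hT : ∀ K, ContDiffAt ℝ ∞ (fun z => T z K) y) (m : ℕ) (I : Fin (q + 1) → ι) :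
    covDeriv G (fun z K => f z ^ (m + 1) * T z K) y I =
      f y ^ m * ((m + 1) * pderiv (I 0) f y * T y (Fin.tail I) + f y * covDeriv G T y I) := by
  simp only [covDeriv]
  rw [pderiv_mul (diffAt (hf.pow _)) (diffAt (hT _)), pderiv_pow (diffAt hf)]
  have : ∑ s : Fin q, ∑ k, christoffel G k (I 0) (I s.succ) y *
      (f y ^ (m + 1) * T y (Function.update (Fin.tail I) s k)) = f y ^ (m + 1) *
      ∑ s : Fin q, ∑ k, christoffel G k (I 0) (I s.succ) y *
        T y (Function.update (Fin.tail I) s k) := by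
    simp only [Finset.mul_sum]
    exact Finset.sum_congr rfl fun s _ => Finset.sum_congr rfl fun k _ => by ring
  rw [this]
  push_cast
  ring

/-- `∇^l f^m = f^(m-l) T`, where `T` is a multiple of `(df)^{⊗l}` on the zero set of `f`. -/
theorem IsMetricOn.iterCovDeriv_pow (hG : IsMetricOn G Ω) {f : EuclideanSpace ℝ ι → ℝ}
    (hf : ∀ y ∈ Ω, ContDiffAt ℝ ∞ f y) (m l : ℕ) (hl : l ≤ m) :
    ∃ T : LocalTensor ι l, SmoothTensorOn T Ω ∧
      (∀ y ∈ Ω, iterCovDeriv G (fun z => f z ^ m) l y = fun I => f y ^ (m - l) * T y I) ∧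
      ∀ y ∈ Ω, f y = 0 → ∀ I, T y I = m.descFactorial l * ∏ s, pderiv (I s) f y := by
  induction l with
  | zero =>
    exact ⟨fun _ _ => 1, fun y _ K => contDiffAt_const, fun y _ => by simp [iterCovDeriv],
      fun y _ _ I => by simp⟩
  | succ l ih =>
    obtain ⟨T, h1, h2, h3⟩ := ih (by omega)
    obtain ⟨r, hr⟩ : ∃ r, m - l = r + 1 := ⟨m - l - 1, by omega⟩
    have hr' : m - (l + 1) = r := by omega
    refine ⟨fun y I => (r + 1) * pderiv (I 0) f y * T y (Fin.tail I) + f y * covDeriv G T y I,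
      fun y hy K => ?_, fun y hy => ?_, fun y hy h0 I => ?_⟩
    · exact ((contDiffAt_const.mul ((hf y hy).pderiv _)).mul (h1 y hy _)).add
        ((hf y hy).mul (h1.covDeriv hG y hy K))
    · ext I
      rw [hr', ← covDeriv_pow_mul (hf y hy) (h1 y hy), iterCovDeriv]
      refine congrFun (covDeriv_congr fun K => ?_) I
      filter_upwards [hG.eventually hy] with z hz
      rw [h2 z hz, hr]
    · beta_reduce
      rw [h0, zero_mul, add_zero, h3 y hy h0, Nat.descFactorial_succ, hr, Fin.prod_univ_succ]
      push_cast
      simp only [Fin.tail]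
      ring

theorem divergence_pow_mul {f : EuclideanSpace ℝ ι → ℝ} (hf : ContDiffAt ℝ ∞ f y) {q : ℕ} {S : LocalTensor ι (q + 1)}
    (hS : ∀ K, ContDiffAt ℝ ∞ (fun z => S z K) y) (m : ℕ) (J : Fin q → ι) :
    divergence G (fun z K => f z ^ (m + 1) * S z K) y J =
      f y ^ m * ((m + 1) * (∑ b, (∑ a, (G y)⁻¹ a b * pderiv a f y) * S y (Fin.cons b J))
        + f y * divergence G S y J) := by
  simp only [divergence, covDeriv_pow_mul hf hS, Fin.cons_zero, Fin.tail_cons]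
  have : ∑ b, (∑ a, (G y)⁻¹ a b * pderiv a f y) * S y (Fin.cons b J) =
      ∑ a, ∑ b, (G y)⁻¹ a b * pderiv a f y * S y (Fin.cons b J) := by
    rw [Finset.sum_comm]; exact Finset.sum_congr rfl fun b _ => Finset.sum_mul _ _ _
  rw [this]
  simp only [Finset.mul_sum, ← Finset.sum_add_distrib]
  exact Finset.sum_congr rfl fun a _ => Finset.sum_congr rfl fun b _ => by ring

/-- The `l`-fold divergence of `f^r S` is `f^(r-l)` times a function which on the zero set of `f`
is a multiple of the contraction of `S` with the gradient of `f`. -/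
theorem IsMetricOn.iterDivergence_pow_mul (hG : IsMetricOn G Ω) {f : EuclideanSpace ℝ ι → ℝ}
    (hf : ∀ y ∈ Ω, ContDiffAt ℝ ∞ f y) {l : ℕ} (r : ℕ) (hl : l ≤ r) {S : LocalTensor ι l}
    (hS : SmoothTensorOn S Ω) : ∀ y ∈ Ω, f y = 0 →
      iterDivergence G l (fun z K => f z ^ r * S z K) y = 0 ^ (r - l) *
        (r.descFactorial l * ∑ J, (∏ s, ∑ a, (G y)⁻¹ a (J s) * pderiv a f y) * S y J) := by
  induction l generalizing r with
  | zero =>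
    intro y hy h0
    rw [Fintype.sum_unique]
    simp only [iterDivergence, h0, Nat.sub_zero, Nat.descFactorial_zero, Finset.univ_eq_empty,
      Finset.prod_empty, one_mul, Nat.cast_one]
    congr 2
  | succ l ih =>
    intro y hy h0
    obtain ⟨r, rfl⟩ : ∃ r', r = r' + 1 := ⟨r - 1, by omega⟩
    simp only [iterDivergence]
    have hS' : SmoothTensorOn (fun z J => ((r : ℝ) + 1) *
        (∑ b, (∑ a, (G z)⁻¹ a b * pderiv a f z) * S z (Fin.cons b J))
        + f z * divergence G S z J) Ω := fun y hy J =>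
      (contDiffAt_const.mul (ContDiffAt.sum fun b _ => (ContDiffAt.sum fun a _ =>
        (hG.smooth_inv hy a b).mul ((hf y hy).pderiv a)).mul (hS y hy _))).add
        ((hf y hy).mul (hS.divergence hG y hy J))
    rw [iterDivergence_congr hG.isOpen (T' := fun z J => f z ^ r * (((r : ℝ) + 1) *
        (∑ b, (∑ a, (G z)⁻¹ a b * pderiv a f z) * S z (Fin.cons b J))
        + f z * divergence G S z J))
      (fun z hz => by ext J; exact divergence_pow_mul (hf z hz) (hS z hz) r J) y hy,
      ih r (by omega) hS' y hy h0]
    simp only [h0, zero_mul, add_zero, Nat.succ_descFactorial_succ, Nat.add_sub_add_right]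
    push_cast
    rw [sum_cons]
    simp only [Fin.prod_univ_succ, Fin.cons_zero, Fin.cons_succ, Finset.mul_sum]
    rw [Finset.sum_comm]
    exact Finset.sum_congr rfl fun b _ => Finset.sum_congr rfl fun J _ => by ring

end LocalAnalysis

/-! ### The formal algebra of the operators `-2ρ∂² + 2s∂ + M(ρ)` -/

section Ladder

variable {F : Type*} [AddCommGroup F] [Module ℝ F] (M : ℕ → Module.End ℝ F) (N : ℕ)

/-- The operator `-2ρ∂² + 2s∂ + ∑_{j < N} ρ^j M_j` on Laurent polynomials in `ρ` with coefficients
in `F`; it sends `ρ^i u` to `2i(s+1-i) ρ^(i-1) u + ∑_j ρ^(i+j) M_j u`. -/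
def ladder (s : ℤ) : (ℤ →₀ F) →ₗ[ℝ] (ℤ →₀ F) :=
  Finsupp.lsum ℝ fun i => ((2 * i * (s + 1 - i) : ℤ) : ℝ) • Finsupp.lsingle (i - 1) +
    ∑ j ∈ Finset.range N, (Finsupp.lsingle (i + j)).comp (M j)

/-- Multiplication by `ρ^d` on Laurent polynomials. -/
def laurentShift (F : Type*) [AddCommGroup F] [Module ℝ F] (d : ℤ) : (ℤ →₀ F) →ₗ[ℝ] (ℤ →₀ F) :=
  Finsupp.lsum ℝ fun i => Finsupp.lsingle (i + d)

/-- The product `D_{s-2(m-1)} ⋯ D_{s-2} D_s` of `m` ladder operators. -/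
def ladderChain (s : ℤ) : ℕ → (ℤ →₀ F) →ₗ[ℝ] (ℤ →₀ F)
  | 0 => LinearMap.id
  | m + 1 => (ladder M N (s - 2 * m)).comp (ladderChain s m)

/-- The residue pairing `∮ B(f, g) dρ` of Laurent polynomials. -/
def residuePairing (B : F →ₗ[ℝ] F →ₗ[ℝ] ℝ) : (ℤ →₀ F) →ₗ[ℝ] (ℤ →₀ F) →ₗ[ℝ] ℝ :=
  Finsupp.lsum ℝ fun i => B.compl₂ (Finsupp.lapply (-1 - i))

theorem ladder_single (s i : ℤ) (u : F) : ladder M N s (Finsupp.single i u) =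
    ((2 * i * (s + 1 - i) : ℤ) : ℝ) • Finsupp.single (i - 1) u +
      ∑ j ∈ Finset.range N, Finsupp.single (i + j) (M j u) := by
  simp only [ladder, Finsupp.lsum_single, LinearMap.add_apply, LinearMap.smul_apply,
    LinearMap.sum_apply, LinearMap.comp_apply, Finsupp.lsingle_apply]

theorem ladder_apply (s : ℤ) (f : ℤ →₀ F) (i : ℤ) : ladder M N s f i =
    ((2 * (i + 1) * (s - i) : ℤ) : ℝ) • f (i + 1) +
      ∑ j ∈ Finset.range N, M j (f (i - j)) := by
  induction f using Finsupp.induction_linear with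
  | zero => simp
  | add f g hf hg =>
    simp only [map_add, Finsupp.add_apply, hf, hg, smul_add, Finset.sum_add_distrib]; abel
  | single a u =>
    rw [ladder_single]
    simp only [Finsupp.add_apply, Finsupp.smul_apply, Finsupp.finsetSum_apply,
      Finsupp.single_apply]
    congr 1
    · by_cases h : a = i + 1
      · subst h; simp only [add_sub_cancel_right, if_true]; congr 3; ring
      · rw [if_neg h, if_neg (by omega)]; simp
    · refine Finset.sum_congr rfl fun j _ => ?_
      by_cases h : a = i - j
      · subst h; simp
      · rw [if_neg h, if_neg (by omega)]; simp

@[simp] theorem laurentShift_single (d i : ℤ) (u : F) :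
    laurentShift F d (Finsupp.single i u) = Finsupp.single (i + d) u := by
  simp [laurentShift]

theorem laurentShift_apply (d : ℤ) (f : ℤ →₀ F) (i : ℤ) :
    laurentShift F d f i = f (i - d) := by
  induction f using Finsupp.induction_linear with
  | zero => simp
  | add f g hf hg => simp [hf, hg]
  | single a u =>
    simp only [laurentShift_single, Finsupp.single_apply]
    congr 1
    exact propext (by omega)

theorem ladder_shift (s : ℤ) (f : ℤ →₀ F) : ladder M N s (laurentShift F 1 f) =
    laurentShift F 1 (ladder M N (s - 2) f) + ((2 * s : ℤ) : ℝ) • f := by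
  ext i
  simp only [ladder_apply, Finsupp.add_apply, Finsupp.smul_apply, laurentShift_apply]
  have h1 : ∀ j : ℕ, i - (j : ℤ) - 1 = i - 1 - j := fun j => by ring
  simp only [h1, add_sub_cancel_right, sub_add_cancel]
  rw [add_right_comm, ← add_smul]
  congr 2
  push_cast
  ring

theorem ladderChain_succ' (s : ℤ) (m : ℕ) (f : ℤ →₀ F) :
    ladderChain M N s (m + 1) f = ladderChain M N (s - 2) m (ladder M N s f) := by
  induction m with
  | zero => simp [ladderChain]
  | succ m ih =>
    rw [ladderChain, LinearMap.comp_apply, ih, ladderChain, LinearMap.comp_apply]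
    congr 2
    push_cast
    ring

/-- Commuting a chain of ladder operators with multiplication by `ρ`; the lower order term
vanishes exactly for the chains that define the GJMS operators. -/
theorem ladderChain_shift (s : ℤ) (m : ℕ) (f : ℤ →₀ F) :
    ladderChain M N s m (laurentShift F 1 f) = laurentShift F 1 (ladderChain M N (s - 2) m f) +
      ((2 * m * (s - m + 1) : ℤ) : ℝ) • ladderChain M N (s - 2) (m - 1) f := by
  induction m with
  | zero => simp [ladderChain]
  | succ m ih =>
    rw [ladderChain, LinearMap.comp_apply, ih, map_add, map_smul, ladder_shift]
    have h1 : s - 2 * (m : ℤ) - 2 = s - 2 - 2 * m := by ring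
    rw [h1, ladderChain, LinearMap.comp_apply, add_assoc]
    congr 1
    rw [Nat.add_sub_cancel]
    rcases m with _ | m
    · simp [ladderChain]
    · have h2 : ladder M N (s - 2 * ((m + 1 : ℕ) : ℤ)) (ladderChain M N (s - 2) (m + 1 - 1) f) =
          ladderChain M N (s - 2) (m + 1) f := by
        rw [Nat.add_sub_cancel, ladderChain, LinearMap.comp_apply]
        congr 2
        push_cast
        ring
      rw [h2, ← add_smul]
      congr 1
      push_cast
      ring

theorem ladder_nonneg (s : ℤ) {f : ℤ →₀ F} (hf : ∀ i < 0, f i = 0) :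
    ∀ i < 0, ladder M N s f i = 0 := by
  intro i hi
  rw [ladder_apply, Finset.sum_eq_zero fun j _ => by rw [hf _ (by omega), map_zero], add_zero]
  rcases eq_or_lt_of_le (show i + 1 ≤ 0 by omega) with h | h
  · simp [h]
  · rw [hf _ h, smul_zero]

theorem ladderChain_nonneg (s : ℤ) (m : ℕ) {f : ℤ →₀ F} (hf : ∀ i < 0, f i = 0) :
    ∀ i < 0, ladderChain M N s m f i = 0 := by
  induction m with
  | zero => exact hf
  | succ m ih =>
    intro i hi
    rw [ladderChain, LinearMap.comp_apply]
    exact ladder_nonneg M N _ ih i hi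

/-- The value at `ρ = 0` of the GJMS chain only depends on the value at `ρ = 0`. -/
theorem ladderChain_apply_zero (k : ℕ) {f : ℤ →₀ F} (hf : ∀ i < 0, f i = 0) :
    ladderChain M N (k - 1) k f 0 = ladderChain M N (k - 1) k (Finsupp.single 0 (f 0)) 0 := by
  set h := laurentShift F (-1) (f - Finsupp.single 0 (f 0)) with hh
  have h1 : f = Finsupp.single 0 (f 0) + laurentShift F 1 h := by
    ext i
    simp [hh, laurentShift_apply]
  have h2 : ∀ i < 0, h i = 0 := by
    intro i hi
    rw [hh, laurentShift_apply, Finsupp.sub_apply, Finsupp.single_apply]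
    rcases eq_or_lt_of_le (show i + 1 ≤ 0 by omega) with h | h
    · simp [show i = -1 by omega]
    · rw [hf _ (by omega), if_neg (by omega), sub_zero]
  conv_lhs => rw [h1]
  rw [map_add, ladderChain_shift, Finsupp.add_apply, Finsupp.add_apply, laurentShift_apply,
    ladderChain_nonneg M N _ _ h2 _ (by norm_num)]
  simp

variable {M N} {B : F →ₗ[ℝ] F →ₗ[ℝ] ℝ}

theorem residuePairing_single (i j : ℤ) (u v : F) :
    residuePairing B (Finsupp.single i u) (Finsupp.single j v) =
      if j = -1 - i then B u v else 0 := by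
  simp only [residuePairing, Finsupp.lsum_single, LinearMap.compl₂_apply, Finsupp.lapply_apply,
    Finsupp.single_apply]
  split_ifs <;> simp

theorem residuePairing_single_left (i : ℤ) (u : F) (g : ℤ →₀ F) :
    residuePairing B (Finsupp.single i u) g = B u (g (-1 - i)) := by
  simp [residuePairing]

theorem residuePairing_single_right (f : ℤ →₀ F) (j : ℤ) (v : F) :
    residuePairing B f (Finsupp.single j v) = B (f (-1 - j)) v := by
  induction f using Finsupp.induction_linear with
  | zero => simp
  | add f g hf hg => simp [hf, hg]
  | single a u =>
    rw [residuePairing_single, Finsupp.single_apply]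
    by_cases h : a = -1 - j
    · rw [if_pos h, if_pos (by omega)]
    · rw [if_neg h, if_neg (by omega)]; simp

/-- If the `M_j` are self-adjoint, the adjoint of `D_s` under the residue pairing is `D_{-s-2}`. -/
theorem residuePairing_ladder (hM : ∀ j u v, B (M j u) v = B u (M j v)) (s : ℤ) (f g : ℤ →₀ F) :
    residuePairing B (ladder M N s f) g = residuePairing B f (ladder M N (-s - 2) g) := by
  induction f using Finsupp.induction_linear with
  | zero => simp
  | add f g hf hg => simp only [map_add, LinearMap.add_apply, hf, hg]
  | single i u =>
    induction g using Finsupp.induction_linear with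
    | zero => simp
    | add f g hf hg => simp only [map_add, hf, hg]
    | single j v =>
      simp only [ladder_single, map_add, map_smul, map_sum, LinearMap.add_apply,
        LinearMap.smul_apply, LinearMap.sum_apply, residuePairing_single, hM]
      congr 1
      · by_cases h : j = -i
        · subst h
          rw [if_pos (by ring), if_pos (by ring)]
          congr 2
          ring
        · rw [if_neg (by omega), if_neg (by omega)]; simp
      · refine Finset.sum_congr rfl fun m _ => ?_
        congr 1
        exact propext (by omega)

theorem residuePairing_ladderChain (hM : ∀ j u v, B (M j u) v = B u (M j v)) (s : ℤ) (m : ℕ)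
    (f g : ℤ →₀ F) : residuePairing B (ladderChain M N s m f) g =
      residuePairing B f (ladderChain M N (2 * m - 4 - s) m g) := by
  induction m generalizing g with
  | zero => simp [ladderChain]
  | succ m ih =>
    rw [ladderChain, LinearMap.comp_apply, residuePairing_ladder hM, ih, ladderChain_succ']
    congr 3
    · push_cast; ring
    · congr 1; push_cast; ring

/-- The GJMS chain of formally self-adjoint operators `M_j` is formally self-adjoint: under the
residue pairing its adjoint is the chain shifted by `-2`, which is its conjugate by `ρ`. -/
theorem ladderChain_selfAdjoint (hM : ∀ j u v, B (M j u) v = B u (M j v)) (k : ℕ) (u v : F) :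
    B (ladderChain M N (k - 1) k (Finsupp.single 0 u) 0) v =
      B u (ladderChain M N (k - 1) k (Finsupp.single 0 v) 0) := by
  have h1 := residuePairing_ladderChain (N := N) hM (k - 1) k (Finsupp.single 0 u)
    (Finsupp.single (-1) v)
  rw [residuePairing_single_right, residuePairing_single_left] at h1
  have h2 := ladderChain_shift M N (k - 1) k (Finsupp.single (-1) v)
  have h4 : (2 * (k : ℤ) * (k - 1 - k + 1)) = 0 := by ring
  rw [laurentShift_single, h4, Int.cast_zero, zero_smul, add_zero, neg_add_cancel] at h2
  have h3 : (2 * (k : ℤ) - 4 - (k - 1)) = k - 1 - 2 := by ring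
  rw [h3] at h1
  rw [h2, laurentShift_apply]
  simpa using h1

end Ladder

/-! ### Differential operators as endomorphisms of an algebra of functions -/

section Order

variable {F : Type*} [CommRing F] [Algebra ℝ F] {X : Type*} (ev : X → F →ₐ[ℝ] ℝ)

/-- The endomorphism `Q` of an algebra of functions is a differential operator of order `< m`:
`Q u` vanishes at every point at which `u` vanishes to order `m`. -/
def IsOrd (m : ℕ) (Q : Module.End ℝ F) : Prop :=
  ∀ x, ∀ u ∈ RingHom.ker (ev x) ^ m, ev x (Q u) = 0

/-- The commutator of `Q` with multiplication by `f`. -/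
def mulComm (Q : Module.End ℝ F) (f : F) : Module.End ℝ F :=
  Q * LinearMap.mulLeft ℝ f - LinearMap.mulLeft ℝ f * Q

@[simp] theorem mulComm_apply (Q : Module.End ℝ F) (f u : F) :
    mulComm Q f u = Q (f * u) - f * Q u := by
  simp [mulComm]

variable {ev}

theorem IsOrd.add {m : ℕ} {Q R : Module.End ℝ F} (hQ : IsOrd ev m Q) (hR : IsOrd ev m R) :
    IsOrd ev m (Q + R) := fun x u hu => by
  simp [hQ x u hu, hR x u hu]

theorem IsOrd.smul {m : ℕ} {Q : Module.End ℝ F} (hQ : IsOrd ev m Q) (c : ℝ) :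
    IsOrd ev m (c • Q) := fun x u hu => by
  simp [hQ x u hu]

theorem IsOrd.sub {m : ℕ} {Q R : Module.End ℝ F} (hQ : IsOrd ev m Q) (hR : IsOrd ev m R) :
    IsOrd ev m (Q - R) := fun x u hu => by
  simp [hQ x u hu, hR x u hu]

theorem isOrd_zero (m : ℕ) : IsOrd ev m (0 : Module.End ℝ F) := fun x u _ => by simp

theorem isOrd_sum {α : Type*} (s : Finset α) {m : ℕ} {Q : α → Module.End ℝ F}
    (h : ∀ a ∈ s, IsOrd ev m (Q a)) : IsOrd ev m (∑ a ∈ s, Q a) := by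
  classical
  induction s using Finset.induction_on with
  | empty => exact isOrd_zero m
  | insert a s ha ih =>
    rw [Finset.sum_insert ha]
    exact (h a (by simp)).add (ih fun b hb => h b (by simp [hb]))

theorem IsOrd.mono {m m' : ℕ} (h : m ≤ m') {Q : Module.End ℝ F} (hQ : IsOrd ev m Q) :
    IsOrd ev m' Q := fun x u hu => hQ x u (Ideal.pow_le_pow_right h hu)

theorem isOrd_zero_iff (hev : ∀ u, (∀ x, ev x u = 0) → u = 0) {Q : Module.End ℝ F} :
    IsOrd ev 0 Q ↔ Q = 0 := by
  constructor
  · intro h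
    ext u
    exact hev _ fun x => h x u (by simp)
  · rintro rfl; exact isOrd_zero 0

/-- Grothendieck's characterization of differential operators by commutators with functions. -/
theorem isOrd_succ_iff {m : ℕ} {Q : Module.End ℝ F} :
    IsOrd ev (m + 1) Q ↔ ∀ f, IsOrd ev m (mulComm Q f) := by
  constructor
  · intro h f x u hu
    have h1 : f - algebraMap ℝ F (ev x f) ∈ RingHom.ker (ev x) := by
      rw [RingHom.mem_ker]; simp
    have h2 := h x _ (by rw [pow_succ']; exact Ideal.mul_mem_mul h1 hu)
    rw [sub_mul, map_sub, map_sub, ← Algebra.smul_def, map_smul, map_smul, smul_eq_mul] at h2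
    simpa using h2
  · intro h x u hu
    rw [pow_succ'] at hu
    refine Submodule.mul_induction_on hu (fun f hf v hv => ?_) fun a b ha hb => by simp [ha, hb]
    rw [RingHom.mem_ker] at hf
    have := h f x v hv
    rw [mulComm_apply, map_sub, map_mul (ev x), hf, zero_mul, sub_zero] at this
    exact this

theorem IsOrd.mul (hev : ∀ u, (∀ x, ev x u = 0) → u = 0) {a b : ℕ} {Q R : Module.End ℝ F}
    (hQ : IsOrd ev (a + 1) Q) (hR : IsOrd ev (b + 1) R) : IsOrd ev (a + b + 1) (Q * R) := by
  obtain ⟨c, hc⟩ : ∃ c, c = a + b := ⟨_, rfl⟩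
  rw [← hc]
  induction c generalizing a b Q R with
  | zero =>
    obtain rfl : a = 0 := by omega
    obtain rfl : b = 0 := by omega
    rw [isOrd_succ_iff]
    intro f
    have h1 := (isOrd_zero_iff hev).1 (isOrd_succ_iff.1 hQ f)
    have h2 := (isOrd_zero_iff hev).1 (isOrd_succ_iff.1 hR f)
    rw [isOrd_zero_iff hev]
    ext u
    have h3 := LinearMap.congr_fun h1 (R u)
    have h4 := congrArg Q (LinearMap.congr_fun h2 u)
    simp only [mulComm_apply, LinearMap.zero_apply, map_zero, map_sub] at h3 h4
    simp only [mulComm_apply, Module.End.mul_apply, LinearMap.zero_apply]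
    linear_combination h3 + h4
  | succ c ih =>
    rw [isOrd_succ_iff]
    intro f
    have h0 : mulComm (Q * R) f = Q * mulComm R f + mulComm Q f * R := by
      ext u
      simp
    rw [h0]
    refine IsOrd.add ?_ ?_
    · rcases b with _ | b
      · rw [(isOrd_zero_iff hev).1 (isOrd_succ_iff.1 hR f), mul_zero]; exact isOrd_zero _
      · exact ih hQ (isOrd_succ_iff.1 hR f) (by omega)
    · rcases a with _ | a
      · rw [(isOrd_zero_iff hev).1 (isOrd_succ_iff.1 hQ f), zero_mul]; exact isOrd_zero _
      · exact ih (isOrd_succ_iff.1 hQ f) hR (by omega)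

theorem isOrd_one : IsOrd ev 1 (1 : Module.End ℝ F) := fun x u hu => by
  simpa [RingHom.mem_ker] using hu

theorem IsOrd.pow (hev : ∀ u, (∀ x, ev x u = 0) → u = 0) {a : ℕ} {Q : Module.End ℝ F}
    (hQ : IsOrd ev (a + 1) Q) (m : ℕ) : IsOrd ev (a * m + 1) (Q ^ m) := by
  induction m with
  | zero => simpa using isOrd_one
  | succ m ih =>
    rw [pow_succ', mul_add, mul_one, add_comm (a * m) a]
    exact hQ.mul hev ih

/-- The coefficient of `t` in the polynomial `ℓ ((f + t g)^(a+1) G)`. -/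
theorem polarize (ℓ : F →ₗ[ℝ] ℝ) (f g G : F) (a : ℕ)
    (h : ∀ t : ℝ, ℓ ((t • g + f) ^ (a + 1) * G) = 0) : ℓ (f ^ a * (g * G)) = 0 := by
  set p : Polynomial ℝ := ∑ m ∈ Finset.range (a + 1 + 1),
    Polynomial.monomial m (ℓ (g ^ m * f ^ (a + 1 - m) * ((a + 1).choose m : F) * G)) with hp
  have h1 : p = 0 := by
    refine Polynomial.funext fun t => ?_
    rw [Polynomial.eval_zero, ← h t, add_pow, Finset.sum_mul, map_sum, hp,
      Polynomial.eval_finsetSum]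
    refine Finset.sum_congr rfl fun m _ => ?_
    rw [Polynomial.eval_monomial, smul_pow, smul_mul_assoc, smul_mul_assoc, smul_mul_assoc,
      map_smul, smul_eq_mul, mul_comm]
  have h2 : p.coeff 1 = ℓ (g ^ 1 * f ^ (a + 1 - 1) * ((a + 1).choose 1 : F) * G) := by
    rw [hp, Polynomial.finsetSum_coeff, Finset.sum_eq_single 1]
    · rw [Polynomial.coeff_monomial, if_pos rfl]
    · intro m _ hm; rw [Polynomial.coeff_monomial, if_neg hm]
    · intro hm; simp at hm
  rw [h1, Polynomial.coeff_zero, Nat.choose_one_right, pow_one, Nat.add_sub_cancel] at h2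
  have h3 : g * f ^ a * ((a + 1 : ℕ) : F) * G = ((a : ℝ) + 1) • (f ^ a * (g * G)) := by
    rw [Algebra.smul_def, map_add, map_natCast, map_one]; push_cast; ring
  rw [h3, map_smul, smul_eq_mul] at h2
  exact (mul_eq_zero.1 h2.symm).resolve_left (by positivity)

/-- By polarization, the order of an operator can be tested on powers. -/
theorem isOrd_of_pow {m : ℕ} {Q : Module.End ℝ F}
    (h : ∀ x, ∀ f, ev x f = 0 → ev x (Q (f ^ (m + 1))) = 0) : IsOrd ev (m + 1) Q := by
  intro x
  set ℓ : F →ₗ[ℝ] ℝ := (ev x).toLinearMap.comp Q with hℓ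
  have key : ∀ b, b ≤ m → ∀ f, ev x f = 0 → ∀ G ∈ RingHom.ker (ev x) ^ (b + 1),
      ℓ (f ^ (m - b) * G) = 0 := by
    intro b
    induction b with
    | zero =>
      intro _ f hf G hG
      rw [zero_add, pow_one, RingHom.mem_ker] at hG
      have := polarize ℓ f G 1 m fun t => by
        rw [mul_one]; exact h x _ (by simp [hf, hG])
      simpa using this
    | succ b ih =>
      intro hb f hf G hG
      rw [pow_succ'] at hG
      refine Submodule.mul_induction_on hG (fun g hg v hv => ?_) fun c d hc hd => by
        rw [mul_add, map_add, hc, hd, add_zero]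
      refine polarize ℓ f g v _ fun t => ?_
      have : m - (b + 1) + 1 = m - b := by omega
      rw [this]
      exact ih (by omega) _ (by simp [hf, RingHom.mem_ker.1 hg]) v hv
  intro u hu
  have := key m le_rfl 0 (map_zero _) u hu
  simpa [hℓ] using this

/-- A differential operator of order `≤ m` which is (anti-)self-adjoint of the parity opposite to
that of `m` has order `< m`. -/
theorem IsOrd.of_adjoint (hev : ∀ u, (∀ x, ev x u = 0) → u = 0) {B : F →ₗ[ℝ] F →ₗ[ℝ] ℝ}
    (hmul : ∀ f u v, B (f * u) v = B u (f * v)) (hdef : ∀ u, B u u = 0 → u = 0) {m : ℕ}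
    {Q : Module.End ℝ F} (hQ : IsOrd ev (m + 1) Q)
    (hadj : ∀ u v, B (Q u) v = (-1) ^ (m + 1) * B u (Q v)) : IsOrd ev m Q := by
  induction m generalizing Q with
  | zero =>
    have h1 : ∀ u, Q u = u * Q 1 := by
      intro u
      have := LinearMap.congr_fun ((isOrd_zero_iff hev).1 (isOrd_succ_iff.1 hQ u)) 1
      simpa [sub_eq_zero] using this
    have h2 := hadj 1 (Q 1)
    rw [h1 (Q 1), zero_add, pow_one] at h2
    have h3 := hmul (Q 1) 1 (Q 1)
    rw [mul_one] at h3
    have h4 : Q 1 = 0 := hdef _ (by rw [h3] at h2 ⊢; linarith)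
    rw [isOrd_zero_iff hev]
    ext u
    rw [h1, h4, mul_zero, LinearMap.zero_apply]
  | succ m ih =>
    rw [isOrd_succ_iff]
    intro f
    refine ih (isOrd_succ_iff.1 hQ f) fun u v => ?_
    simp only [mulComm_apply, map_sub, LinearMap.sub_apply, hadj, hmul]
    ring

/-- Modulo `I^(m+1)`, a product of `m` elements of `I` depends only on their classes modulo `I^2`. -/
theorem prod_sub_prod_mem {I : Ideal F} {α : Type*} [DecidableEq α] (s : Finset α) {f f' : α → F}
    (hf : ∀ a, f a ∈ I) (hf' : ∀ a, f' a ∈ I) (h : ∀ a, f a - f' a ∈ I ^ 2) :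
    ∏ a ∈ s, f a ∈ I ^ s.card ∧ ∏ a ∈ s, f a - ∏ a ∈ s, f' a ∈ I ^ (s.card + 1) := by
  induction s using Finset.induction_on with
  | empty => simp
  | insert a s ha ih =>
    rw [Finset.prod_insert ha, Finset.prod_insert ha, Finset.card_insert_of_notMem ha]
    refine ⟨?_, ?_⟩
    · rw [pow_succ']; exact Ideal.mul_mem_mul (hf a) ih.1
    · have h1 : f a * ∏ b ∈ s, f b - f' a * ∏ b ∈ s, f' b =
          (f a - f' a) * ∏ b ∈ s, f b + f' a * (∏ b ∈ s, f b - ∏ b ∈ s, f' b) := by ring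
      rw [h1]
      refine Ideal.add_mem _ ?_ ?_
      · rw [show s.card + 1 + 1 = 2 + s.card by ring, pow_add]
        exact Ideal.mul_mem_mul (h a) ih.1
      · rw [pow_succ' _ (s.card + 1)]; exact Ideal.mul_mem_mul (hf' a) ih.2

/-- The principal symbol only depends on the differentials. -/
theorem IsOrd.symbol_congr {m : ℕ} {Q : Module.End ℝ F} (hQ : IsOrd ev (m + 1) Q) (x : X)
    {f f' : Fin m → F} (hf : ∀ a, ev x (f a) = 0) (hf' : ∀ a, ev x (f' a) = 0)
    (h : ∀ a, f a - f' a ∈ RingHom.ker (ev x) ^ 2) :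
    ev x (Q (∏ a, f a)) = ev x (Q (∏ a, f' a)) := by
  have h1 := (prod_sub_prod_mem Finset.univ (I := RingHom.ker (ev x)) hf hf' h).2
  rw [Finset.card_univ, Fintype.card_fin] at h1
  have h2 := hQ x _ h1
  rw [map_sub, map_sub, sub_eq_zero] at h2
  exact h2

variable (M : ℕ → Module.End ℝ F) (N : ℕ)

/-- The operator giving the coefficient of `ρ^i` in the chain applied to `u`. -/
def ladderCoeff (s : ℤ) (m : ℕ) (i : ℤ) : Module.End ℝ F :=
  ((Finsupp.lapply i).comp (ladderChain M N s m)).comp (Finsupp.lsingle 0)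

theorem ladderCoeff_apply (s : ℤ) (m : ℕ) (i : ℤ) (u : F) :
    ladderCoeff M N s m i u = ladderChain M N s m (Finsupp.single 0 u) i := rfl

theorem ladderCoeff_succ (s : ℤ) (m : ℕ) (i : ℤ) : ladderCoeff M N s (m + 1) i =
    ((2 * (i + 1) * (s - 2 * m - i) : ℤ) : ℝ) • ladderCoeff M N s m (i + 1) +
      ∑ j ∈ Finset.range N, M j * ladderCoeff M N s m (i - j) := by
  ext u
  rw [ladderCoeff_apply, ladderChain, LinearMap.comp_apply, ladder_apply]
  simp [ladderCoeff_apply]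

variable {M N}

theorem isOrd_ladderCoeff (hev : ∀ u, (∀ x, ev x u = 0) → u = 0) (hM : ∀ j, IsOrd ev 3 (M j))
    (s : ℤ) (m : ℕ) (i : ℤ) : IsOrd ev (2 * m + 1) (ladderCoeff M N s m i) := by
  induction m generalizing i with
  | zero =>
    by_cases h : i = 0
    · have : ladderCoeff M N s 0 i = 1 := by
        ext u; simp [ladderCoeff_apply, ladderChain, h]
      rw [this]; exact isOrd_one
    · have : ladderCoeff M N s 0 i = 0 := by
        ext u
        simp [ladderCoeff_apply, ladderChain, Ne.symm h]
      rw [this]; exact isOrd_zero _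
  | succ m ih =>
    rw [ladderCoeff_succ]
    refine (((ih _).mono (by omega)).smul _).add (isOrd_sum _ fun j _ => ?_)
    have := (hM j).mul hev (ih (i - j))
    rwa [show 2 + 2 * m + 1 = 2 * (m + 1) + 1 by ring] at this

/-- The leading part of the GJMS chain is a power of `M 0`. -/
theorem isOrd_ladderCoeff_sub_pow (hev : ∀ u, (∀ x, ev x u = 0) → u = 0)
    (hM : ∀ j, IsOrd ev 3 (M j)) (hN : 0 < N) (s : ℤ) (m : ℕ) :
    IsOrd ev (2 * m + 1) (ladderCoeff M N s (m + 1) 0 - M 0 ^ (m + 1)) := by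
  have hneg : ∀ m, ∀ i < 0, ladderCoeff M N s m i = 0 := by
    intro m i hi
    ext u
    refine ladderChain_nonneg M N s m (fun i hi => ?_) i hi
    rw [Finsupp.lsingle_apply, Finsupp.single_apply, if_neg (by omega)]
  have hstep : ∀ m, ladderCoeff M N s (m + 1) 0 =
      ((2 * (0 + 1) * (s - 2 * m - 0) : ℤ) : ℝ) • ladderCoeff M N s m (0 + 1) +
        M 0 * ladderCoeff M N s m 0 := by
    intro m
    rw [ladderCoeff_succ]
    congr 1
    rw [Finset.sum_eq_single 0]
    · simp
    · intro j _ hj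
      rw [hneg m _ (by omega), mul_zero]
    · intro h; simp at h; omega
  induction m with
  | zero =>
    rw [hstep, zero_add, pow_one]
    have : ladderCoeff M N s 0 0 = 1 := by
      ext u; simp [ladderCoeff_apply, ladderChain]
    rw [this, mul_one (M 0), add_sub_assoc, sub_self, add_zero]
    exact (isOrd_ladderCoeff hev hM s 0 _).smul _
  | succ m ih =>
    rw [hstep, pow_succ', add_sub_assoc, ← mul_sub]
    refine ((isOrd_ladderCoeff hev hM s (m + 1) _).smul _).add ?_
    have := (hM 0).mul hev ih
    rwa [show 2 + 2 * m + 1 = 2 * (m + 1) + 1 by ring] at this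

/-- Changing a second-order operator by a function changes its powers by terms of order at least two
lower. -/
theorem isOrd_pow_sub_pow (hev : ∀ u, (∀ x, ev x u = 0) → u = 0) {P D : Module.End ℝ F}
    (hP : IsOrd ev 3 P) (hPD : IsOrd ev 1 (P - D)) (m : ℕ) :
    IsOrd ev (2 * m + 1) (P ^ (m + 1) - D ^ (m + 1)) := by
  have hD : IsOrd ev 3 D := by
    have := hP.sub (hPD.mono (show 1 ≤ 3 by norm_num))
    rwa [sub_sub_cancel] at this
  induction m with
  | zero => simpa using hPD
  | succ m ih =>
    have : P ^ (m + 1 + 1) - D ^ (m + 1 + 1) =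
        P * (P ^ (m + 1) - D ^ (m + 1)) + (P - D) * D ^ (m + 1) := by
      rw [pow_succ' P (m + 1), pow_succ' D (m + 1), mul_sub, sub_mul]; abel
    rw [this]
    refine IsOrd.add ?_ ?_
    · have := hP.mul hev ih
      rwa [show 2 + 2 * m + 1 = 2 * (m + 1) + 1 by ring] at this
    · have := hPD.mul (a := 0) hev (hD.pow (a := 2) hev (m + 1))
      rwa [zero_add] at this

end Order

/-! ### Smooth functions and charts -/

section Charts

variable {n : ℕ} {M : Type*} [TopologicalSpace M] [ChartedSpace (E n) M] [IsManifold (𝓡 n) ∞ M]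
  {φ ψ : OpenPartialHomeomorph M (E n)} {x : M} {y : E n}

/-- The algebra of smooth functions. -/
abbrev SmoothFn (n : ℕ) (M : Type*) [TopologicalSpace M] [ChartedSpace (E n) M] :
    Type _ := ContMDiffMap (𝓡 n) 𝓘(ℝ, ℝ) M ℝ ∞

theorem mem_maxAtlas (hφ : φ ∈ atlas (E n) M) : φ ∈ IsManifold.maximalAtlas (𝓡 n) ∞ M :=
  IsManifold.subset_maximalAtlas hφ

theorem contDiffAt_comp_symm {f : M → ℝ} (hφ : φ ∈ atlas (E n) M) (hy : y ∈ φ.target)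
    (hf : ContMDiffAt (𝓡 n) 𝓘(ℝ, ℝ) ∞ f (φ.symm y)) : ContDiffAt ℝ ∞ (f ∘ φ.symm) y := by
  rw [← contMDiffAt_iff_contDiffAt]
  exact hf.comp y (contMDiffAt_symm_of_mem_maximalAtlas (mem_maxAtlas hφ) hy)

theorem SmoothFn.contDiffAt (u : SmoothFn n M) (hφ : φ ∈ atlas (E n) M) (hy : y ∈ φ.target) :
    ContDiffAt ℝ ∞ (u ∘ φ.symm) y :=
  contDiffAt_comp_symm hφ hy u.contMDiff.contMDiffAt

theorem contMDiffAt_of_comp_symm {f : M → ℝ} (hφ : φ ∈ atlas (E n) M) (hx : x ∈ φ.source)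
    (hf : ContDiffAt ℝ ∞ (f ∘ φ.symm) (φ x)) : ContMDiffAt (𝓡 n) 𝓘(ℝ, ℝ) ∞ f x := by
  rw [← contMDiffAt_iff_contDiffAt] at hf
  have h := hf.comp x (contMDiffAt_of_mem_maximalAtlas (mem_maxAtlas hφ) hx)
  refine h.congr_of_eventuallyEq ?_
  filter_upwards [φ.open_source.mem_nhds hx] with z hz
  simp [φ.left_inv hz]

/-- The domain, in the chart `ψ`, of the transition map from `ψ` to `φ`. -/
def overlap (φ ψ : OpenPartialHomeomorph M (E n)) : Set (E n) :=
  {y | y ∈ ψ.target ∧ ψ.symm y ∈ φ.source}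

theorem isOpen_overlap (φ ψ : OpenPartialHomeomorph M (E n)) : IsOpen (overlap φ ψ) :=
  ψ.symm.isOpen_inter_preimage φ.open_source

theorem contDiffAt_transition (hφ : φ ∈ atlas (E n) M) (hψ : ψ ∈ atlas (E n) M)
    (hy : y ∈ overlap φ ψ) : ContDiffAt ℝ ∞ (fun z => φ (ψ.symm z)) y := by
  rw [← contMDiffAt_iff_contDiffAt]
  exact (contMDiffAt_of_mem_maximalAtlas (mem_maxAtlas hφ) hy.2).comp y
    (contMDiffAt_symm_of_mem_maximalAtlas (mem_maxAtlas hψ) hy.1)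

/-- The coordinate vector field `∂_i` of `φ` at `x`, as an element of the tangent space at `x`. -/
def coordField (φ : OpenPartialHomeomorph M (E n)) (x : M) (i : Fin n) : TangentSpace (𝓡 n) x :=
  (coordVec φ (φ x) i : E n)

theorem mdifferentiableAt_symm (hφ : φ ∈ atlas (E n) M) (hy : y ∈ φ.target) :
    MDifferentiableAt (𝓡 n) (𝓡 n) φ.symm y :=
  (contMDiffAt_symm_of_mem_maximalAtlas (mem_maxAtlas hφ) hy).mdifferentiableAt (by simp)

/-- The differential of the inverse of a chart, as an endomorphism of the model space (every
tangent space is a copy of it). -/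
def symmDeriv (φ : OpenPartialHomeomorph M (E n)) (y : E n) : E n →L[ℝ] E n :=
  mfderiv (𝓡 n) (𝓡 n) φ.symm y

/-- The differential of a chart, as an endomorphism of the model space. -/
def chartDeriv (φ : OpenPartialHomeomorph M (E n)) (x : M) : E n →L[ℝ] E n :=
  mfderiv (𝓡 n) (𝓡 n) φ x

theorem symmDeriv_transition (hφ : φ ∈ atlas (E n) M) (hψ : ψ ∈ atlas (E n) M)
    (hy : y ∈ overlap φ ψ) : symmDeriv ψ y =
      (symmDeriv φ (φ (ψ.symm y))).comp (fderiv ℝ (fun z => φ (ψ.symm z)) y) := by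
  have hτ := (contDiffAt_transition hφ hψ hy)
  have he : ψ.symm =ᶠ[𝓝 y] (φ.symm ∘ fun z => φ (ψ.symm z)) := by
    filter_upwards [(isOpen_overlap φ ψ).mem_nhds hy] with z hz
    simp [φ.left_inv hz.2]
  have h2 := mfderiv_comp y (I := 𝓡 n) (I' := 𝓡 n) (I'' := 𝓡 n) (g := φ.symm)
    (f := fun z => φ (ψ.symm z))
    (mdifferentiableAt_symm hφ (φ.map_source hy.2))
    (hτ.differentiableAt (by simp)).mdifferentiableAt
  rw [mfderiv_eq_fderiv] at h2
  exact he.mfderiv_eq.trans h2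

theorem chartDeriv_comp_symmDeriv (hφ : φ ∈ atlas (E n) M) (hx : x ∈ φ.source) :
    (chartDeriv φ x).comp (symmDeriv φ (φ x)) = ContinuousLinearMap.id ℝ (E n) := by
  have : IsManifold (𝓡 n) 1 M := IsManifold.of_le (n := ∞) (by simp)
  have h := (mdifferentiable_of_mem_atlas (I := 𝓡 n) hφ).comp_symm_deriv (φ.map_source hx)
  have key : ∀ p, p = x → (mfderiv (𝓡 n) (𝓡 n) φ p : E n →L[ℝ] E n) = chartDeriv φ x := by
    rintro _ rfl; rfl
  exact (congrArg (fun L : E n →L[ℝ] E n => L.comp (symmDeriv φ (φ x)))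
    (key _ (φ.left_inv hx)).symm).trans h

theorem symmDeriv_apply (φ : OpenPartialHomeomorph M (E n)) (x : M) (v : E n) :
    symmDeriv φ (φ x) v = ∑ a, v a • (coordField φ x a : E n) := by
  conv_lhs => rw [sum_single_smul v, map_sum]
  simp only [map_smul]
  rfl

theorem coordField_transition (hφ : φ ∈ atlas (E n) M) (hψ : ψ ∈ atlas (E n) M)
    (hxφ : x ∈ φ.source) (hxψ : x ∈ ψ.source) (i : Fin n) :
    coordField ψ x i = ∑ a, jac (fun z => φ (ψ.symm z)) a i (ψ x) • coordField φ x a := by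
  have hyo : ψ x ∈ overlap φ ψ := ⟨ψ.map_source hxψ, by rwa [ψ.left_inv hxψ]⟩
  have h := congrArg (fun L : E n →L[ℝ] E n => L (EuclideanSpace.single i 1))
    (symmDeriv_transition hφ hψ hyo)
  simp only [ContinuousLinearMap.comp_apply, ψ.left_inv hxψ] at h
  rw [symmDeriv_apply φ x] at h
  refine h.trans (Finset.sum_congr rfl fun a _ => ?_)
  rw [fderiv_apply_coord ((contDiffAt_transition hφ hψ hyo).differentiableAt (by simp))]
  rfl

theorem eq_zero_of_sum_coordField (hφ : φ ∈ atlas (E n) M) (hx : x ∈ φ.source) {c : Fin n → ℝ}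
    (h : ∑ a, c a • coordField φ x a = 0) : c = 0 := by
  have h1 : symmDeriv φ (φ x) (WithLp.toLp 2 c) = 0 := (symmDeriv_apply φ x _).trans h
  have h2 := congrArg (fun L : E n →L[ℝ] E n => L (WithLp.toLp 2 c))
    (chartDeriv_comp_symmDeriv hφ hx)
  simp only [ContinuousLinearMap.comp_apply, h1, map_zero] at h2
  funext a
  exact (congrArg (fun v : E n => v a) h2).symm

/-! ### Components of tensors in charts -/

variable {b : (x : M) → TangentSpace (𝓡 n) x →L[ℝ] TangentSpace (𝓡 n) x →L[ℝ] ℝ}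

theorem formMatrix_apply (b : (x : M) → TangentSpace (𝓡 n) x →L[ℝ] TangentSpace (𝓡 n) x →L[ℝ] ℝ)
    (hx : x ∈ φ.source) (i j : Fin n) :
    formMatrix b φ (φ x) i j = b x (coordField φ x i) (coordField φ x j) := by
  have : ∀ p, p = x → ∀ v w : E n, b p v w = b x v w := by rintro p rfl v w; rfl
  exact this _ (φ.left_inv hx) _ _

theorem CovTensorField.comp_apply {q : ℕ} (A : CovTensorField n M q) (hx : x ∈ φ.source)
    (I : Fin q → Fin n) : A.comp φ (φ x) I = A.toFun x fun s => coordField φ x (I s) := by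
  have : ∀ p, p = x → ∀ v : Fin q → E n, A.toFun p v = A.toFun x v := by rintro p rfl v; rfl
  exact this _ (φ.left_inv hx) _

/-- The transformation law for the components of a bilinear form. -/
theorem formMatrix_transition (b : (x : M) → TangentSpace (𝓡 n) x →L[ℝ] TangentSpace (𝓡 n) x →L[ℝ] ℝ)
    (hφ : φ ∈ atlas (E n) M) (hψ : ψ ∈ atlas (E n) M) (hy : y ∈ overlap φ ψ) (i j : Fin n) :
    formMatrix b ψ y i j = ∑ a, ∑ c, jac (fun z => φ (ψ.symm z)) a i y *
      jac (fun z => φ (ψ.symm z)) c j y * formMatrix b φ (φ (ψ.symm y)) a c := by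
  obtain ⟨x, hx, rfl⟩ : ∃ x ∈ ψ.source, ψ x = y := ⟨_, ψ.map_target hy.1, ψ.right_inv hy.1⟩
  have hxφ : x ∈ φ.source := by have := hy.2; rwa [ψ.left_inv hx] at this
  rw [formMatrix_apply b hx, ψ.left_inv hx, coordField_transition hφ hψ hxφ hx i,
    coordField_transition hφ hψ hxφ hx j]
  simp only [formMatrix_apply b hxφ, map_sum, map_smul, sum_apply,
    smul_apply, smul_eq_mul, Finset.mul_sum]
  rw [Finset.sum_comm]
  refine Finset.sum_congr rfl fun _ _ => Finset.sum_congr rfl fun _ _ => ?_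
  ring

theorem CovTensorField.comp_transition {q : ℕ} (A : CovTensorField n M q)
    (hφ : φ ∈ atlas (E n) M) (hψ : ψ ∈ atlas (E n) M) (hy : y ∈ overlap φ ψ) :
    A.comp ψ y = pullback (fun z => φ (ψ.symm z)) (A.comp φ) y := by
  obtain ⟨x, hx, rfl⟩ : ∃ x ∈ ψ.source, ψ x = y := ⟨_, ψ.map_target hy.1, ψ.right_inv hy.1⟩
  have hxφ : x ∈ φ.source := by have := hy.2; rwa [ψ.left_inv hx] at this
  funext I
  rw [A.comp_apply hx]
  simp only [pullback, ψ.left_inv hx, A.comp_apply hxφ, coordField_transition hφ hψ hxφ hx]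
  rw [MultilinearMap.map_sum]
  refine Finset.sum_congr rfl fun _ _ => ?_
  rw [MultilinearMap.map_smul_univ]
  simp

theorem CovTensorField.smoothTensorOn {q : ℕ} (A : CovTensorField n M q)
    (hφ : φ ∈ atlas (E n) M) : SmoothTensorOn (A.comp φ) φ.target := fun _ hy I =>
  (A.smooth φ hφ I).contDiffAt (φ.open_target.mem_nhds hy)

variable {g : Metric n M}

theorem coords_eq (a : AmbientMetric g) (φ : OpenPartialHomeomorph M (E n)) :
    coords g φ = formMatrix (a.form 0) φ := by
  funext y
  simp only [coords, formMatrix, a.form_zero]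

theorem coords_posDef (g : Metric n M) (hφ : φ ∈ atlas (E n) M) (hy : y ∈ φ.target) :
    (coords g φ y).PosDef := by
  obtain ⟨x, hx, rfl⟩ : ∃ x ∈ φ.source, φ x = y := ⟨_, φ.map_target hy, φ.right_inv hy⟩
  refine Matrix.posDef_iff_dotProduct_mulVec.2 ⟨?_, fun c hc => ?_⟩
  · ext i j
    simp only [Matrix.conjTranspose_apply, coords, formMatrix_apply _ hx, star_trivial]
    exact g.symm _ _ _
  · have h := g.pos x (∑ a, c a • coordField φ x a)
      fun h => hc (eq_zero_of_sum_coordField hφ hx h)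
    refine h.trans_le (le_of_eq ?_)
    simp only [coords, dotProduct, Matrix.mulVec, formMatrix_apply _ hx, map_sum, map_smul,
      sum_apply, smul_apply, smul_eq_mul, Finset.mul_sum,
      star_trivial, Pi.star_apply]
    rw [Finset.sum_comm]
    refine Finset.sum_congr rfl fun _ _ => Finset.sum_congr rfl fun _ _ => ?_
    ring

/-- The components of `g` are smooth. This is read off from the ambient metric at `ρ = 0`, which is
why an `AmbientMetric` appears here and in the statements that depend on it. -/
theorem coords_isMetricOn (a : AmbientMetric g) (hφ : φ ∈ atlas (E n) M) :
    IsMetricOn (coords g φ) φ.target where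
  isOpen := φ.open_target
  smooth y hy i j := by
    rw [coords_eq a φ]
    have h : ContDiffAt ℝ ∞ (fun p : ℝ × E n => formMatrix (a.form p.1) φ p.2 i j) (0, y) :=
      (a.smooth φ hφ i j).contDiffAt
        ((isOpen_univ.prod φ.open_target).mem_nhds ⟨trivial, hy⟩)
    exact h.comp y (f := fun z => ((0 : ℝ), z)) (by fun_prop)
  symm y hy i j := by
    simpa using (congrFun (congrFun (coords_posDef g hφ hy).isHermitian i) j).symm
  det_ne y hy := (coords_posDef g hφ hy).det_pos.ne'

theorem isCoordChange (a : AmbientMetric g) (hφ : φ ∈ atlas (E n) M) (hψ : ψ ∈ atlas (E n) M) :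
    IsCoordChange (coords g φ) (coords g ψ) φ.target (overlap φ ψ) (fun z => φ (ψ.symm z)) where
  metric := coords_isMetricOn a hφ
  metric' :=
    { isOpen := isOpen_overlap φ ψ
      smooth := fun _ hy => (coords_isMetricOn a hψ).smooth _ hy.1
      symm := fun _ hy => (coords_isMetricOn a hψ).symm _ hy.1
      det_ne := fun _ hy => (coords_isMetricOn a hψ).det_ne _ hy.1 }
  mapsTo _ hy := φ.map_source hy.2
  smooth _ hy := contDiffAt_transition hφ hψ hy
  pull _ hy i j := formMatrix_transition g.inner hφ hψ hy i j

end Charts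

/-! ### Linearity of the local operators -/

section Linear

variable {ι : Type} [Fintype ι] [DecidableEq ι] {G : EuclideanSpace ℝ ι → Matrix ι ι ℝ}
  {Ω : Set (EuclideanSpace ℝ ι)}

theorem covDeriv_linear {q : ℕ} {S T : LocalTensor ι q} (hS : SmoothTensorOn S Ω)
    (hT : SmoothTensorOn T Ω) (c : ℝ) : ∀ y ∈ Ω,
    covDeriv G (fun z K => c * S z K + T z K) y =
      fun K => c * covDeriv G S y K + covDeriv G T y K := by
  intro y hy
  ext I
  have h1 := diffAt (hS y hy (Fin.tail I))
  have h2 := diffAt (hT y hy (Fin.tail I))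
  simp only [covDeriv]
  rw [pderiv_add (h1.const_mul c) h2, pderiv_const_mul c h1]
  simp only [mul_add, Finset.sum_add_distrib, mul_sub, Finset.mul_sum]
  simp only [mul_left_comm c]
  ring

theorem iterCovDeriv_linear (hG : IsMetricOn G Ω) {u v : EuclideanSpace ℝ ι → ℝ}
    (hu : ∀ y ∈ Ω, ContDiffAt ℝ ∞ u y) (hv : ∀ y ∈ Ω, ContDiffAt ℝ ∞ v y) (c : ℝ) (l : ℕ) :
    ∀ y ∈ Ω, iterCovDeriv G (fun z => c * u z + v z) l y =
      fun K => c * iterCovDeriv G u l y K + iterCovDeriv G v l y K := by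
  induction l with
  | zero => intro y _; rfl
  | succ l ih =>
    intro y hy
    simp only [iterCovDeriv]
    rw [← covDeriv_linear (smoothTensorOn_iterCovDeriv hG hu l)
      (smoothTensorOn_iterCovDeriv hG hv l) c y hy]
    refine covDeriv_congr fun K => ?_
    filter_upwards [hG.eventually hy] with z hz
    rw [ih z hz]

theorem iterDivergence_linear (hG : IsMetricOn G Ω) {l : ℕ} {S T : LocalTensor ι l}
    (hS : SmoothTensorOn S Ω) (hT : SmoothTensorOn T Ω) (c : ℝ) :
    ∀ y ∈ Ω, iterDivergence G l (fun z K => c * S z K + T z K) y =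
      c * iterDivergence G l S y + iterDivergence G l T y := by
  induction l with
  | zero => intro y _; rfl
  | succ l ih =>
    intro y hy
    simp only [iterDivergence]
    rw [← ih (hS.divergence hG) (hT.divergence hG) y hy]
    refine iterDivergence_congr hG.isOpen (fun z hz => ?_) y hy
    ext K
    simp only [divergence, covDeriv_linear hS hT c z hz, mul_add, Finset.sum_add_distrib,
      Finset.mul_sum, mul_left_comm c]

end Linear

/-! ### Tensorial operators on the manifold -/

section Operators

variable {n : ℕ} {M : Type*} [TopologicalSpace M] [ChartedSpace (E n) M] [IsManifold (𝓡 n) ∞ M]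
  {φ ψ : OpenPartialHomeomorph M (E n)} {x : M} {y : E n} {g : Metric n M}

/-- The tensor `A_{i_1…i_l j_1…j_l} ∇^{i_1…i_l} u` in the chart `φ`. -/
def contractNabla (g : Metric n M) {l : ℕ} (A : CovTensorField n M (l + l))
    (φ : OpenPartialHomeomorph M (E n)) (u : M → ℝ) : LocalTensor (Fin n) l :=
  fun y J => ∑ I : Fin l → Fin n, A.comp φ y (Fin.append I J) *
    raise (coords g φ y) (iterCovDeriv (coords g φ) (u ∘ φ.symm) l y) I

theorem smoothTensorOn_contractNabla (a : AmbientMetric g) {l : ℕ} (A : CovTensorField n M (l + l))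
    (hφ : φ ∈ atlas (E n) M) (u : SmoothFn n M) :
    SmoothTensorOn (contractNabla g A φ u) φ.target := fun y hy _ =>
  ContDiffAt.sum fun I _ => (A.smoothTensorOn hφ y hy _).mul
    (((smoothTensorOn_iterCovDeriv (coords_isMetricOn a hφ)
      (fun _ hz => u.contDiffAt hφ hz) l).raise (coords_isMetricOn a hφ)) y hy I)

theorem comp_symm_transition (u : M → ℝ) : ∀ z ∈ overlap φ ψ,
    (u ∘ ψ.symm) z = (u ∘ φ.symm) (φ (ψ.symm z)) := fun z hz => by
  simp [φ.left_inv hz.2]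

theorem iterCovDeriv_transition (a : AmbientMetric g) (hφ : φ ∈ atlas (E n) M)
    (hψ : ψ ∈ atlas (E n) M) (u : SmoothFn n M) (l : ℕ) (hy : y ∈ overlap φ ψ) :
    iterCovDeriv (coords g ψ) (u ∘ ψ.symm) l y =
      pullback (fun z => φ (ψ.symm z)) (iterCovDeriv (coords g φ) (u ∘ φ.symm) l) y := by
  rw [← (isCoordChange a hφ hψ).iterCovDeriv_comp (fun z hz => u.contDiffAt hφ hz) l y hy]
  exact iterCovDeriv_congr (isOpen_overlap φ ψ) (comp_symm_transition u) l y hy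

theorem contractNabla_transition (a : AmbientMetric g) {l : ℕ} (A : CovTensorField n M (l + l))
    (hφ : φ ∈ atlas (E n) M) (hψ : ψ ∈ atlas (E n) M) (u : SmoothFn n M)
    (hy : y ∈ overlap φ ψ) : contractNabla g A ψ u y =
      pullback (fun z => φ (ψ.symm z)) (contractNabla g A φ u) y := by
  ext J
  simp only [contractNabla, A.comp_transition hφ hψ hy, pullback]
  exact (isCoordChange a hφ hψ).contract_pullback (A.comp φ)
    (fun K => by
      rw [iterCovDeriv_transition a hφ hψ u l hy]
      exact (isCoordChange a hφ hψ).raise_pullback hy _ K) J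

theorem mem_overlap (hφ : x ∈ φ.source) (hψ : x ∈ ψ.source) : ψ x ∈ overlap φ ψ :=
  ⟨ψ.map_source hψ, by rwa [ψ.left_inv hψ]⟩

/-- The operator `divForm` can be computed in any chart. -/
theorem divForm_eq (a : AmbientMetric g) {l : ℕ} (A : CovTensorField n M (l + l))
    (hφ : φ ∈ atlas (E n) M) (hx : x ∈ φ.source) (u : SmoothFn n M) :
    divForm g A u x = iterDivergence (coords g φ) l (contractNabla g A φ u) (φ x) := by
  have hψ := chart_mem_atlas (E n) x
  have hy := mem_overlap hx (mem_chart_source (E n) x)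
  have h := (isCoordChange a hφ hψ).iterDivergence_pullback
    (smoothTensorOn_contractNabla a A hφ u) _ hy
  rw [(chartAt (E n) x).left_inv (mem_chart_source (E n) x)] at h
  rw [← h]
  exact iterDivergence_congr (isOpen_overlap φ _)
    (fun z hz => contractNabla_transition a A hφ hψ u hz) _ hy

theorem pair_eq {l : ℕ} (A : CovTensorField n M (l + l)) (X Y : (Fin l → Fin n) → ℝ) :
    A.pair φ y X Y = ∑ J, (∑ I, A.comp φ y (Fin.append I J) * X I) * Y J := by
  simp only [CovTensorField.pair, Finset.sum_mul]
  exact Finset.sum_comm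

/-- The function `pairNabla` can be computed in any chart. -/
theorem pairNabla_eq (a : AmbientMetric g) {l : ℕ} (A : CovTensorField n M (l + l))
    (hφ : φ ∈ atlas (E n) M) (hx : x ∈ φ.source) (u v : SmoothFn n M) :
    pairNabla g A u v x = ∑ J, contractNabla g A φ u (φ x) J *
      raise (coords g φ (φ x)) (iterCovDeriv (coords g φ) (v ∘ φ.symm) l (φ x)) J := by
  have hψ := chart_mem_atlas (E n) x
  have hy := mem_overlap hx (mem_chart_source (E n) x)
  have hC := isCoordChange a hφ hψ
  have h1 := contractNabla_transition a A hφ hψ u hy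
  have h2 := iterCovDeriv_transition a hφ hψ v l hy
  have h3 := fun K => hC.raise_pullback hy (iterCovDeriv (coords g φ) (v ∘ φ.symm) l) K
  simp only [(chartAt (E n) x).left_inv (mem_chart_source (E n) x)] at h3
  simp only [pairNabla]
  rw [pair_eq]
  simp only [← h3, ← h2, Finset.mul_sum]
  have h4 : ∀ J, (∑ I, A.comp (chartAt (E n) x) (chartAt (E n) x x) (Fin.append I J) *
      raise (coords g (chartAt (E n) x) (chartAt (E n) x x))
      (iterCovDeriv (coords g (chartAt (E n) x)) (u ∘ (chartAt (E n) x).symm) l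
        (chartAt (E n) x x)) I) = _ := fun J => congrFun h1 J
  simp only [h4, pullback, (chartAt (E n) x).left_inv (mem_chart_source (E n) x), Finset.sum_mul]
  rw [Finset.sum_comm]
  refine Finset.sum_congr rfl fun _ _ => Finset.sum_congr rfl fun _ _ => ?_
  ring

theorem laplacian_eq (a : AmbientMetric g) (hφ : φ ∈ atlas (E n) M) (hx : x ∈ φ.source)
    (u : SmoothFn n M) : laplacian g u x = localLaplacian (coords g φ) (u ∘ φ.symm) (φ x) := by
  have hψ := chart_mem_atlas (E n) x
  have hy := mem_overlap hx (mem_chart_source (E n) x)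
  have h := (isCoordChange a hφ hψ).localLaplacian_comp (fun z hz => u.contDiffAt hφ hz) _ hy
  rw [(chartAt (E n) x).left_inv (mem_chart_source (E n) x)] at h
  rw [← h]
  exact localLaplacian_congr (((isOpen_overlap φ _).eventually_mem hy).mono
    (comp_symm_transition u))

/-- A function that in every chart agrees with a smooth function is smooth. -/
theorem contMDiff_of_charts {f : M → ℝ} {F : OpenPartialHomeomorph M (E n) → E n → ℝ}
    (hF : ∀ φ ∈ atlas (E n) M, ∀ y ∈ φ.target, ContDiffAt ℝ ∞ (F φ) y)
    (hf : ∀ φ ∈ atlas (E n) M, ∀ x ∈ φ.source, f x = F φ (φ x)) :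
    ContMDiff (𝓡 n) 𝓘(ℝ, ℝ) ∞ f := fun x => by
  have hψ := chart_mem_atlas (E n) x
  have hx := mem_chart_source (E n) x
  refine contMDiffAt_of_comp_symm hψ hx ((hF _ hψ _ (mem_chart_target _ x)).congr_of_eventuallyEq ?_)
  filter_upwards [(chartAt (E n) x).open_target.mem_nhds (mem_chart_target _ x)] with z hz
  have hz' := (chartAt (E n) x).map_target hz
  simp [hf _ hψ _ hz', (chartAt (E n) x).right_inv hz]

theorem contMDiff_pairNabla (a : AmbientMetric g) {l : ℕ} (A : CovTensorField n M (l + l))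
    (u v : SmoothFn n M) : ContMDiff (𝓡 n) 𝓘(ℝ, ℝ) ∞ (pairNabla g A u v) :=
  contMDiff_of_charts (F := fun φ y => ∑ J, contractNabla g A φ u y J *
      raise (coords g φ y) (iterCovDeriv (coords g φ) (v ∘ φ.symm) l y) J)
    (fun _ hφ y hy => ContDiffAt.sum fun J _ => (smoothTensorOn_contractNabla a A hφ u y hy J).mul
      (((smoothTensorOn_iterCovDeriv (coords_isMetricOn a hφ)
        (fun _ hz => v.contDiffAt hφ hz) l).raise (coords_isMetricOn a hφ)) y hy J))
    (fun _ hφ _ hx => pairNabla_eq a A hφ hx u v)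

/-- A map between smooth functions whose values at each point depend linearly on the function, as a
linear operator. -/
def endOfPointwise (T : SmoothFn n M → SmoothFn n M)
    (hT : ∀ (c : ℝ) (u v : SmoothFn n M) (x : M), T (c • u + v) x = c * T u x + T v x) :
    Module.End ℝ (SmoothFn n M) where
  toFun := T
  map_add' u v := by
    ext x
    have h := hT 1 u v x
    rw [one_smul, one_mul] at h
    exact h
  map_smul' c u := by
    ext x
    have h0 : T 0 x = 0 := by
      have h := hT 1 0 0 x
      rw [smul_zero, add_zero] at h
      linarith
    have h := hT c u 0 x
    rw [add_zero, h0, add_zero] at h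
    exact h

/-- `divForm` as an endomorphism of the space of smooth functions. -/
def divFormEnd (a : AmbientMetric g) {l : ℕ} (A : CovTensorField n M (l + l)) :
    Module.End ℝ (SmoothFn n M) :=
  endOfPointwise (fun u => ⟨divForm g A u, contMDiff_of_charts
    (F := fun φ => iterDivergence (coords g φ) l (contractNabla g A φ u))
    (fun _ hφ => contDiffAt_iterDivergence (coords_isMetricOn a hφ)
      (smoothTensorOn_contractNabla a A hφ u))
    (fun _ hφ _ hx => divForm_eq a A hφ hx u)⟩) <| by
  intro c u v x
  change divForm g A (c • u + v : SmoothFn n M) x = c * divForm g A u x + divForm g A v x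
  have hφ := chart_mem_atlas (E n) x
  have hx := mem_chart_source (E n) x
  have hy := mem_chart_target (E n) x
  rw [divForm_eq a A hφ hx, divForm_eq a A hφ hx, divForm_eq a A hφ hx,
    ← iterDivergence_linear (coords_isMetricOn a hφ) (smoothTensorOn_contractNabla a A hφ u)
    (smoothTensorOn_contractNabla a A hφ v) c _ hy]
  refine iterDivergence_congr (coords_isMetricOn a hφ).isOpen (fun z hz => ?_) _ hy
  ext J
  simp only [contractNabla]
  have h := iterCovDeriv_linear (coords_isMetricOn a hφ) (fun _ hz => u.contDiffAt hφ hz)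
    (fun _ hz => v.contDiffAt hφ hz) c l z hz
  have h' : ((c • u + v : SmoothFn n M) : M → ℝ) ∘ (chartAt (E n) x).symm =
    fun z => c * (u ∘ (chartAt (E n) x).symm) z + (v ∘ (chartAt (E n) x).symm) z := rfl
  rw [h', h]
  simp only [raise, mul_add, Finset.mul_sum, Finset.sum_add_distrib, mul_left_comm c]

theorem divFormEnd_apply (a : AmbientMetric g) {l : ℕ} (A : CovTensorField n M (l + l))
    (u : SmoothFn n M) (x : M) : divFormEnd a A u x = divForm g A u x := rfl

/-- The Laplace-Beltrami operator as an endomorphism of the space of smooth functions. -/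
def laplacianEnd (a : AmbientMetric g) : Module.End ℝ (SmoothFn n M) :=
  endOfPointwise (fun u => ⟨laplacian g u, contMDiff_of_charts
    (F := fun φ => localLaplacian (coords g φ) (u ∘ φ.symm))
    (fun _ hφ y hy => (contDiffAt_iterDivergence (coords_isMetricOn a hφ)
      (smoothTensorOn_iterCovDeriv (coords_isMetricOn a hφ)
        (fun _ hz => u.contDiffAt hφ hz) 1) y hy).neg)
    (fun _ hφ _ hx => laplacian_eq a hφ hx u)⟩) <| by
  intro c u v x
  change laplacian g (c • u + v : SmoothFn n M) x = c * laplacian g u x + laplacian g v x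
  have hφ := chart_mem_atlas (E n) x
  have hy := mem_chart_target (E n) x
  have hG := coords_isMetricOn a hφ
  have hu := fun z hz => u.contDiffAt hφ (y := z) hz
  have hv := fun z hz => v.contDiffAt hφ (y := z) hz
  have h := iterDivergence_linear hG (smoothTensorOn_iterCovDeriv hG hu 1)
    (smoothTensorOn_iterCovDeriv hG hv 1) c _ hy
  have h3 := iterDivergence_congr (G := coords g (chartAt (E n) x)) hG.isOpen
    (iterCovDeriv_linear hG hu hv c 1) _ hy
  have h4 := h3.trans h
  simp only [laplacian, localLaplacian]
  rw [mul_neg, ← neg_add, ← h4]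
  rfl

theorem laplacianEnd_apply (a : AmbientMetric g) (u : SmoothFn n M) (x : M) :
    laplacianEnd a u x = laplacian g u x := rfl

theorem laplacianEnd_pow_apply (a : AmbientMetric g) (m : ℕ) (u : SmoothFn n M) :
    ((laplacianEnd a ^ m) u : M → ℝ) = (laplacian g)^[m] u := by
  induction m with
  | zero => rfl
  | succ m ih => rw [pow_succ', Function.iterate_succ_apply', ← ih]; rfl

/-- Evaluation at a point. -/
def evalAt (x : M) : SmoothFn n M →ₐ[ℝ] ℝ where
  toFun u := u x
  map_one' := rfl
  map_mul' _ _ := rfl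
  map_zero' := rfl
  map_add' _ _ := rfl
  commutes' _ := rfl

@[simp] theorem evalAt_apply (x : M) (u : SmoothFn n M) : evalAt x u = u x := rfl

theorem eq_zero_of_evalAt (u : SmoothFn n M) (h : ∀ x : M, evalAt x u = 0) : u = 0 := by
  ext x; exact h x

end Operators

/-! ### Hadamard's lemma -/

section Hadamard

variable {V : Type} [NormedAddCommGroup V] [NormedSpace ℝ V] [ProperSpace V]

/-- Differentiation under the integral sign along rays; the weight `t^m` makes the formula apply to
its own output. -/
theorem hasFDerivAt_integral_ray {W : Type} [NormedAddCommGroup W] [NormedSpace ℝ W]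
    {f : V → W} (hf : ContDiff ℝ 1 f) (m : ℕ) (y : V) :
    HasFDerivAt (fun z => ∫ t in (0:ℝ)..1, t ^ m • f (t • z))
      (∫ t in (0:ℝ)..1, t ^ (m + 1) • fderiv ℝ f (t • y)) y := by
  have hc : Continuous (fun p : V × ℝ => p.2 ^ (m + 1) • fderiv ℝ f (p.2 • p.1)) := by
    have := hf.continuous_fderiv (by simp)
    fun_prop
  have hfc := hf.continuous
  obtain ⟨C, hC⟩ := ((isCompact_closedBall y 1).prod
    (isCompact_uIcc (a := (0:ℝ)) (b := 1))).exists_bound_of_continuousOn hc.continuousOn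
  refine intervalIntegral.hasFDerivAt_integral_of_dominated_of_fderiv_le
    (s := Metric.closedBall y 1) (bound := fun _ => C) (F' := fun z t => t ^ (m + 1) • fderiv ℝ f (t • z))
    (Metric.closedBall_mem_nhds y one_pos) ?_ ?_ ?_ ?_ ?_ ?_
  · exact Filter.Eventually.of_forall fun z => Continuous.aestronglyMeasurable (by fun_prop)
  · exact Continuous.intervalIntegrable (by fun_prop) _ _
  · exact (hc.comp (f := fun t : ℝ => (y, t)) (by fun_prop)).aestronglyMeasurable
  · exact Filter.Eventually.of_forall fun t ht z hz =>
      hC (z, t) ⟨hz, Set.uIoc_subset_uIcc ht⟩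
  · exact intervalIntegrable_const
  · refine Filter.Eventually.of_forall fun t _ z _ => ?_
    have h := (((hf.differentiable (by simp)) (t • z)).hasFDerivAt.comp z
      ((hasFDerivAt_id z).const_smul t)).const_smul (t ^ m)
    refine h.congr_fderiv ?_
    ext v
    simp [pow_succ, mul_smul]

theorem contDiff_integral_ray_nat (k : ℕ) : ∀ {W : Type} [NormedAddCommGroup W] [NormedSpace ℝ W]
    {f : V → W}, ContDiff ℝ ∞ f → ∀ m : ℕ,
    ContDiff ℝ k (fun z => ∫ t in (0:ℝ)..1, t ^ m • f (t • z)) := by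
  induction k with
  | zero =>
    intro W _ _ f hf m
    have hfc := hf.continuous
    refine contDiff_zero.2 (intervalIntegral.continuous_parametric_intervalIntegral_of_continuous' ?_ _ _)
    fun_prop
  | succ k ih =>
    intro W _ _ f hf m
    exact contDiff_succ_iff_hasFDerivAt.2 ⟨_, ih (contDiff_infty_iff_fderiv.1 hf).2 (m + 1),
      hasFDerivAt_integral_ray (hf.of_le (by simp)) m⟩

theorem contDiff_integral_ray {W : Type} [NormedAddCommGroup W] [NormedSpace ℝ W]
    {f : V → W} (hf : ContDiff ℝ ∞ f) :
    ContDiff ℝ ∞ (fun z => ∫ t in (0:ℝ)..1, f (t • z)) := by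
  refine contDiff_infty.2 fun k => ?_
  simpa using contDiff_integral_ray_nat k hf 0

/-- Hadamard's lemma. -/
theorem exists_eq_sum_mul {ι : Type} [Fintype ι] [DecidableEq ι] {f : EuclideanSpace ℝ ι → ℝ}
    (hf : ContDiff ℝ ∞ f) (h0 : f 0 = 0) : ∃ F : ι → EuclideanSpace ℝ ι → ℝ,
    (∀ i, ContDiff ℝ ∞ (F i)) ∧ (∀ i, F i 0 = pderiv i f 0) ∧ ∀ y, f y = ∑ i, y i * F i y := by
  have hp : ∀ i, ContDiff ℝ ∞ (pderiv i f) := fun i =>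
    contDiff_iff_contDiffAt.2 fun y => hf.contDiffAt.pderiv i
  refine ⟨fun i y => ∫ t in (0:ℝ)..1, pderiv i f (t • y), fun i => contDiff_integral_ray (hp i),
    fun i => by simp, fun y => ?_⟩
  have hd : ∀ t : ℝ, HasDerivAt (fun t : ℝ => f (t • y)) (∑ i, y i * pderiv i f (t • y)) t := by
    intro t
    have h := ((hf.differentiable (by simp)) (t • y)).hasFDerivAt.comp_hasDerivAt t
      ((hasDerivAt_id t).smul_const y)
    refine h.congr_deriv ?_
    conv_lhs => rw [one_smul, sum_single_smul y, map_sum]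
    simp only [map_smul, smul_eq_mul, pderiv]
    rw [← sum_single_smul y]
  have hc : ∀ i, Continuous fun t : ℝ => y i * pderiv i f (t • y) := fun i => by
    have := (hp i).continuous
    fun_prop
  have := intervalIntegral.integral_eq_sub_of_hasDerivAt (a := 0) (b := 1) (fun t _ => hd t)
    ((continuous_finsetSum _ fun i _ => hc i).intervalIntegrable _ _)
  rw [one_smul, zero_smul, h0, sub_zero] at this
  rw [← this, intervalIntegral.integral_finsetSum fun i _ => (hc i).intervalIntegrable _ _]
  simp

end Hadamard

/-! ### Cut-off functions -/

section Cutoff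

variable {n : ℕ} {M : Type*} [TopologicalSpace M] [ChartedSpace (E n) M] [IsManifold (𝓡 n) ∞ M]
  [CompactSpace M] [T2Space M]
  {φ : OpenPartialHomeomorph M (E n)} {x : M}

theorem exists_cutoff {K U : Set M} (hK : IsClosed K) (hU : IsOpen U) (hKU : K ⊆ U) :
    ∃ (χ : SmoothFn n M) (t : Set M), IsClosed t ∧ t ⊆ U ∧ (∀ᶠ z in 𝓝ˢ K, χ z = 1) ∧
      ∀ z ∉ t, χ z = 0 := by
  obtain ⟨V, hV, hKV, hVU⟩ := normal_exists_closure_subset hK hU hKU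
  obtain ⟨χ, h1, h0, -⟩ := exists_contMDiffMap_one_nhds_of_subset_interior (n := (⊤ : ℕ∞)) (𝓡 n) hK
    (t := closure V) (hKV.trans (hV.subset_interior_iff.2 subset_closure))
  exact ⟨χ, closure V, isClosed_closure, hVU, h1, h0⟩

theorem exists_cutoff_at {U : Set M} (hU : IsOpen U) (hx : x ∈ U) :
    ∃ (χ : SmoothFn n M) (t : Set M), IsClosed t ∧ t ⊆ U ∧ (∀ᶠ z in 𝓝 x, χ z = 1) ∧
      ∀ z ∉ t, χ z = 0 := by
  simpa using exists_cutoff (n := n) (K := {x}) isClosed_singleton hU (by simpa using hx)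

/-- The function `f` in the chart `φ`, cut off by `χ` and extended by zero to `M`. -/
def glue (hφ : φ ∈ atlas (E n) M) {t : Set M} (ht : IsClosed t) (htφ : t ⊆ φ.source)
    (χ : SmoothFn n M) (hχ : ∀ z ∉ t, χ z = 0) {f : E n → ℝ}
    (hf : ∀ y ∈ φ.target, ContDiffAt ℝ ∞ f y) : SmoothFn n M :=
  ⟨fun z => χ z * f (φ z), fun z => by
    by_cases hz : z ∈ t
    · refine χ.contMDiff.contMDiffAt.mul (contMDiffAt_of_comp_symm hφ (htφ hz) ?_)
      refine (hf _ (φ.map_source (htφ hz))).congr_of_eventuallyEq ?_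
      filter_upwards [φ.open_target.mem_nhds (φ.map_source (htφ hz))] with w hw
      simp [φ.right_inv hw]
    · refine (contMDiffAt_const (c := (0 : ℝ))).congr_of_eventuallyEq ?_
      filter_upwards [ht.isOpen_compl.mem_nhds hz] with w hw
      simp [hχ w hw]⟩

/-- Every smooth function on a chart agrees near a given point with a globally smooth function. -/
theorem exists_extension (hφ : φ ∈ atlas (E n) M) (hx : x ∈ φ.source) {f : E n → ℝ}
    (hf : ∀ y ∈ φ.target, ContDiffAt ℝ ∞ f y) :
    ∃ u : SmoothFn n M, ∀ᶠ z in 𝓝 x, u z = f (φ z) := by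
  obtain ⟨χ, t, ht, htφ, h1, h0⟩ := exists_cutoff_at (n := n) φ.open_source hx
  refine ⟨glue hφ ht htφ χ h0 hf, h1.mono fun z hz => ?_⟩
  change χ z * _ = _
  rw [hz, one_mul]

theorem isCompact_image_chart {t : Set M} (ht : IsClosed t) (htφ : t ⊆ φ.source) :
    IsCompact (φ '' t) := ht.isCompact.image_of_continuousOn (φ.continuousOn.mono htφ)

theorem tendsto_symm_nhds (hx : x ∈ φ.source) : Filter.Tendsto φ.symm (𝓝 (φ x)) (𝓝 x) := by
  have h := φ.symm.continuousAt (φ.map_source hx)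
  rwa [ContinuousAt, φ.left_inv hx] at h

/-- A smooth function vanishing at `x` together with its differential is a sum of products of two
functions vanishing at `x`. -/
theorem mem_ker_sq (hφ : φ ∈ atlas (E n) M) (hx : x ∈ φ.source) {u : SmoothFn n M} (h0 : u x = 0)
    (h1 : ∀ i, pderiv i (u ∘ φ.symm) (φ x) = 0) : u ∈ RingHom.ker (evalAt (n := n) x) ^ 2 := by
  obtain ⟨χ, t, ht, htφ, hχ1, hχ0⟩ := exists_cutoff_at (n := n) φ.open_source hx
  have hχx : χ x = 1 := hχ1.self_of_nhds
  set f : E n → ℝ := φ.target.indicator (fun y => (χ * u : SmoothFn n M) (φ.symm y)) with hf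
  have hfs : ContDiff ℝ ∞ f := contDiff_iff_contDiffAt.2 fun y => by
    by_cases hy : y ∈ φ '' t
    · obtain ⟨z, hz, rfl⟩ := hy
      have hz' := φ.map_source (htφ hz)
      refine ((χ * u : SmoothFn n M).contDiffAt hφ hz').congr_of_eventuallyEq ?_
      filter_upwards [φ.open_target.mem_nhds hz'] with w hw
      simp [hf, hw]
    · refine (contDiffAt_const (c := (0 : ℝ))).congr_of_eventuallyEq ?_
      filter_upwards [(isCompact_image_chart ht htφ).isClosed.isOpen_compl.mem_nhds hy] with w hw
      by_cases hwt : w ∈ φ.target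
      · have : φ.symm w ∉ t := fun h => hw ⟨_, h, φ.right_inv hwt⟩
        simp [hf, hwt, hχ0 _ this]
      · simp [hf, hwt]
  have hfx : ∀ z ∈ φ.source, f (φ z) = χ z * u z := fun z hz => by
    simp [hf, φ.map_source hz, φ.left_inv hz]
  have hfu : f =ᶠ[𝓝 (φ x)] u ∘ φ.symm := by
    filter_upwards [φ.open_target.mem_nhds (φ.map_source hx), (tendsto_symm_nhds hx).eventually hχ1]
      with w hw hw1
    simp [hf, hw, hw1]
  obtain ⟨F, hF, hF0, hFs⟩ := exists_eq_sum_mul (f := fun w => f (w + φ x))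
    (hfs.comp (by fun_prop)) (by simp [hfx x hx, h0])
  have hF0' : ∀ i, F i 0 = 0 := fun i => by
    rw [hF0, ← h1 i, ← pderiv_congr hfu]
    have := fderiv_comp_add_right (𝕜 := ℝ) (f := f) (x := 0) (φ x)
    simp only [pderiv, this, zero_add]
  have hs : χ ^ 3 * u = ∑ i, glue hφ ht htφ χ hχ0 (f := fun y => y i - φ x i) (fun y _ => by fun_prop) *
      glue hφ ht htφ χ hχ0 (f := fun y => F i (y - φ x))
        (fun y _ => ((hF i).comp (by fun_prop : ContDiff ℝ ∞ fun y => y - φ x)).contDiffAt) := by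
    ext z
    have e : evalAt z (χ ^ 3 * u) = evalAt z (∑ i, glue hφ ht htφ χ hχ0 (f := fun y => y i - φ x i) (fun y _ => by fun_prop) *
      glue hφ ht htφ χ hχ0 (f := fun y => F i (y - φ x))
        (fun y _ => ((hF i).comp (by fun_prop : ContDiff ℝ ∞ fun y => y - φ x)).contDiffAt)) := by
      simp only [map_mul, map_pow, map_sum, evalAt_apply]
      by_cases hz : z ∈ t
      · have h := hFs (φ z - φ x)
        simp only [sub_add_cancel, hfx z (htφ hz)] at h
        calc χ z ^ 3 * u z = χ z ^ 2 * (χ z * u z) := by ring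
          _ = _ := by
            rw [h, Finset.mul_sum]
            refine Finset.sum_congr rfl fun i _ => ?_
            change _ = χ z * _ * (χ z * _)
            simp only [PiLp.sub_apply]
            ring
      · rw [hχ0 z hz, Finset.sum_eq_zero]
        · simp
        · intro i _
          change χ z * _ * (χ z * _) = 0
          rw [hχ0 z hz]; ring
    exact e
  have hker : ∀ w : SmoothFn n M, w ∈ RingHom.ker (evalAt (n := n) x) ↔ w x = 0 := fun w => Iff.rfl
  have e : u = χ ^ 3 * u + (1 - χ ^ 3) * u := by ring
  rw [e, pow_two]
  refine Ideal.add_mem _ ?_ (Ideal.mul_mem_mul ?_ ((hker u).2 h0))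
  · rw [hs]
    refine Ideal.sum_mem _ fun i _ => Ideal.mul_mem_mul ?_ ?_
    · rw [hker]; change χ x * _ = 0; simp
    · rw [hker]; change χ x * F i (φ x - φ x) = 0; simp [hF0']
  · rw [RingHom.mem_ker]
    simp [hχx]

/-- A linear functional on smooth functions that kills the functions supported in a chart is
zero. -/
theorem eq_zero_of_forall_chart (L : SmoothFn n M →ₗ[ℝ] ℝ)
    (hL : ∀ φ ∈ atlas (E n) M, ∀ t, IsClosed t → t ⊆ φ.source → ∀ u : SmoothFn n M,
      (∀ z ∉ t, u z = 0) → L u = 0) (u : SmoothFn n M) : L u = 0 := by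
  have h := fun x : M => exists_cutoff_at (n := n) (chartAt (E n) x).open_source
    (mem_chart_source (E n) x)
  choose χ t ht htφ h1 h0 using h
  have hstep : ∀ x (w : SmoothFn n M), L ((1 - χ x) * w) = L w := fun x w => by
    have : L (χ x * w) = 0 := hL _ (chart_mem_atlas (E n) x) (t x) (ht x) (htφ x) _ fun z hz => by
      simp [h0 x z hz]
    rw [sub_mul, one_mul, map_sub, this, sub_zero]
  obtain ⟨s, hs⟩ := isCompact_univ.elim_nhds_subcover (fun x : M => {z | χ x z = 1})
    fun x _ => h1 x
  have hprod : ∀ s : Finset M, L ((∏ x ∈ s, (1 - χ x)) * u) = L u := by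
    classical
    intro s
    induction s using Finset.induction_on with
    | empty => simp
    | insert x s hx ih => rw [Finset.prod_insert hx, mul_assoc, hstep, ih]
  rw [← hprod s, show (∏ x ∈ s, (1 - χ x)) * u = 0 from ?_, map_zero]
  ext z
  have e : evalAt z ((∏ x ∈ s, (1 - χ x)) * u) = 0 := by
    obtain ⟨x, hx, hxz⟩ := Set.mem_iUnion₂.1 (hs.2 (Set.mem_univ z))
    rw [map_mul, map_prod, Finset.prod_eq_zero hx, zero_mul]
    have : χ x z = 1 := hxz
    simp [this]
  exact e

end Cutoff

/-! ### The Riemannian volume measure -/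

section Volume

variable {n : ℕ} {M : Type*} [TopologicalSpace M] [ChartedSpace (E n) M] [IsManifold (𝓡 n) ∞ M]
  {φ ψ : OpenPartialHomeomorph M (E n)} {x : M} {g : Metric n M}

/-- The density `√(det g_{ij})` of the volume measure in the chart `φ`. -/
def volDensity (g : Metric n M) (φ : OpenPartialHomeomorph M (E n)) (y : E n) : ℝ :=
  √ (coords g φ y).det

theorem volDensity_pos (hφ : φ ∈ atlas (E n) M) {y : E n} (hy : y ∈ φ.target) :
    0 < volDensity g φ y := Real.sqrt_pos.2 (coords_posDef g hφ hy).det_pos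

theorem contDiffAt_volDensity (a : AmbientMetric g) (hφ : φ ∈ atlas (E n) M) {y : E n}
    (hy : y ∈ φ.target) : ContDiffAt ℝ ∞ (volDensity g φ) y :=
  (contDiffAt_det ((coords_isMetricOn a hφ).smooth y hy)).sqrt (coords_posDef g hφ hy).det_pos.ne'

theorem volDensity_transition (a : AmbientMetric g) (hφ : φ ∈ atlas (E n) M)
    (hψ : ψ ∈ atlas (E n) M) {y : E n} (hy : y ∈ overlap φ ψ) :
    volDensity g ψ y = |(fderiv ℝ (fun z => φ (ψ.symm z)) y).det| *
      volDensity g φ (φ (ψ.symm y)) := by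
  have h := (isCoordChange a hφ hψ).pull_matrix hy
  have hdet : (fderiv ℝ (fun z => φ (ψ.symm z)) y).det =
      (Matrix.of fun b i => jac (fun z => φ (ψ.symm z)) b i y).det := by
    rw [ContinuousLinearMap.det, ← LinearMap.det_toMatrix (EuclideanSpace.basisFun (Fin n) ℝ).toBasis]
    congr 1
    ext i j
    simp only [LinearMap.toMatrix_apply, OrthonormalBasis.coe_toBasis, EuclideanSpace.basisFun_apply,
      OrthonormalBasis.coe_toBasis_repr_apply, EuclideanSpace.basisFun_repr, Matrix.of_apply]
    exact fderiv_apply_coord ((contDiffAt_transition hφ hψ hy).differentiableAt (by simp)) _ _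
  rw [volDensity, h, Matrix.det_mul, Matrix.det_mul, Matrix.det_transpose, ← hdet, volDensity,
    ← Real.sqrt_sq_eq_abs, ← Real.sqrt_mul (sq_nonneg _)]
  congr 1
  ring

theorem aemeasurable_volDensity (a : AmbientMetric g) (hφ : φ ∈ atlas (E n) M) :
    AEMeasurable (volDensity g φ) (volume.restrict φ.target) :=
  ContinuousOn.aemeasurable
    (fun _ hy => (contDiffAt_volDensity a hφ hy).continuousAt.continuousWithinAt)
    φ.open_target.measurableSet

variable [MeasurableSpace M] [BorelSpace M]

/-- The measure `√(det g_{ij}) dy` on the domain of the chart `φ`. -/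
def chartMeasure (g : Metric n M) (φ : OpenPartialHomeomorph M (E n)) : Measure M :=
  ((volume.restrict φ.target).withDensity
    fun y => ENNReal.ofReal (volDensity g φ y)).map φ.symm

theorem vol_eq (g : Metric n M) : vol g = ⨆ φ ∈ atlas (E n) M, chartMeasure g φ := rfl

theorem aemeasurable_symm (g : Metric n M) (φ : OpenPartialHomeomorph M (E n)) :
    AEMeasurable φ.symm ((volume.restrict φ.target).withDensity
      fun y => ENNReal.ofReal (volDensity g φ y)) :=
  (φ.continuousOn_symm.aemeasurable φ.open_target.measurableSet).mono_ac
    (withDensity_absolutelyContinuous _ _)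

theorem chartMeasure_apply (g : Metric n M) (φ : OpenPartialHomeomorph M (E n)) {S : Set M}
    (hS : MeasurableSet S) : chartMeasure g φ S =
      ∫⁻ y in φ.symm ⁻¹' S ∩ φ.target, ENNReal.ofReal (volDensity g φ y) := by
  rw [chartMeasure, Measure.map_apply_of_aemeasurable (aemeasurable_symm g φ) hS,
    withDensity_apply', Measure.restrict_restrict' φ.open_target.measurableSet]

theorem measurableSet_preimage_symm (φ : OpenPartialHomeomorph M (E n)) {S : Set M}
    (hS : MeasurableSet S) : MeasurableSet (φ.symm ⁻¹' S ∩ φ.target) := by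
  have h := (continuousOn_iff_continuous_domRestrict.1 φ.continuousOn_symm).measurable hS
  have h2 := φ.open_target.measurableSet.subtype_image h
  convert h2 using 1
  ext y
  simp [and_comm]

theorem chartMeasure_compl (g : Metric n M) (φ : OpenPartialHomeomorph M (E n)) :
    chartMeasure g φ φ.sourceᶜ = 0 := by
  rw [chartMeasure_apply g φ φ.open_source.measurableSet.compl]
  have : φ.symm ⁻¹' φ.sourceᶜ ∩ φ.target = ∅ := by
    ext y
    simp only [Set.mem_inter_iff, Set.mem_preimage, Set.mem_compl_iff, Set.mem_empty_iff_false,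
      iff_false, not_and]
    exact fun h hy => h (φ.map_target hy)
  rw [this, Measure.restrict_empty, lintegral_zero_measure]

/-- The change of variables formula: the measures `√(det g_{ij}) dy` of two charts agree on the
overlap. -/
theorem chartMeasure_eq (a : AmbientMetric g) (hφ : φ ∈ atlas (E n) M) (hψ : ψ ∈ atlas (E n) M)
    {S : Set M} (hS : MeasurableSet S) (hSφ : S ⊆ φ.source) (hSψ : S ⊆ ψ.source) :
    chartMeasure g φ S = chartMeasure g ψ S := by
  have hov : ∀ y ∈ ψ.symm ⁻¹' S ∩ ψ.target, y ∈ overlap φ ψ := fun y hy => ⟨hy.2, hSφ hy.1⟩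
  rw [chartMeasure_apply g φ hS, chartMeasure_apply g ψ hS]
  have him : φ.symm ⁻¹' S ∩ φ.target =
      (fun z => φ (ψ.symm z)) '' (ψ.symm ⁻¹' S ∩ ψ.target) := by
    ext y
    constructor
    · rintro ⟨hy, hyt⟩
      have h1 : φ.symm y ∈ ψ.source := hSψ hy
      refine ⟨ψ (φ.symm y), ⟨?_, ψ.map_source h1⟩, ?_⟩
      · simpa [ψ.left_inv h1] using hy
      · simp [ψ.left_inv h1, φ.right_inv hyt]
    · rintro ⟨z, hz, rfl⟩
      refine ⟨?_, φ.map_source (hov z hz).2⟩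
      simpa [φ.left_inv (hov z hz).2] using hz.1
  rw [him, lintegral_image_eq_lintegral_abs_det_fderiv_mul volume
    (measurableSet_preimage_symm ψ hS) (fun z hz =>
      ((contDiffAt_transition hφ hψ (hov z hz)).differentiableAt
        (by simp)).hasFDerivAt.hasFDerivWithinAt)]
  · refine setLIntegral_congr_fun (measurableSet_preimage_symm ψ hS) fun z hz => ?_
    rw [← ENNReal.ofReal_mul (abs_nonneg _), ← volDensity_transition a hφ hψ (hov z hz)]
  · intro z hz w hw h
    have h1 := φ.injOn (hov z hz).2 (hov w hw).2 h
    exact ψ.symm.injOn hz.2 hw.2 h1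

/-- On the domain of `φ` the measure of `φ` dominates those of all other charts, so the supremum
defining `vol` is attained there. -/
theorem chartMeasure_restrict_le (a : AmbientMetric g) (hφ : φ ∈ atlas (E n) M)
    (hψ : ψ ∈ atlas (E n) M) : (chartMeasure g ψ).restrict φ.source ≤ chartMeasure g φ := by
  have hmφ := φ.open_source.measurableSet
  have hmψ := ψ.open_source.measurableSet
  refine Measure.le_iff.2 fun S hS => ?_
  rw [Measure.restrict_apply hS]
  have h1 : chartMeasure g ψ (S ∩ φ.source) ≤ chartMeasure g ψ (S ∩ φ.source ∩ ψ.source) := by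
    have h := measure_le_inter_add_sdiff (chartMeasure g ψ) (S ∩ φ.source) ψ.source
    have h0 : chartMeasure g ψ ((S ∩ φ.source) \ ψ.source) = 0 :=
      measure_mono_null (fun z hz => hz.2) (chartMeasure_compl g ψ)
    rwa [h0, add_zero] at h
  refine h1.trans ?_
  rw [← chartMeasure_eq a hφ hψ ((hS.inter hmφ).inter hmψ) (fun z hz => hz.1.2) fun z hz => hz.2]
  exact measure_mono fun z hz => hz.1.1

/-- On the domain of a chart the volume measure is `√(det g_{ij}) dy`. -/
theorem vol_restrict (a : AmbientMetric g) (hφ : φ ∈ atlas (E n) M) :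
    (vol g).restrict φ.source = chartMeasure g φ := by
  have hm := φ.open_source.measurableSet
  have h0 : (chartMeasure g φ).restrict φ.source = chartMeasure g φ := by
    have h := Measure.restrict_add_restrict_compl (μ := chartMeasure g φ) hm
    rwa [Measure.restrict_eq_zero.2 (chartMeasure_compl g φ), add_zero] at h
  have hle : ∀ ψ ∈ atlas (E n) M, chartMeasure g ψ ≤ vol g := fun ψ hψ =>
    le_iSup₂ (f := fun (ψ : OpenPartialHomeomorph M (E n)) (_ : ψ ∈ atlas (E n) M) => chartMeasure g ψ) ψ hψ
  refine le_antisymm ?_ ?_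
  · have h1 : vol g ≤ chartMeasure g φ + (vol g).restrict φ.sourceᶜ := by
      rw [vol_eq]
      refine iSup₂_le fun ψ hψ => ?_
      rw [← Measure.restrict_add_restrict_compl (μ := chartMeasure g ψ) hm]
      exact add_le_add (chartMeasure_restrict_le a hφ hψ)
        (Measure.restrict_mono le_rfl (hle ψ hψ))
    have h2 := Measure.restrict_mono (le_refl φ.source) h1
    rwa [Measure.restrict_add, h0, Measure.restrict_restrict hm, Set.inter_compl_self,
      Measure.restrict_empty, add_zero] at h2
  · rw [← h0]
    exact Measure.restrict_mono le_rfl (hle φ hφ)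

/-- Integration of a function supported in the domain of a chart. -/
theorem integral_vol_eq (a : AmbientMetric g) (hφ : φ ∈ atlas (E n) M) {f : M → ℝ}
    (hf : Continuous f) (h0 : ∀ z ∉ φ.source, f z = 0) :
    ∫ z, f z ∂(vol g) = ∫ y in φ.target, volDensity g φ y * f (φ.symm y) := by
  rw [← setIntegral_eq_integral_of_forall_compl_eq_zero h0, vol_restrict a hφ, chartMeasure,
    integral_map (aemeasurable_symm g φ) hf.aestronglyMeasurable,
    integral_withDensity_eq_integral_toReal_smul₀ (aemeasurable_volDensity a hφ).ennreal_ofReal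
      (Filter.Eventually.of_forall fun _ => ENNReal.ofReal_lt_top)]
  refine setIntegral_congr_fun φ.open_target.measurableSet fun y hy => ?_
  simp [ENNReal.toReal_ofReal (volDensity_pos (g := g) hφ hy).le]

theorem isOpenPosMeasure_vol (a : AmbientMetric g) : (vol g).IsOpenPosMeasure := by
  refine ⟨fun U hU ⟨x, hx⟩ h0 => ?_⟩
  have hφ := chart_mem_atlas (E n) x
  set φ := chartAt (E n) x with hφd
  have hm := φ.open_source.measurableSet
  have h1 : chartMeasure g φ U = 0 := by
    rw [← vol_restrict a hφ]
    exact nonpos_iff_eq_zero.1 ((Measure.restrict_apply_le _ _).trans h0.le)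
  rw [chartMeasure_apply g φ hU.measurableSet] at h1
  have hpos : ∀ y ∈ φ.symm ⁻¹' U ∩ φ.target, ENNReal.ofReal (volDensity g φ y) ≠ 0 := fun y hy => by
    simpa using volDensity_pos (g := g) hφ hy.2
  rw [setLIntegral_eq_zero_iff' (measurableSet_preimage_symm φ hU.measurableSet)
    ((aemeasurable_volDensity a hφ).ennreal_ofReal.mono_set Set.inter_subset_right)] at h1
  have h2 : volume (φ.symm ⁻¹' U ∩ φ.target) = 0 := by
    refine measure_mono_null (fun y hy => ?_) (ae_iff.1 h1)
    simp only [Set.mem_ofPred_eq, Classical.not_imp]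
    exact ⟨hy, hpos y hy⟩
  have ho : IsOpen (φ.symm ⁻¹' U ∩ φ.target) := by
    rw [Set.inter_comm]; exact φ.symm.isOpen_inter_preimage hU
  refine (ho.measure_pos volume ⟨φ x, ?_, mem_chart_target _ x⟩).ne' h2
  simpa [φ.left_inv (mem_chart_source (E n) x)] using hx

variable [CompactSpace M] [T2Space M]

theorem isFiniteMeasure_vol (a : AmbientMetric g) : IsFiniteMeasure (vol g) := by
  suffices IsLocallyFiniteMeasure (vol g) from ⟨isCompact_univ.measure_lt_top⟩
  refine ⟨fun x => ?_⟩
  have hφ := chart_mem_atlas (E n) x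
  set φ := chartAt (E n) x with hφd
  obtain ⟨χ, t, ht, htφ, h1, hχ0⟩ := exists_cutoff_at (n := n) φ.open_source
    (mem_chart_source (E n) x)
  have htx : t ∈ 𝓝 x := h1.mono fun z hz => by
    by_contra hzt
    rw [hχ0 z hzt] at hz
    exact zero_ne_one hz
  refine ⟨t, htx, ?_⟩
  have hmt := ht.measurableSet
  have h2 : vol g t = chartMeasure g φ t := by
    rw [← vol_restrict a hφ, Measure.restrict_apply hmt, Set.inter_eq_left.2 htφ]
  rw [h2, chartMeasure_apply g φ hmt]
  have h3 : φ.symm ⁻¹' t ∩ φ.target ⊆ φ '' t := fun y hy => ⟨φ.symm y, hy.1, φ.right_inv hy.2⟩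
  have hK := isCompact_image_chart (φ := φ) ht htφ
  have hc : ContinuousOn (volDensity g φ) (φ '' t) := fun y hy =>
    (contDiffAt_volDensity a hφ (by
      obtain ⟨z, hz, rfl⟩ := hy; exact φ.map_source (htφ hz))).continuousAt.continuousWithinAt
  exact (lintegral_mono_set h3).trans_lt (hc.integrableOn_compact hK).lintegral_lt_top

theorem integrable_of_continuous (a : AmbientMetric g) {f : M → ℝ} (hf : Continuous f) :
    Integrable f (vol g) := by
  have := isFiniteMeasure_vol a
  exact hf.integrable_of_hasCompactSupport (HasCompactSupport.of_compactSpace f)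

/-- The `L²` pairing of smooth functions. -/
def l2Pairing (a : AmbientMetric g) : SmoothFn n M →ₗ[ℝ] SmoothFn n M →ₗ[ℝ] ℝ :=
  have hi : ∀ u v : SmoothFn n M, Integrable (fun x => u x * v x) (vol g) := fun u v =>
    integrable_of_continuous a (u.contMDiff.continuous.mul v.contMDiff.continuous)
  LinearMap.mk₂ ℝ (fun u v => ∫ x, u x * v x ∂(vol g))
    (fun u u' v => by
      rw [← integral_add (hi u v) (hi u' v)]
      exact integral_congr_ae (Filter.Eventually.of_forall fun x => add_mul (u x) (u' x) (v x)))
    (fun c u v => by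
      rw [smul_eq_mul, ← integral_const_mul]
      exact integral_congr_ae (Filter.Eventually.of_forall fun x => mul_assoc c (u x) (v x)))
    (fun u v v' => by
      rw [← integral_add (hi u v) (hi u v')]
      exact integral_congr_ae (Filter.Eventually.of_forall fun x => mul_add (u x) (v x) (v' x)))
    (fun c u v => by
      rw [smul_eq_mul, ← integral_const_mul]
      exact integral_congr_ae (Filter.Eventually.of_forall fun x => mul_left_comm (u x) c (v x)))

theorem l2Pairing_apply (a : AmbientMetric g) (u v : SmoothFn n M) :
    l2Pairing a u v = ∫ x, u x * v x ∂(vol g) := rfl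

theorem l2Pairing_comm (a : AmbientMetric g) (u v : SmoothFn n M) :
    l2Pairing a u v = l2Pairing a v u := by
  simp only [l2Pairing_apply, mul_comm]

theorem l2Pairing_mul (a : AmbientMetric g) (f u v : SmoothFn n M) :
    l2Pairing a (f * u) v = l2Pairing a u (f * v) := by
  rw [l2Pairing_apply, l2Pairing_apply]
  exact integral_congr_ae (Filter.Eventually.of_forall fun x => by
    change f x * u x * v x = u x * (f x * v x)
    ring)

theorem l2Pairing_definite (a : AmbientMetric g) (u : SmoothFn n M) (h : l2Pairing a u u = 0) :
    u = 0 := by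
  have := isFiniteMeasure_vol a
  have := isOpenPosMeasure_vol a
  ext x
  by_contra hx
  have hc : Continuous fun x => u x * u x := u.contMDiff.continuous.mul u.contMDiff.continuous
  exact (integral_pos_of_integrable_nonneg_nonzero hc (integrable_of_continuous a hc)
    (fun x => mul_self_nonneg (u x)) (x := x) (mul_self_ne_zero.2 hx)).ne' h

end Volume

/-! ### Integration by parts on the manifold -/

section Parts

variable {n : ℕ} {M : Type*} [TopologicalSpace M] [ChartedSpace (E n) M] [IsManifold (𝓡 n) ∞ M]
  {φ ψ : OpenPartialHomeomorph M (E n)} {x : M} {g : Metric n M}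

theorem isDensityOn_volDensity (a : AmbientMetric g) (hφ : φ ∈ atlas (E n) M) :
    IsDensityOn (coords g φ) φ.target (volDensity g φ) :=
  (coords_isMetricOn a hφ).isDensityOn (ε := 1) fun y hy =>
    ⟨contDiffAt_volDensity a hφ hy, volDensity_pos hφ hy, by
      rw [volDensity, Real.sq_sqrt (coords_posDef g hφ hy).det_pos.le, one_mul]⟩

theorem pairNabla_linear (a : AmbientMetric g) {l : ℕ} (A : CovTensorField n M (l + l))
    (v u u' : SmoothFn n M) (c : ℝ) (x : M) :
    pairNabla g A v (c • u + u' : SmoothFn n M) x =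
      c * pairNabla g A v u x + pairNabla g A v u' x := by
  have hφ := chart_mem_atlas (E n) x
  have hx := mem_chart_source (E n) x
  have hy := mem_chart_target (E n) x
  have h := iterCovDeriv_linear (coords_isMetricOn a hφ) (fun _ hz => u.contDiffAt hφ hz)
    (fun _ hz => u'.contDiffAt hφ hz) c l _ hy
  have h' : ((c • u + u' : SmoothFn n M) : M → ℝ) ∘ (chartAt (E n) x).symm =
    fun z => c * (u ∘ (chartAt (E n) x).symm) z + (u' ∘ (chartAt (E n) x).symm) z := rfl
  rw [pairNabla_eq a A hφ hx, pairNabla_eq a A hφ hx, pairNabla_eq a A hφ hx, h', h]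
  simp only [raise, mul_add, Finset.mul_sum, Finset.sum_add_distrib, mul_left_comm c]

theorem pairNabla_comm {l : ℕ} {A : CovTensorField n M (l + l)} (hA : A.IsSymm) (u v : M → ℝ)
    (x : M) : pairNabla g A u v x = pairNabla g A v u x :=
  hA _ (chart_mem_atlas (E n) x) _ (mem_chart_target (E n) x) _ _

variable [CompactSpace M] [T2Space M] [MeasurableSpace M] [BorelSpace M]

/-- Integration by parts on `M`, reduced to functions supported in one chart by a partition of unity. -/
theorem l2Pairing_divFormEnd (a : AmbientMetric g) {l : ℕ} (A : CovTensorField n M (l + l))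
    (u v : SmoothFn n M) : l2Pairing a u (divFormEnd a A v) =
      (-1) ^ l * ∫ x, pairNabla g A v u x ∂(vol g) := by
  have hi : ∀ u : SmoothFn n M, Integrable (fun x => pairNabla g A v u x) (vol g) := fun u =>
    integrable_of_continuous a (contMDiff_pairNabla a A v u).continuous
  have hlin : ∀ (c : ℝ) (u u' : SmoothFn n M),
      ∫ x, pairNabla g A v (c • u + u' : SmoothFn n M) x ∂(vol g) =
      c * ∫ x, pairNabla g A v u x ∂(vol g) + ∫ x, pairNabla g A v u' x ∂(vol g) := by
    intro c u u'
    rw [← integral_const_mul, ← integral_add ((hi u).const_mul c) (hi u')]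
    simp only [pairNabla_linear a]
  let L : SmoothFn n M →ₗ[ℝ] ℝ := (l2Pairing a).flip (divFormEnd a A v) - (-1 : ℝ) ^ l •
    { toFun := fun u : SmoothFn n M => ∫ x, pairNabla g A v u x ∂(vol g)
      map_add' := fun u u' => by simpa only [one_smul, one_mul] using hlin 1 u u'
      map_smul' := fun c u => by
        have h0 : ∫ x, pairNabla g A v (0 : SmoothFn n M) x ∂(vol g) = 0 := by
          have := hlin 1 0 0
          rw [one_smul, add_zero] at this
          linarith
        have := hlin c u 0
        rwa [add_zero, h0, add_zero] at this }
  have key : L u = 0 := by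
    refine eq_zero_of_forall_chart L (fun φ hφ t ht htφ u hu => ?_) u
    have h1 := integral_vol_eq a hφ (f := fun x => u x * divFormEnd a A v x)
      (u.contMDiff.continuous.mul (divFormEnd a A v).contMDiff.continuous)
      (fun z hz => by rw [hu z fun h => hz (htφ h), zero_mul])
    have hC := isCompact_image_chart ht htφ
    have hCt : φ '' t ⊆ φ.target := by
      rintro _ ⟨z, hz, rfl⟩; exact φ.map_source (htφ hz)
    have hu0 : ∀ y ∈ φ.target, y ∉ φ '' t → (u ∘ φ.symm) y = 0 := fun y hy hyt =>
      hu _ fun h => hyt ⟨_, h, φ.right_inv hy⟩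
    have h0 : ∀ z ∉ φ.source, pairNabla g A v u z = 0 := by
      intro z hz
      have hψ := chart_mem_atlas (E n) z
      have hzs := mem_chart_source (E n) z
      rw [pairNabla_eq a A hψ hzs]
      refine Finset.sum_eq_zero fun J _ => ?_
      rw [raise_zero, mul_zero]
      refine iterCovDeriv_eq_zero ((chartAt (E n) z).symm.isOpen_inter_preimage ht.isOpen_compl)
        (fun y hy => hu _ hy.2) l _ ⟨mem_chart_target _ z, ?_⟩
      simpa [(chartAt (E n) z).left_inv hzs] using fun h => hz (htφ h)
    have h2 := integral_vol_eq a hφ (contMDiff_pairNabla a A v u).continuous h0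
    have h3 := (coords_isMetricOn a hφ).integral_mul_iterDivergence (isDensityOn_volDensity a hφ)
      (fun y hy => u.contDiffAt hφ hy) hC hCt hu0 (smoothTensorOn_contractNabla a A hφ v)
    change ∫ x, u x * divFormEnd a A v x ∂(vol g) - (-1) ^ l * ∫ x, pairNabla g A v u x ∂(vol g) = 0
    rw [h1, h2, sub_eq_zero]
    refine Eq.trans ?_ (h3.trans ?_)
    · refine setIntegral_congr_fun φ.open_target.measurableSet fun y hy => ?_
      simp only [divFormEnd_apply]
      rw [divForm_eq a A hφ (φ.map_target hy), φ.right_inv hy]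
      rfl
    · congr 1
      refine setIntegral_congr_fun φ.open_target.measurableSet fun y hy => ?_
      rw [pairNabla_eq a A hφ (φ.map_target hy), φ.right_inv hy]
      congr 1
      exact Finset.sum_congr rfl fun J _ => mul_comm _ _
  exact sub_eq_zero.1 key

theorem divFormEnd_selfAdjoint (a : AmbientMetric g) {l : ℕ} {A : CovTensorField n M (l + l)}
    (hA : A.IsSymm) (u v : SmoothFn n M) :
    l2Pairing a (divFormEnd a A u) v = l2Pairing a u (divFormEnd a A v) := by
  rw [l2Pairing_comm, l2Pairing_divFormEnd, l2Pairing_divFormEnd]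
  simp only [pairNabla_comm hA u v]

end Parts

/-! ### The symbol of a differential operator as a tensor field -/

section Symbol

variable {n : ℕ} {M : Type*} [TopologicalSpace M] [ChartedSpace (E n) M] [IsManifold (𝓡 n) ∞ M]
  {φ ψ : OpenPartialHomeomorph M (E n)} {x : M} {g : Metric n M}

theorem pderiv_transition (hφ : φ ∈ atlas (E n) M) (hψ : ψ ∈ atlas (E n) M) (hxφ : x ∈ φ.source)
    (hxψ : x ∈ ψ.source) (u : SmoothFn n M) (i : Fin n) : pderiv i (u ∘ ψ.symm) (ψ x) =
      ∑ b, jac (fun z => φ (ψ.symm z)) b i (ψ x) * pderiv b (u ∘ φ.symm) (φ x) := by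
  have hy := mem_overlap hxφ hxψ
  have h : u ∘ ψ.symm =ᶠ[𝓝 (ψ x)] fun z => (u ∘ φ.symm) (φ (ψ.symm z)) :=
    ((isOpen_overlap φ ψ).eventually_mem hy).mono (comp_symm_transition u)
  have hτ : φ (ψ.symm (ψ x)) = φ x := by rw [ψ.left_inv hxψ]
  rw [pderiv_congr h, pderiv_comp (F := u ∘ φ.symm) _
    ((contDiffAt_transition hφ hψ hy).differentiableAt (by simp)), hτ]
  · rfl
  · rw [hτ]
    exact diffAt (u.contDiffAt hφ (φ.map_source hxφ))

/-- The function `u` vanishes at `x` and `v` is its gradient there. -/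
def HasGradAt (g : Metric n M) (u : SmoothFn n M) (v : TangentSpace (𝓡 n) x) : Prop :=
  u x = 0 ∧ ∀ φ ∈ atlas (E n) M, x ∈ φ.source → ∀ i,
    pderiv i (u ∘ φ.symm) (φ x) = g.inner x v (coordField φ x i)

theorem hasGradAt_of_chart {u : SmoothFn n M} {v : TangentSpace (𝓡 n) x} (h0 : u x = 0)
    (hφ : φ ∈ atlas (E n) M) (hx : x ∈ φ.source)
    (h : ∀ i, pderiv i (u ∘ φ.symm) (φ x) = g.inner x v (coordField φ x i)) :
    HasGradAt g u v := by
  refine ⟨h0, fun ψ hψ hxψ i => ?_⟩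
  rw [pderiv_transition hφ hψ hx hxψ, coordField_transition hφ hψ hx hxψ, map_sum]
  simp only [h, map_smul, smul_eq_mul]

variable [CompactSpace M] [T2Space M]

theorem HasGradAt.sub_mem {u u' : SmoothFn n M} {v : TangentSpace (𝓡 n) x}
    (hu : HasGradAt g u v) (hu' : HasGradAt g u' v) :
    u - u' ∈ RingHom.ker (evalAt (n := n) x) ^ 2 := by
  have hφ := chart_mem_atlas (E n) x
  have hx := mem_chart_source (E n) x
  have hy := mem_chart_target (E n) x
  refine mem_ker_sq hφ hx (u := u - u') (by
    change u x - u' x = 0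
    rw [hu.1, hu'.1, sub_zero]) fun i => ?_
  have h := pderiv_sub (diffAt (u.contDiffAt hφ hy)) (diffAt (u'.contDiffAt hφ hy)) i
  refine Eq.trans h ?_
  rw [hu.2 _ hφ hx, hu'.2 _ hφ hx, sub_self]

theorem exists_gradSection (g : Metric n M) (x : M) :
    ∃ L : TangentSpace (𝓡 n) x →ₗ[ℝ] SmoothFn n M, ∀ v, HasGradAt g (L v) v := by
  set φ := chartAt (E n) x with hφd
  have hφ : φ ∈ atlas (E n) M := chart_mem_atlas (E n) x
  have hx : x ∈ φ.source := mem_chart_source (E n) x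
  have hy : φ x ∈ φ.target := mem_chart_target (E n) x
  have h := fun i : Fin n => exists_extension hφ hx (f := fun y => y i - φ x i) (fun y _ => by fun_prop)
  choose X hX using h
  refine ⟨∑ i, LinearMap.smulRight (g.inner x (coordField φ x i)).toLinearMap (X i),
    fun v => ?_⟩
  have hv : (∑ i, LinearMap.smulRight (g.inner x (coordField φ x i)).toLinearMap (X i)) v =
      ∑ i, (g.inner x v (coordField φ x i)) • X i := by
    simp only [LinearMap.sum_apply, LinearMap.smulRight_apply]
    exact Finset.sum_congr rfl fun i _ => congrArg (· • X i) (g.symm x _ _)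
  rw [hv]
  have hval : ∀ z, (∑ i, (g.inner x v (coordField φ x i)) • X i : SmoothFn n M) z =
      ∑ i, g.inner x v (coordField φ x i) * X i z := by
    intro z
    change evalAt z _ = _
    simp
  refine hasGradAt_of_chart ?_ hφ hx fun i => ?_
  · rw [hval]
    exact Finset.sum_eq_zero fun i _ => by rw [(hX i).self_of_nhds]; simp
  · have he : (∑ i, (g.inner x v (coordField φ x i)) • X i : SmoothFn n M) ∘ φ.symm =ᶠ[𝓝 (φ x)]
        fun y => ∑ i, g.inner x v (coordField φ x i) * (y i - φ x i) := by
      filter_upwards [φ.open_target.mem_nhds hy, (tendsto_symm_nhds hx).eventually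
        (Filter.eventually_all.2 hX)] with y hyt hyX
      rw [Function.comp_apply, hval]
      simp only [hyX, φ.right_inv hyt]
    rw [pderiv_congr he, pderiv_sum _ (fun j _ => by fun_prop)]
    have : ∀ j, pderiv i (fun y => g.inner x v (coordField φ x j) * (y j - φ x j)) (φ x) =
        g.inner x v (coordField φ x j) * if j = i then 1 else 0 := by
      intro j
      rw [pderiv_const_mul _ (by fun_prop), pderiv_sub (by fun_prop) (by fun_prop), pderiv_coord,
        pderiv_const, sub_zero]
    simp [this]

/-- A linear choice of functions with prescribed gradient at `x`. -/
def gradSection (g : Metric n M) (x : M) : TangentSpace (𝓡 n) x →ₗ[ℝ] SmoothFn n M :=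
  (exists_gradSection g x).choose

theorem hasGradAt_gradSection (g : Metric n M) (x : M) (v : TangentSpace (𝓡 n) x) :
    HasGradAt g (gradSection g x v) v := (exists_gradSection g x).choose_spec v

/-- The multilinear form `(v_1, …, v_m) ↦ Q(f_1 ⋯ f_m)(x)`, where `f_s` vanishes at `x` and has
gradient `v_s` there. -/
def symbolForm (g : Metric n M) (Q : Module.End ℝ (SmoothFn n M)) (m : ℕ) (x : M) :
    MultilinearMap ℝ (fun _ : Fin m => TangentSpace (𝓡 n) x) ℝ :=
  ((evalAt x).toLinearMap.comp Q).compMultilinearMap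
    ((MultilinearMap.mkPiAlgebra ℝ (Fin m) (SmoothFn n M)).compLinearMap fun _ => gradSection g x)

theorem symbolForm_apply {m : ℕ} {Q : Module.End ℝ (SmoothFn n M)}
    (hQ : IsOrd (evalAt (n := n) (M := M)) (m + 1) Q) {v : Fin m → TangentSpace (𝓡 n) x}
    {f : Fin m → SmoothFn n M} (hf : ∀ s, HasGradAt g (f s) (v s)) :
    symbolForm g Q m x v = Q (∏ s, f s) x := by
  have h := hQ.symbol_congr x (f := f) (f' := fun s => gradSection g x (v s)) (fun s => (hf s).1)
    (fun s => (hasGradAt_gradSection g x (v s)).1)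
    fun s => (hf s).sub_mem (hasGradAt_gradSection g x (v s))
  simp only [symbolForm, LinearMap.compMultilinearMap_apply, MultilinearMap.compLinearMap_apply,
    MultilinearMap.mkPiAlgebra_apply]
  exact h.symm

theorem contDiffAt_apply_prod (Q : Module.End ℝ (SmoothFn n M)) (hφ : φ ∈ atlas (E n) M)
    {m : ℕ} {κ : Type} [Fintype κ] [DecidableEq κ] {c : Fin m → κ → E n → ℝ}
    (w : Fin m → κ → SmoothFn n M)
    {y : E n} (hy : y ∈ φ.target) (hc : ∀ s k, ContDiffAt ℝ ∞ (c s k) y) :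
    ContDiffAt ℝ ∞ (fun z => Q (∏ s, ∑ k, c s k z • w s k) (φ.symm z)) y := by
  have h : ∀ z, Q (∏ s, ∑ k, c s k z • w s k) (φ.symm z) =
      ∑ p : Fin m → κ, (∏ s, c s (p s) z) * Q (∏ s, w s (p s)) (φ.symm z) := by
    intro z
    change evalAt (φ.symm z) _ = _
    rw [Finset.prod_univ_sum, map_sum, map_sum, Fintype.piFinset_univ]
    refine Finset.sum_congr rfl fun p _ => ?_
    rw [Finset.prod_smul, map_smul, map_smul]
    rfl
  simp only [h]
  exact ContDiffAt.sum fun p _ => (contDiffAt_prod fun s _ => hc s _).mul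
    ((Q _).contDiffAt hφ hy)

/-- The components of `symbolForm` are smooth: near a fixed point the functions with prescribed
gradient can be chosen as smooth combinations of finitely many fixed functions. -/
theorem contDiffOn_symbolForm (a : AmbientMetric g) {m : ℕ} {Q : Module.End ℝ (SmoothFn n M)}
    (hQ : IsOrd (evalAt (n := n) (M := M)) (m + 1) Q) (hφ : φ ∈ atlas (E n) M)
    (I : Fin m → Fin n) :
    ContDiffOn ℝ ∞ (fun y => symbolForm g Q m (φ.symm y) fun s => coordVec φ y (I s)) φ.target := by
  intro y₀ hy₀
  refine ContDiffAt.contDiffWithinAt ?_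
  set x₀ := φ.symm y₀
  have hx₀ : x₀ ∈ φ.source := φ.map_target hy₀
  have h := fun i : Fin n => exists_extension hφ hx₀ (f := fun y => y i) (fun y _ => by fun_prop)
  choose X hX using h
  obtain ⟨U, hUo, hxU, hU⟩ : ∃ U : Set M, IsOpen U ∧ x₀ ∈ U ∧ ∀ z ∈ U, ∀ i, X i z = φ z i := by
    obtain ⟨U, hU, hUo, hxU⟩ := eventually_nhds_iff.1 (Filter.eventually_all.2 hX)
    exact ⟨U, hUo, hxU, hU⟩
  have hG := coords_isMetricOn a hφ
  -- near `y₀`, the function `∑ⱼ g_{I s, j}(y) (X j - y j)` has gradient `∂_{I s}` at `y`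
  set c : Fin m → Fin n ⊕ Unit → E n → ℝ := fun s k z => Sum.elim
    (fun j => coords g φ z (I s) j) (fun _ => -∑ j, coords g φ z (I s) j * z j) k with hc
  set w : Fin m → Fin n ⊕ Unit → SmoothFn n M := fun s k => Sum.elim X (fun _ => 1) k with hw
  refine (contDiffAt_apply_prod Q hφ w hy₀ (c := c) ?_).congr_of_eventuallyEq ?_
  · rintro s (j | _)
    · exact hG.smooth y₀ hy₀ _ _
    · exact (ContDiffAt.sum fun j _ => (hG.smooth y₀ hy₀ _ _).mul (by fun_prop)).neg
  · filter_upwards [φ.open_target.mem_nhds hy₀, (φ.symm.isOpen_inter_preimage hUo).mem_nhds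
      ⟨hy₀, hxU⟩] with y hy hyU
    obtain ⟨x, hx, rfl⟩ : ∃ x ∈ φ.source, φ x = y := ⟨_, φ.map_target hy, φ.right_inv hy⟩
    have hxU : x ∈ U := by simpa [φ.left_inv hx] using hyU.2
    have e1 : (symbolForm g Q m (φ.symm (φ x)) fun s => coordVec φ (φ x) (I s)) =
        symbolForm g Q m x fun s => coordField φ x (I s) := by
      have : ∀ p, p = x → ∀ v : Fin m → E n, symbolForm g Q m p v = symbolForm g Q m x v := by
        rintro p rfl v; rfl
      exact this _ (φ.left_inv hx) _
    rw [e1, φ.left_inv hx]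
    refine symbolForm_apply hQ fun s => ?_
    have hval : ∀ z, (∑ k, c s k (φ x) • w s k : SmoothFn n M) z =
        ∑ j, coords g φ (φ x) (I s) j * (X j z - φ x j) := by
      intro z
      change evalAt z _ = _
      have h1 : (1 : SmoothFn n M) z = 1 := rfl
      rw [map_sum]
      simp only [map_smul, hc, hw, Fintype.sum_sum_type, Sum.elim_inl, Sum.elim_inr, h1,
        evalAt_apply, smul_eq_mul, mul_sub, Finset.sum_sub_distrib, Finset.univ_unique,
        Finset.sum_singleton, mul_one]
      ring
    refine hasGradAt_of_chart ?_ hφ hx fun i => ?_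
    · rw [hval]
      exact Finset.sum_eq_zero fun j _ => by rw [hU x hxU, sub_self, mul_zero]
    · have he : (∑ k, c s k (φ x) • w s k : SmoothFn n M) ∘ φ.symm =ᶠ[𝓝 (φ x)]
          fun y => ∑ j, coords g φ (φ x) (I s) j * (y j - φ x j) := by
        filter_upwards [φ.open_target.mem_nhds (φ.map_source hx),
          (tendsto_symm_nhds hx).eventually (hUo.mem_nhds hxU)] with z hzt hzU
        rw [Function.comp_apply, hval]
        simp only [hU _ hzU, φ.right_inv hzt]
      rw [pderiv_congr he, pderiv_sum _ (fun j _ => by fun_prop)]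
      have : ∀ j, pderiv i (fun y => coords g φ (φ x) (I s) j * (y j - φ x j)) (φ x) =
          coords g φ (φ x) (I s) j * if j = i then 1 else 0 := by
        intro j
        rw [pderiv_const_mul _ (by fun_prop), pderiv_sub (by fun_prop) (by fun_prop), pderiv_coord,
          pderiv_const, sub_zero]
      simp only [this]
      simp [coords, formMatrix_apply g.inner hx]

/-- The principal symbol of a differential operator of order at most `2l`, normalized to be the
leading coefficient of the operator in divergence form. -/
def symbolTensor (a : AmbientMetric g) {l : ℕ} {Q : Module.End ℝ (SmoothFn n M)}
    (hQ : IsOrd (evalAt (n := n) (M := M)) (l + l + 1) Q) : CovTensorField n M (l + l) where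
  toFun x := ((-1 : ℝ) ^ l / (l + l).factorial) • symbolForm g Q (l + l) x
  smooth φ hφ I := by
    have := (contDiffOn_symbolForm a hQ hφ I).const_smul ((-1 : ℝ) ^ l / (l + l).factorial)
    exact this

theorem symbolTensor_apply (a : AmbientMetric g) {l : ℕ} {Q : Module.End ℝ (SmoothFn n M)}
    (hQ : IsOrd (evalAt (n := n) (M := M)) (l + l + 1) Q)
    {v : Fin (l + l) → TangentSpace (𝓡 n) x} {f : Fin (l + l) → SmoothFn n M}
    (hf : ∀ s, HasGradAt g (f s) (v s)) :
    (symbolTensor a hQ).toFun x v =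
      ((-1 : ℝ) ^ l / (l + l).factorial) * Q (∏ s, f s) x := by
  rw [← symbolForm_apply hQ hf]
  rfl

theorem isSymm_symbolTensor (a : AmbientMetric g) {l : ℕ} {Q : Module.End ℝ (SmoothFn n M)}
    (hQ : IsOrd (evalAt (n := n) (M := M)) (l + l + 1) Q) : (symbolTensor a hQ).IsSymm := by
  intro φ hφ y hy X Y
  obtain ⟨x, hx, rfl⟩ : ∃ x ∈ φ.source, φ x = y := ⟨_, φ.map_target hy, φ.right_inv hy⟩
  simp only [CovTensorField.pair]
  rw [Finset.sum_comm]
  refine Finset.sum_congr rfl fun J _ => Finset.sum_congr rfl fun I _ => ?_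
  have h : (symbolTensor a hQ).comp φ (φ x) (Fin.append I J) =
      (symbolTensor a hQ).comp φ (φ x) (Fin.append J I) := by
    rw [CovTensorField.comp_apply _ hx, CovTensorField.comp_apply _ hx,
      symbolTensor_apply a hQ (fun s => hasGradAt_gradSection g x _),
      symbolTensor_apply a hQ (fun s => hasGradAt_gradSection g x _)]
    simp only [Fin.prod_univ_add, Fin.append_left, Fin.append_right]
    rw [mul_comm (∏ i, _)]
  rw [h]; ring

/-! ### Self-adjoint operators in divergence form -/

/-- The divergence form operator on powers of a function `u` vanishing at `x`: for `r = l` it gives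
`(2l)!` times the coefficient tensor on the gradient of `u`, for `r > l` it gives zero. -/
theorem divFormEnd_pow (a : AmbientMetric g) {l : ℕ} (A : CovTensorField n M (l + l))
    {u : SmoothFn n M} (r : ℕ) (hlr : l ≤ r) (hφ : φ ∈ atlas (E n) M) (hx : x ∈ φ.source)
    (h0 : u x = 0) : divFormEnd a A (u ^ (l + r)) x = 0 ^ (r - l) * ((l + r).factorial / (r - l).factorial *
      A.toFun x fun _ => ∑ i, (∑ j, (coords g φ (φ x))⁻¹ j i * pderiv j (u ∘ φ.symm) (φ x)) •
        coordField φ x i) := by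
  have hG := coords_isMetricOn a hφ
  have hy := φ.map_source hx
  have hu := fun z hz => u.contDiffAt hφ (y := z) hz
  obtain ⟨T, hT1, hT2, hT3⟩ := hG.iterCovDeriv_pow hu (l + r) l (by omega)
  have hu0 : (u ∘ φ.symm) (φ x) = 0 := by simp [φ.left_inv hx, h0]
  set grad : Fin n → ℝ := fun i => ∑ j, (coords g φ (φ x))⁻¹ j i * pderiv j (u ∘ φ.symm) (φ x)
    with hgrad
  set S : LocalTensor (Fin n) l := fun y J => ∑ I : Fin l → Fin n, A.comp φ y (Fin.append I J) *
    raise (coords g φ y) (T y) I with hS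
  have hSs : SmoothTensorOn S φ.target := fun y hy J => ContDiffAt.sum fun I _ =>
    (A.smoothTensorOn hφ y hy _).mul ((hT1.raise hG) y hy I)
  have h1 : ∀ y ∈ φ.target, contractNabla g A φ (u ^ (l + r) : SmoothFn n M) y =
      fun J => (u ∘ φ.symm) y ^ r * S y J := by
    intro y hy
    ext J
    have e : ((u ^ (l + r) : SmoothFn n M) : M → ℝ) ∘ φ.symm =
        fun z => (u ∘ φ.symm) z ^ (l + r) := by
      ext z
      exact map_pow (evalAt (φ.symm z)) u (l + r)
    simp only [contractNabla, hS, e, hT2 y hy, raise, Finset.mul_sum, Nat.add_sub_cancel_left]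
    refine Finset.sum_congr rfl fun I _ => Finset.sum_congr rfl fun K _ => by ring
  have hraise : ∀ I : Fin l → Fin n, raise (coords g φ (φ x)) (T (φ x)) I =
      (l + r).descFactorial l * ∏ s, grad (I s) := by
    intro I
    simp only [raise, hT3 _ hy hu0, hgrad]
    rw [Finset.prod_univ_sum, Fintype.piFinset_univ, Finset.mul_sum]
    refine Finset.sum_congr rfl fun K _ => ?_
    rw [Finset.prod_mul_distrib]
    simp only [hG.inv_symm hy (I _)]
    ring
  have hA : A.toFun x (fun _ => ∑ i, grad i • coordField φ x i) =
      ∑ I : Fin l → Fin n, ∑ J : Fin l → Fin n, A.comp φ (φ x) (Fin.append I J) *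
        (∏ s, grad (I s)) * ∏ s, grad (J s) := by
    rw [MultilinearMap.map_sum, sum_append]
    refine Finset.sum_congr rfl fun I _ => Finset.sum_congr rfl fun J _ => ?_
    rw [MultilinearMap.map_smul_univ, A.comp_apply hx, Fin.prod_univ_add]
    simp only [Fin.append_left, Fin.append_right, smul_eq_mul]
    ring
  rw [divFormEnd_apply, divForm_eq a A hφ hx, iterDivergence_congr hG.isOpen h1 _ hy,
    hG.iterDivergence_pow_mul hu r hlr hSs _ hy hu0, hA]
  have hf : ((l + r).factorial : ℝ) / (r - l).factorial =
      r.descFactorial l * (l + r).descFactorial l := by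
    have e1 := Nat.factorial_mul_descFactorial hlr
    have e2 := Nat.factorial_mul_descFactorial (Nat.le_add_right l r)
    rw [Nat.add_sub_cancel_left] at e2
    rw [div_eq_iff (by positivity), ← e2, ← e1]
    push_cast
    ring
  rw [hf, Finset.sum_comm]
  congr 1
  rw [mul_assoc]
  congr 1
  rw [Finset.mul_sum]
  refine Finset.sum_congr rfl fun J _ => ?_
  simp only [hS, hraise, Finset.mul_sum]
  refine Finset.sum_congr rfl fun I _ => ?_
  simp only [hgrad]
  ring

/-- The gradient in coordinates has components `g^{ij} ∂_j u`. -/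
theorem hasGradAt_sum (a : AmbientMetric g) {u : SmoothFn n M} (hφ : φ ∈ atlas (E n) M)
    (hx : x ∈ φ.source) (h0 : u x = 0) : HasGradAt g u (∑ i, (∑ j, (coords g φ (φ x))⁻¹ j i *
      pderiv j (u ∘ φ.symm) (φ x)) • coordField φ x i) := by
  refine hasGradAt_of_chart h0 hφ hx fun k => ?_
  have hG := coords_isMetricOn a hφ
  have hm := hG.inv_mul (φ.map_source hx)
  simp only [map_sum, map_smul, sum_apply, smul_apply, smul_eq_mul,
    ← formMatrix_apply g.inner hx, Finset.sum_mul]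
  rw [Finset.sum_comm]
  have : ∀ j, ∑ i, (coords g φ (φ x))⁻¹ j i * pderiv j (u ∘ φ.symm) (φ x) *
      formMatrix g.inner φ (φ x) i k = (1 : Matrix (Fin n) (Fin n) ℝ) j k *
        pderiv j (u ∘ φ.symm) (φ x) := by
    intro j
    rw [← hm, Matrix.mul_apply, Finset.sum_mul]
    refine Finset.sum_congr rfl fun i _ => ?_
    change _ = _ * formMatrix g.inner φ (φ x) i k * _
    ring
  simp [this, Matrix.one_apply]

theorem isOrd_divFormEnd (a : AmbientMetric g) {l : ℕ} (A : CovTensorField n M (l + l)) :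
    IsOrd (evalAt (n := n) (M := M)) (l + l + 1) (divFormEnd a A) := by
  refine isOrd_of_pow fun x f hf => ?_
  have h := divFormEnd_pow a A (l + 1) (by omega) (chart_mem_atlas (E n) x)
    (mem_chart_source (E n) x) hf
  rw [evalAt_apply, show l + l + 1 = l + (l + 1) by ring, h]
  simp

/-- Subtracting the divergence form with the principal symbol as coefficient lowers the order. -/
theorem isOrd_sub_symbolTensor (a : AmbientMetric g) {l : ℕ} {Q : Module.End ℝ (SmoothFn n M)}
    (hQ : IsOrd (evalAt (n := n) (M := M)) (l + l + 1) Q) :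
    IsOrd (evalAt (n := n) (M := M)) (l + l) (Q - (-1 : ℝ) ^ l • divFormEnd a (symbolTensor a hQ)) := by
  set R := Q - (-1 : ℝ) ^ l • divFormEnd a (symbolTensor a hQ) with hR
  have hRo : IsOrd (evalAt (n := n) (M := M)) (l + l + 1) R :=
    hQ.sub ((isOrd_divFormEnd a _).smul _)
  have key : ∀ (x : M) (f : SmoothFn n M), f x = 0 → evalAt x (R (f ^ (l + l))) = 0 := by
    intro x f hf
    have h := divFormEnd_pow a (symbolTensor a hQ) l le_rfl (chart_mem_atlas (E n) x)
      (mem_chart_source (E n) x) hf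
    rw [symbolTensor_apply a hQ (fun _ => hasGradAt_sum a (chart_mem_atlas (E n) x)
      (mem_chart_source (E n) x) hf), Finset.prod_const, Finset.card_univ, Fintype.card_fin] at h
    have hfac : ((l + l).factorial : ℝ) ≠ 0 := by positivity
    have hsgn : ((-1 : ℝ) ^ l) * (-1) ^ l = 1 := by rw [← mul_pow]; simp
    have e : divFormEnd a (symbolTensor a hQ) (f ^ (l + l)) x =
        (-1) ^ l * Q (f ^ (l + l)) x := by
      rw [h]
      simp only [Nat.sub_self, pow_zero, Nat.factorial_zero, Nat.cast_one, div_one, one_mul]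
      field_simp
    have e2 : evalAt x (R (f ^ (l + l))) = Q (f ^ (l + l)) x -
        (-1) ^ l * divFormEnd a (symbolTensor a hQ) (f ^ (l + l)) x := rfl
    rw [e2, e, ← mul_assoc, hsgn, one_mul, sub_self]
  rcases Nat.eq_zero_or_pos l with rfl | hl
  · -- an operator of order zero that kills the constants vanishes
    intro x u _
    have h1 : u - algebraMap ℝ _ (u x) ∈ RingHom.ker (evalAt (n := n) x) ^ 1 := by
      rw [pow_one, RingHom.mem_ker, map_sub, AlgHom.commutes]
      simp
    have h2 := hRo x _ h1
    have h3 := key x 0 rfl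
    rw [pow_zero] at h3
    rw [Algebra.algebraMap_eq_smul_one, map_sub, map_smul, map_sub, map_smul, h3, smul_zero,
      sub_zero] at h2
    exact h2
  · obtain ⟨m, hm⟩ : ∃ m, l + l = m + 1 := ⟨l + l - 1, by omega⟩
    rw [hm] at key ⊢
    exact isOrd_of_pow key

variable [MeasurableSpace M] [BorelSpace M]

/-- The zero tensor field. -/
def zeroTensor {q : ℕ} : CovTensorField n M q := ⟨fun _ => 0, fun _ _ _ => contDiffOn_const⟩

theorem selfAdjoint_sub_smul {F : Type*} [AddCommGroup F] [Module ℝ F] {B : F →ₗ[ℝ] F →ₗ[ℝ] ℝ}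
    {Q D : Module.End ℝ F} (hQ : ∀ u v, B (Q u) v = B u (Q v))
    (hD : ∀ u v, B (D u) v = B u (D v)) (c : ℝ) (u v : F) :
    B ((Q - c • D) u) v = B u ((Q - c • D) v) := by
  simp only [LinearMap.sub_apply, LinearMap.smul_apply, map_sub, map_smul, hQ, hD]

/-- The operator in divergence form with the principal symbol as coefficient is self-adjoint;
subtracting it from a self-adjoint operator of positive order lowers the order by two, since a
self-adjoint operator has no leading part of odd order. -/
theorem exists_leading_divForm (a : AmbientMetric g) {l : ℕ} {Q : Module.End ℝ (SmoothFn n M)}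
    (hQ : IsOrd (evalAt (n := n) (M := M)) (l + l + 1) Q)
    (hadj : ∀ u v, l2Pairing a (Q u) v = l2Pairing a u (Q v)) :
    ∃ A : CovTensorField n M (l + l), A.IsSymm ∧
      (∀ u v, l2Pairing a ((Q - (-1 : ℝ) ^ l • divFormEnd a A) u) v =
        l2Pairing a u ((Q - (-1 : ℝ) ^ l • divFormEnd a A) v)) ∧
      IsOrd (evalAt (n := n) (M := M)) (l + l - 1) (Q - (-1 : ℝ) ^ l • divFormEnd a A) := by
  refine ⟨symbolTensor a hQ, isSymm_symbolTensor a hQ, ?_⟩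
  have h1 := isOrd_sub_symbolTensor a hQ
  have h2 := selfAdjoint_sub_smul hadj (divFormEnd_selfAdjoint a (isSymm_symbolTensor a hQ))
    ((-1 : ℝ) ^ l)
  refine ⟨h2, ?_⟩
  rcases Nat.eq_zero_or_pos l with rfl | hl
  · exact h1
  · obtain ⟨m, rfl⟩ : ∃ m, l = m + 1 := ⟨l - 1, by omega⟩
    refine IsOrd.of_adjoint eq_zero_of_evalAt (l2Pairing_mul a) (l2Pairing_definite a)
      (m := m + 1 + (m + 1) - 1) h1 fun u v => ?_
    have hs : (-1 : ℝ) ^ (m + 1 + (m + 1) - 1 + 1) = 1 := Even.neg_one_pow ⟨m + 1, by omega⟩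
    rw [h2, hs, one_mul]

/-- A self-adjoint differential operator of order at most `2l` is a sum of operators in divergence
form. -/
theorem exists_divergence_form (a : AmbientMetric g) (l : ℕ) {Q : Module.End ℝ (SmoothFn n M)}
    (hQ : IsOrd (evalAt (n := n) (M := M)) (l + l + 1) Q)
    (hadj : ∀ u v, l2Pairing a (Q u) v = l2Pairing a u (Q v)) :
    ∃ A : (l : ℕ) → CovTensorField n M (l + l), (∀ j ≤ l, (A j).IsSymm) ∧
      Q = ∑ j ∈ Finset.range (l + 1), (-1 : ℝ) ^ j • divFormEnd a (A j) := by
  induction l generalizing Q with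
  | zero =>
    obtain ⟨A, hA, -, h⟩ := exists_leading_divForm (l := 0) a hQ hadj
    have h0 := sub_eq_zero.1 ((isOrd_zero_iff eq_zero_of_evalAt).1 h)
    refine ⟨Function.update (fun _ => zeroTensor) 0 A, fun j hj => ?_, ?_⟩
    · obtain rfl : j = 0 := by omega
      rwa [Function.update_self]
    · rw [Finset.sum_range_one, Function.update_self]
      exact h0
  | succ l ih =>
    obtain ⟨A', hA', h1, h2⟩ := exists_leading_divForm (l := l + 1) a hQ hadj
    rw [show l + 1 + (l + 1) - 1 = l + l + 1 by omega] at h2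
    obtain ⟨A, hA1, hA2⟩ := ih h2 h1
    refine ⟨Function.update A (l + 1) A', fun j hj => ?_, ?_⟩
    · rcases Nat.lt_or_ge j (l + 1) with h | h
      · rw [Function.update_of_ne h.ne]; exact hA1 j (by omega)
      · obtain rfl : j = l + 1 := by omega
        rwa [Function.update_self]
    · rw [Finset.sum_range_succ, Function.update_self, ← sub_eq_iff_eq_add, hA2]
      refine Finset.sum_congr rfl fun j hj => ?_
      rw [Function.update_of_ne (Finset.mem_range.1 hj).ne]

end Symbol

/-! ### The ambient metric in coordinates -/

section Ambient

variable {n : ℕ}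

@[simp] theorem ambientBase_ambientPoint (y : E n) (t ρ : ℝ) :
    ambientBase (ambientPoint y t ρ) = y := rfl

@[simp] theorem ambientPoint_inl (y : E n) (t ρ : ℝ) (i : Fin n) :
    ambientPoint y t ρ (Sum.inl i) = y i := rfl

@[simp] theorem ambientPoint_inr_zero (y : E n) (t ρ : ℝ) :
    ambientPoint y t ρ (Sum.inr 0) = t := rfl

@[simp] theorem ambientPoint_inr_one (y : E n) (t ρ : ℝ) :
    ambientPoint y t ρ (Sum.inr 1) = ρ := rfl

@[simp] theorem ambientBase_apply (z : EuclideanSpace ℝ (AmbientIndex n)) (i : Fin n) :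
    ambientBase z i = z (Sum.inl i) := rfl

theorem contDiff_ambientBase : ContDiff ℝ ∞ (ambientBase (n := n)) := by
  rw [contDiff_euclidean]
  intro i
  simp only [ambientBase_apply]
  fun_prop

theorem contDiff_ambientPoint :
    ContDiff ℝ ∞ (fun p : E n × ℝ × ℝ => ambientPoint p.1 p.2.1 p.2.2) := by
  rw [contDiff_euclidean]
  rintro (i | i)
  · simp only [ambientPoint_inl]
    fun_prop
  · fin_cases i
    · simp only [Fin.zero_eta, ambientPoint_inr_zero]; fun_prop
    · simp only [Fin.mk_one, ambientPoint_inr_one]; fun_prop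

variable {z : EuclideanSpace ℝ (AmbientIndex n)}

theorem pderiv_comp_ambientBase {F : E n → ℝ} (hF : DifferentiableAt ℝ F (ambientBase z))
    (c : AmbientIndex n) : pderiv c (fun z => F (ambientBase z)) z =
      Sum.elim (fun i => pderiv i F (ambientBase z)) (fun _ => 0) c := by
  rw [pderiv_comp hF (contDiff_ambientBase.differentiable (by simp) z)]
  simp only [ambientBase_apply, pderiv_coord]
  rcases c with i | i
  · simp
  · simp

section Weights

variable {F : EuclideanSpace ℝ (AmbientIndex n) → ℝ} (hz : 0 < z (Sum.inr 0))
  (hF : DifferentiableAt ℝ F z)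
include hz hF

theorem pderiv_weight_mul (β : ℝ) (c : AmbientIndex n) (hc : c ≠ Sum.inr 0) :
    pderiv c (fun z => z (Sum.inr 0) ^ β * F z) z = z (Sum.inr 0) ^ β * pderiv c F z := by
  have h := Real.hasDerivAt_rpow_const (x := z (Sum.inr 0)) (p := β) (Or.inl hz.ne')
  have h0 : pderiv c (fun z : EuclideanSpace ℝ (AmbientIndex n) => z (Sum.inr 0) ^ β) z = 0 := by
    rw [pderiv_comp_deriv (f := fun z : EuclideanSpace ℝ (AmbientIndex n) => z (Sum.inr 0)) h
      (by fun_prop), pderiv_coord, if_neg hc.symm, mul_zero]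
  have hd : DifferentiableAt ℝ (fun z : EuclideanSpace ℝ (AmbientIndex n) => z (Sum.inr 0) ^ β) z :=
    h.differentiableAt.comp z (f := fun z : EuclideanSpace ℝ (AmbientIndex n) => z (Sum.inr 0))
      (by fun_prop)
  rw [pderiv_mul hd hF, h0, zero_mul, zero_add]

theorem pderiv_weight_mul_zero (β : ℝ) :
    pderiv (Sum.inr 0) (fun z => z (Sum.inr 0) ^ β * F z) z =
      β * z (Sum.inr 0) ^ (β - 1) * F z + z (Sum.inr 0) ^ β * pderiv (Sum.inr 0) F z := by
  have h := Real.hasDerivAt_rpow_const (x := z (Sum.inr 0)) (p := β) (Or.inl hz.ne')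
  have hd : DifferentiableAt ℝ (fun z : EuclideanSpace ℝ (AmbientIndex n) => z (Sum.inr 0) ^ β) z :=
    h.differentiableAt.comp z (f := fun z : EuclideanSpace ℝ (AmbientIndex n) => z (Sum.inr 0))
      (by fun_prop)
  rw [pderiv_mul hd hF, pderiv_comp_deriv (f := fun z : EuclideanSpace ℝ (AmbientIndex n) =>
    z (Sum.inr 0)) h (by fun_prop), pderiv_coord, if_pos rfl, mul_one]

end Weights

theorem contDiffAt_weight (hz : 0 < z (Sum.inr 0)) (β : ℝ) :
    ContDiffAt ℝ ∞ (fun z : EuclideanSpace ℝ (AmbientIndex n) => z (Sum.inr 0) ^ β) z :=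
  ContDiffAt.rpow_const_of_ne (by fun_prop) hz.ne'

variable {M : Type*} [TopologicalSpace M] [ChartedSpace (E n) M] [IsManifold (𝓡 n) ∞ M]
  {φ ψ : OpenPartialHomeomorph M (E n)} {g : Metric n M}

/-- The components `h_{ij}(ρ, y)` as functions on the ambient coordinate space. -/
def ambientH (a : AmbientMetric g) (φ : OpenPartialHomeomorph M (E n))
    (z : EuclideanSpace ℝ (AmbientIndex n)) : Matrix (Fin n) (Fin n) ℝ :=
  formMatrix (a.form (z (Sum.inr 1))) φ (ambientBase z)

/-- The region of the ambient coordinate space where the ambient metric is nondegenerate and `h_ρ`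
has positive determinant; it contains the hypersurface `ρ = 0`. -/
def ambientDomain (a : AmbientMetric g) (φ : OpenPartialHomeomorph M (E n)) :
    Set (EuclideanSpace ℝ (AmbientIndex n)) :=
  {z | ambientBase z ∈ φ.target ∧ 0 < z (Sum.inr 0) ∧ 0 < (ambientH a φ z).det}

theorem contDiffAt_ambientH (a : AmbientMetric g) (hφ : φ ∈ atlas (E n) M)
    (hz : ambientBase z ∈ φ.target) (i j : Fin n) :
    ContDiffAt ℝ ∞ (fun z => ambientH a φ z i j) z := by
  have h : ContDiffAt ℝ ∞ (fun p : ℝ × E n => formMatrix (a.form p.1) φ p.2 i j)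
      (z (Sum.inr 1), ambientBase z) := (a.smooth φ hφ i j).contDiffAt
    ((isOpen_univ.prod φ.open_target).mem_nhds ⟨trivial, hz⟩)
  exact h.comp z (f := fun z => (z (Sum.inr 1), ambientBase z))
    (ContDiffAt.prodMk (f := fun z : EuclideanSpace ℝ (AmbientIndex n) => z (Sum.inr 1))
      (by fun_prop) contDiff_ambientBase.contDiffAt)

theorem contDiffAt_det_ambientH (a : AmbientMetric g) (hφ : φ ∈ atlas (E n) M)
    (hz : ambientBase z ∈ φ.target) : ContDiffAt ℝ ∞ (fun z => (ambientH a φ z).det) z :=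
  contDiffAt_det (G := ambientH a φ) (contDiffAt_ambientH a hφ hz)

theorem isOpen_ambientDomain (a : AmbientMetric g) (hφ : φ ∈ atlas (E n) M) :
    IsOpen (ambientDomain a φ) := by
  refine isOpen_iff_mem_nhds.2 fun z hz => ?_
  have h1 := contDiff_ambientBase.continuous.continuousAt.preimage_mem_nhds (x := z)
    (φ.open_target.mem_nhds hz.1)
  have h2 : ∀ᶠ w : EuclideanSpace ℝ (AmbientIndex n) in 𝓝 z, 0 < w (Sum.inr 0) :=
    Filter.Tendsto.eventually_const_lt hz.2.1 (ContinuousAt.tendsto (by fun_prop))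
  have h3 := Filter.Tendsto.eventually_const_lt hz.2.2
    (contDiffAt_det_ambientH a hφ hz.1).continuousAt.tendsto
  filter_upwards [h1, h2, h3] with w hw1 hw2 hw3 using ⟨hw1, hw2, hw3⟩

theorem ambientH_zero (a : AmbientMetric g) (φ : OpenPartialHomeomorph M (E n)) (y : E n) (t : ℝ) :
    ambientH a φ (ambientPoint y t 0) = coords g φ y := by
  rw [coords_eq a φ]; rfl

theorem ambientPoint_mem (a : AmbientMetric g) (hφ : φ ∈ atlas (E n) M) {y : E n}
    (hy : y ∈ φ.target) {t : ℝ} (ht : 0 < t) : ambientPoint y t 0 ∈ ambientDomain a φ :=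
  ⟨hy, ht, by rw [ambientH_zero]; exact (coords_posDef g hφ hy).det_pos⟩

theorem ambientMatrix_eq (a : AmbientMetric g) (φ : OpenPartialHomeomorph M (E n))
    (z : EuclideanSpace ℝ (AmbientIndex n)) : ambientMatrix a.form φ z =
      Matrix.fromBlocks (z (Sum.inr 0) ^ 2 • ambientH a φ z) 0 0
        !![2 * z (Sum.inr 1), z (Sum.inr 0); z (Sum.inr 0), 0] := rfl

theorem det_ambientMatrix (a : AmbientMetric g) (φ : OpenPartialHomeomorph M (E n))
    (z : EuclideanSpace ℝ (AmbientIndex n)) : (ambientMatrix a.form φ z).det =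
      -(z (Sum.inr 0) ^ (2 * n + 2) * (ambientH a φ z).det) := by
  rw [ambientMatrix_eq, Matrix.det_fromBlocks_zero₁₂, Matrix.det_smul, Matrix.det_fin_two_of,
    Fintype.card_fin]
  ring

theorem inv_ambientMatrix (a : AmbientMetric g) (hz : z ∈ ambientDomain a φ) :
    (ambientMatrix a.form φ z)⁻¹ =
      Matrix.fromBlocks ((z (Sum.inr 0) ^ 2)⁻¹ • (ambientH a φ z)⁻¹) 0 0
        !![0, (z (Sum.inr 0))⁻¹; (z (Sum.inr 0))⁻¹, -(2 * z (Sum.inr 1)) * (z (Sum.inr 0) ^ 2)⁻¹] := by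
  have ht := hz.2.1.ne'
  have hd : IsUnit (ambientH a φ z).det := hz.2.2.ne'.isUnit
  refine Matrix.inv_eq_right_inv ?_
  rw [ambientMatrix_eq, Matrix.fromBlocks_multiply]
  simp only [Matrix.mul_zero, Matrix.zero_mul, add_zero, zero_add, Matrix.smul_mul,
    Matrix.mul_smul, smul_smul, Matrix.mul_nonsing_inv _ hd]
  rw [inv_mul_cancel₀ (pow_ne_zero 2 ht), one_smul, smul_zero, ← Matrix.fromBlocks_one]
  congr 1
  ext i j
  fin_cases i <;> fin_cases j <;> simp [Matrix.mul_apply, Fin.sum_univ_two] <;> try (field_simp; try ring)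

theorem isMetricOn_ambientMatrix (a : AmbientMetric g) (hφ : φ ∈ atlas (E n) M) :
    IsMetricOn (ambientMatrix a.form φ) (ambientDomain a φ) where
  isOpen := isOpen_ambientDomain a hφ
  smooth z hz c e := by
    simp only [ambientMatrix_eq]
    rcases c with i | i <;> rcases e with j | j
    · simp only [Matrix.fromBlocks_apply₁₁, Matrix.smul_apply, smul_eq_mul]
      exact ContDiffAt.mul (by fun_prop) (contDiffAt_ambientH a hφ hz.1 i j)
    · exact contDiffAt_const
    · exact contDiffAt_const
    · fin_cases i <;> fin_cases j <;> simp <;> fun_prop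
  symm z hz c e := by
    simp only [ambientMatrix_eq]
    rcases c with i | i <;> rcases e with j | j
    · simp only [Matrix.fromBlocks_apply₁₁, Matrix.smul_apply, ambientH, formMatrix,
        Matrix.of_apply, a.symm _ _ (coordVec φ _ i)]
    · rfl
    · rfl
    · fin_cases i <;> fin_cases j <;> simp
  det_ne z hz := by
    rw [det_ambientMatrix]
    exact neg_ne_zero.2 (mul_pos (pow_pos hz.2.1 _) hz.2.2).ne'

/-- The function `(det h_ρ)^{1/4}`. -/
def ambientRoot (a : AmbientMetric g) (φ : OpenPartialHomeomorph M (E n))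
    (z : EuclideanSpace ℝ (AmbientIndex n)) : ℝ := √ √ (ambientH a φ z).det

theorem ambientRoot_pos (a : AmbientMetric g) (hz : z ∈ ambientDomain a φ) :
    0 < ambientRoot a φ z := Real.sqrt_pos.2 (Real.sqrt_pos.2 hz.2.2)

theorem contDiffAt_ambientRoot (a : AmbientMetric g) (hφ : φ ∈ atlas (E n) M)
    (hz : z ∈ ambientDomain a φ) : ContDiffAt ℝ ∞ (ambientRoot a φ) z := by
  have h := contDiffAt_det_ambientH a hφ hz.1
  have h1 : ContDiffAt ℝ ∞ (fun z => √ (ambientH a φ z).det) z := h.sqrt hz.2.2.ne'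
  have h2 : ContDiffAt ℝ ∞ (fun z => √ √ (ambientH a φ z).det) z :=
    h1.sqrt (Real.sqrt_pos.2 hz.2.2).ne'
  exact h2

theorem isDensityOn_ambient (a : AmbientMetric g) (hφ : φ ∈ atlas (E n) M) :
    IsDensityOn (ambientMatrix a.form φ) (ambientDomain a φ)
      (fun z => (z (Sum.inr 0) ^ (((n : ℝ) + 1) / 2) * ambientRoot a φ z) ^ 2) := by
  refine (isMetricOn_ambientMatrix a hφ).isDensityOn (ε := -1) fun z hz => ⟨?_, ?_, ?_⟩
  · exact ((contDiffAt_weight hz.2.1 _).mul (contDiffAt_ambientRoot a hφ hz)).pow 2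
  · exact pow_pos (mul_pos (Real.rpow_pos_of_pos hz.2.1 _) (ambientRoot_pos a hz)) 2
  · have h1 : (z (Sum.inr 0) ^ (((n : ℝ) + 1) / 2)) ^ 4 = z (Sum.inr 0) ^ (2 * n + 2) := by
      rw [← Real.rpow_natCast, ← Real.rpow_mul hz.2.1.le, ← Real.rpow_natCast]
      congr 1
      push_cast
      ring
    have h2 : ambientRoot a φ z ^ 4 = (ambientH a φ z).det := by
      rw [ambientRoot, show (4 : ℕ) = 2 * 2 from rfl, pow_mul, Real.sq_sqrt (Real.sqrt_nonneg _),
        Real.sq_sqrt hz.2.2.le]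
    rw [det_ambientMatrix, ← h1, ← h2]
    ring

end Ambient

/-! ### The ambient Laplacian on homogeneous functions -/

theorem pderiv_eq_zero_of_const {ι : Type} [Fintype ι] [DecidableEq ι] {w : EuclideanSpace ℝ ι → ℝ}
    {z : EuclideanSpace ℝ ι} (hw : DifferentiableAt ℝ w z) (c : ι)
    (h : ∀ r : ℝ, w (z + r • EuclideanSpace.single c 1) = w z) : pderiv c w z = 0 := by
  rw [pderiv, ← hw.lineDeriv_eq_fderiv, lineDeriv]
  simp [h]

section AmbientLaplacian

variable {n : ℕ} {M : Type*} [TopologicalSpace M] [ChartedSpace (E n) M] [IsManifold (𝓡 n) ∞ M]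
  {φ ψ : OpenPartialHomeomorph M (E n)} {g : Metric n M} {z : EuclideanSpace ℝ (AmbientIndex n)}

/-- The operator `∂_i (h^{ij} ∂_j w)`. -/
def tangentialOp (a : AmbientMetric g) (φ : OpenPartialHomeomorph M (E n))
    (w : EuclideanSpace ℝ (AmbientIndex n) → ℝ) (z : EuclideanSpace ℝ (AmbientIndex n)) : ℝ :=
  ∑ i, ∑ j, pderiv (Sum.inl i) (fun z => (ambientH a φ z)⁻¹ i j * pderiv (Sum.inl j) w z) z

/-- A smooth function on the ambient domain that does not depend on `t`. -/
structure IsFlowFn (a : AmbientMetric g) (φ : OpenPartialHomeomorph M (E n))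
    (w : EuclideanSpace ℝ (AmbientIndex n) → ℝ) : Prop where
  smooth : ∀ z ∈ ambientDomain a φ, ContDiffAt ℝ ∞ w z
  pderiv_t : ∀ z ∈ ambientDomain a φ, pderiv (Sum.inr 0) w z = 0

theorem contDiffAt_inv_ambientH (a : AmbientMetric g) (hφ : φ ∈ atlas (E n) M)
    (hz : z ∈ ambientDomain a φ) (i j : Fin n) :
    ContDiffAt ℝ ∞ (fun z => (ambientH a φ z)⁻¹ i j) z :=
  contDiffAt_inv (G := ambientH a φ) (contDiffAt_ambientH a hφ hz.1) hz.2.2.ne' i j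

/-- The flat part of the ambient Laplacian on functions homogeneous in `t`. -/
theorem sum_pderiv_ambient (a : AmbientMetric g) (hφ : φ ∈ atlas (E n) M) (hz : z ∈ ambientDomain a φ)
    {w : EuclideanSpace ℝ (AmbientIndex n) → ℝ} (hw : IsFlowFn a φ w) (β : ℝ) :
    ∑ c, ∑ e, pderiv c (fun z => (ambientMatrix a.form φ z)⁻¹ c e *
        pderiv e (fun z => z (Sum.inr 0) ^ β * w z) z) z =
      z (Sum.inr 0) ^ (β - 2) * (tangentialOp a φ w z
        - 2 * z (Sum.inr 1) * pderiv (Sum.inr 1) (pderiv (Sum.inr 1) w) z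
        + (2 * β - 3) * pderiv (Sum.inr 1) w z) := by
  have hev : ∀ᶠ z in 𝓝 z, z ∈ ambientDomain a φ := (isOpen_ambientDomain a hφ).eventually_mem hz
  have hws := hw.smooth
  have hpow : ∀ z ∈ ambientDomain a φ, z (Sum.inr 0) ^ β =
      z (Sum.inr 0) ^ (β - 2) * z (Sum.inr 0) ^ 2 := fun z hz => by
    rw [← Real.rpow_natCast, ← Real.rpow_add hz.2.1]; congr 1; push_cast; ring
  have hpow1 : ∀ z ∈ ambientDomain a φ, z (Sum.inr 0) ^ β =
      z (Sum.inr 0) ^ (β - 1) * z (Sum.inr 0) := fun z hz => by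
    conv_rhs => rw [← Real.rpow_one (z (Sum.inr 0))]
    rw [Real.rpow_one, ← Real.rpow_add_one hz.2.1.ne']; congr 1; ring
  have hpow2 : ∀ z ∈ ambientDomain a φ, z (Sum.inr 0) ^ (β - 1) =
      z (Sum.inr 0) ^ (β - 2) * z (Sum.inr 0) := fun z hz => by
    rw [← Real.rpow_add_one hz.2.1.ne']; congr 1; ring
  have hll : ∀ i j : Fin n, pderiv (Sum.inl i) (fun z => (ambientMatrix a.form φ z)⁻¹ (Sum.inl i)
      (Sum.inl j) * pderiv (Sum.inl j) (fun z => z (Sum.inr 0) ^ β * w z) z) z =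
      z (Sum.inr 0) ^ (β - 2) *
        pderiv (Sum.inl i) (fun z => (ambientH a φ z)⁻¹ i j * pderiv (Sum.inl j) w z) z := by
    intro i j
    rw [← pderiv_weight_mul hz.2.1 (diffAt ((contDiffAt_inv_ambientH a hφ hz i j).mul
      ((hws z hz).pderiv _))) _ _ (by simp)]
    refine pderiv_congr ?_ _
    filter_upwards [hev] with z hz
    rw [pderiv_weight_mul hz.2.1 (diffAt (hws z hz)) _ _ (by simp), inv_ambientMatrix a hz,
      Matrix.fromBlocks_apply₁₁, Matrix.smul_apply, smul_eq_mul, hpow z hz]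
    have := hz.2.1.ne'
    field_simp
  have hlr : ∀ (i : Fin n) (e : Fin 2), pderiv (Sum.inl i) (fun z => (ambientMatrix a.form φ z)⁻¹
      (Sum.inl i) (Sum.inr e) * pderiv (Sum.inr e) (fun z => z (Sum.inr 0) ^ β * w z) z) z = 0 := by
    intro i e
    rw [← pderiv_const (y := z) (Sum.inl i) 0]
    refine pderiv_congr ?_ _
    filter_upwards [hev] with z hz
    rw [inv_ambientMatrix a hz, Matrix.fromBlocks_apply₁₂, Matrix.zero_apply, zero_mul]
  have hrl : ∀ (i : Fin n) (e : Fin 2), pderiv (Sum.inr e) (fun z => (ambientMatrix a.form φ z)⁻¹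
      (Sum.inr e) (Sum.inl i) * pderiv (Sum.inl i) (fun z => z (Sum.inr 0) ^ β * w z) z) z = 0 := by
    intro i e
    rw [← pderiv_const (y := z) (Sum.inr e) 0]
    refine pderiv_congr ?_ _
    filter_upwards [hev] with z hz
    rw [inv_ambientMatrix a hz, Matrix.fromBlocks_apply₂₁, Matrix.zero_apply, zero_mul]
  have h00 : pderiv (Sum.inr 0) (fun z => (ambientMatrix a.form φ z)⁻¹ (Sum.inr 0) (Sum.inr 0) *
      pderiv (Sum.inr 0) (fun z => z (Sum.inr 0) ^ β * w z) z) z = 0 := by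
    rw [← pderiv_const (y := z) (Sum.inr 0) 0]
    refine pderiv_congr ?_ _
    filter_upwards [hev] with z hz
    rw [inv_ambientMatrix a hz, Matrix.fromBlocks_apply₂₂]
    simp
  have h01 : pderiv (Sum.inr 0) (fun z => (ambientMatrix a.form φ z)⁻¹ (Sum.inr 0) (Sum.inr 1) *
      pderiv (Sum.inr 1) (fun z => z (Sum.inr 0) ^ β * w z) z) z =
      (β - 1) * z (Sum.inr 0) ^ (β - 2) * pderiv (Sum.inr 1) w z := by
    have e1 : pderiv (Sum.inr 0) (pderiv (Sum.inr 1) w) z = 0 := by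
      rw [pderiv_comm (hws z hz), ← pderiv_const (y := z) (Sum.inr 1) 0]
      exact pderiv_congr (hev.mono hw.pderiv_t) _
    have e2 := pderiv_weight_mul_zero hz.2.1 (diffAt ((hws z hz).pderiv (Sum.inr 1))) (β - 1)
    rw [e1, mul_zero, add_zero, show β - 1 - 1 = β - 2 by ring] at e2
    rw [← e2]
    refine pderiv_congr ?_ _
    filter_upwards [hev] with z hz
    rw [pderiv_weight_mul hz.2.1 (diffAt (hws z hz)) _ _ (by simp), inv_ambientMatrix a hz,
      Matrix.fromBlocks_apply₂₂, hpow1 z hz]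
    have := hz.2.1.ne'
    simp
    field_simp
  have h10 : pderiv (Sum.inr 1) (fun z => (ambientMatrix a.form φ z)⁻¹ (Sum.inr 1) (Sum.inr 0) *
      pderiv (Sum.inr 0) (fun z => z (Sum.inr 0) ^ β * w z) z) z =
      z (Sum.inr 0) ^ (β - 2) * (β * pderiv (Sum.inr 1) w z) := by
    rw [← pderiv_const_mul β (diffAt (hws z hz)), ← pderiv_weight_mul hz.2.1
      ((diffAt (hws z hz)).const_mul β) _ _ (by simp)]
    refine pderiv_congr ?_ _
    filter_upwards [hev] with z hz
    rw [pderiv_weight_mul_zero hz.2.1 (diffAt (hws z hz)), hw.pderiv_t z hz, inv_ambientMatrix a hz,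
      Matrix.fromBlocks_apply₂₂, hpow2 z hz]
    have := hz.2.1.ne'
    simp
    field_simp
  have h11 : pderiv (Sum.inr 1) (fun z => (ambientMatrix a.form φ z)⁻¹ (Sum.inr 1) (Sum.inr 1) *
      pderiv (Sum.inr 1) (fun z => z (Sum.inr 0) ^ β * w z) z) z =
      z (Sum.inr 0) ^ (β - 2) * (-2 * (pderiv (Sum.inr 1) w z +
        z (Sum.inr 1) * pderiv (Sum.inr 1) (pderiv (Sum.inr 1) w) z)) := by
    have hd := diffAt ((hws z hz).pderiv (Sum.inr 1))
    have hd' : DifferentiableAt ℝ (fun z : EuclideanSpace ℝ (AmbientIndex n) =>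
      z (Sum.inr 1) * pderiv (Sum.inr 1) w z) z := DifferentiableAt.fun_mul (by fun_prop) hd
    have e1 : pderiv (Sum.inr 1) w z + z (Sum.inr 1) * pderiv (Sum.inr 1) (pderiv (Sum.inr 1) w) z =
        pderiv (Sum.inr 1) (fun z => z (Sum.inr 1) * pderiv (Sum.inr 1) w z) z := by
      rw [pderiv_mul (by fun_prop) hd, pderiv_coord, if_pos rfl, one_mul]
    rw [e1, ← pderiv_const_mul (-2) hd', ← pderiv_weight_mul hz.2.1 (hd'.const_mul (-2)) _ _ (by simp)]
    refine pderiv_congr ?_ _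
    filter_upwards [hev] with z hz
    rw [pderiv_weight_mul hz.2.1 (diffAt (hws z hz)) _ _ (by simp), inv_ambientMatrix a hz,
      Matrix.fromBlocks_apply₂₂, hpow z hz]
    have := hz.2.1.ne'
    simp
    field_simp
  simp only [Fintype.sum_sum_type, Fin.sum_univ_two, hll, hlr, hrl, h00, h01, h10, h11, tangentialOp]
  simp only [← Finset.mul_sum, Finset.sum_const_zero, add_zero]
  ring

/-- The zeroth-order term produced by conjugating with `(det h_ρ)^{1/4}`. -/
def flowPotential (a : AmbientMetric g) (φ : OpenPartialHomeomorph M (E n))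
    (z : EuclideanSpace ℝ (AmbientIndex n)) : ℝ :=
  (tangentialOp a φ (ambientRoot a φ) z
    - 2 * z (Sum.inr 1) * pderiv (Sum.inr 1) (pderiv (Sum.inr 1) (ambientRoot a φ)) z
    + ((n : ℝ) - 2) * pderiv (Sum.inr 1) (ambientRoot a φ) z) / ambientRoot a φ z

/-- The operator `-2ρ ∂_ρ² + 2s ∂_ρ + ∂_i (h^{ij} ∂_j) - V` induced by the ambient Laplacian on
homogeneous half-densities. -/
def flowOp (a : AmbientMetric g) (φ : OpenPartialHomeomorph M (E n)) (s : ℝ)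
    (w : EuclideanSpace ℝ (AmbientIndex n) → ℝ) (z : EuclideanSpace ℝ (AmbientIndex n)) : ℝ :=
  tangentialOp a φ w z - 2 * z (Sum.inr 1) * pderiv (Sum.inr 1) (pderiv (Sum.inr 1) w) z
    + 2 * s * pderiv (Sum.inr 1) w z - flowPotential a φ z * w z

theorem isFlowFn_ambientRoot (a : AmbientMetric g) (hφ : φ ∈ atlas (E n) M) :
    IsFlowFn a φ (ambientRoot a φ) where
  smooth _ hz := contDiffAt_ambientRoot a hφ hz
  pderiv_t z hz := by
    refine pderiv_eq_zero_of_const (diffAt (contDiffAt_ambientRoot a hφ hz)) _ fun r => ?_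
    have h1 : ambientBase (z + r • EuclideanSpace.single (Sum.inr 0) 1) = ambientBase z := by
      ext i; simp
    simp [ambientRoot, ambientH, h1]

/-- On functions of degree `γ` in `t`, the ambient Laplacian conjugated by `(det h_ρ)^{1/4}` is minus
the flow operator with `s = γ + n/2 - 1`. -/
theorem localLaplacian_ambient (a : AmbientMetric g) (hφ : φ ∈ atlas (E n) M)
    (hz : z ∈ ambientDomain a φ) {w : EuclideanSpace ℝ (AmbientIndex n) → ℝ} (hw : IsFlowFn a φ w)
    (γ : ℝ) : localLaplacian (ambientMatrix a.form φ)
        (fun z => z (Sum.inr 0) ^ γ * ((ambientRoot a φ z)⁻¹ * w z)) z =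
      -(z (Sum.inr 0) ^ (γ - 2) * ((ambientRoot a φ z)⁻¹ * flowOp a φ (γ + n / 2 - 1) w z)) := by
  set θ : EuclideanSpace ℝ (AmbientIndex n) → ℝ := fun z =>
    z (Sum.inr 0) ^ (((n : ℝ) + 1) / 2) * ambientRoot a φ z with hθ
  have hθs : ∀ z ∈ ambientDomain a φ, ContDiffAt ℝ ∞ θ z ∧ 0 < θ z := fun z hz =>
    ⟨(contDiffAt_weight hz.2.1 _).mul (contDiffAt_ambientRoot a hφ hz),
      mul_pos (Real.rpow_pos_of_pos hz.2.1 _) (ambientRoot_pos a hz)⟩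
  have hψ : ContDiffAt ℝ ∞ (fun z => z (Sum.inr 0) ^ (γ + (n + 1) / 2) * w z) z :=
    (contDiffAt_weight hz.2.1 _).mul (hw.smooth z hz)
  have h := (isMetricOn_ambientMatrix a hφ).localLaplacian_halfDensity (isDensityOn_ambient a hφ)
    hθs hz hψ
  rw [sum_pderiv_ambient a hφ hz hw, sum_pderiv_ambient a hφ hz (isFlowFn_ambientRoot a hφ)] at h
  have hcongr : (fun z => z (Sum.inr 0) ^ γ * ((ambientRoot a φ z)⁻¹ * w z)) =ᶠ[𝓝 z]
      fun z => (θ z)⁻¹ * (z (Sum.inr 0) ^ (γ + ((n : ℝ) + 1) / 2) * w z) := by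
    filter_upwards [(isOpen_ambientDomain a hφ).mem_nhds hz] with z hz
    have h1 := (Real.rpow_pos_of_pos hz.2.1 (((n : ℝ) + 1) / 2)).ne'
    have h2 := (ambientRoot_pos a hz).ne'
    rw [Real.rpow_add hz.2.1]
    simp only [hθ]
    field_simp
  rw [localLaplacian_congr hcongr]
  have h1 := (hθs z hz).2.ne'
  have ht := (Real.rpow_pos_of_pos hz.2.1 (((n : ℝ) + 1) / 2)).ne'
  have hr := (ambientRoot_pos a hz).ne'
  refine mul_left_cancel₀ h1 (h.trans ?_)
  have e1 : z (Sum.inr 0) ^ (γ + ((n : ℝ) + 1) / 2 - 2) =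
      z (Sum.inr 0) ^ (((n : ℝ) + 1) / 2) * z (Sum.inr 0) ^ (γ - 2) := by
    rw [← Real.rpow_add hz.2.1]; congr 1; ring
  have e2 : z (Sum.inr 0) ^ (γ + ((n : ℝ) + 1) / 2) =
      z (Sum.inr 0) ^ (((n : ℝ) + 1) / 2) * (z (Sum.inr 0) ^ (γ - 2) * z (Sum.inr 0) ^ 2) := by
    rw [← Real.rpow_natCast, ← Real.rpow_add hz.2.1, ← Real.rpow_add hz.2.1]; congr 1; push_cast; ring
  have e3 : z (Sum.inr 0) ^ (((n : ℝ) + 1) / 2) =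
      z (Sum.inr 0) ^ (((n : ℝ) + 1) / 2 - 2) * z (Sum.inr 0) ^ 2 := by
    rw [← Real.rpow_natCast, ← Real.rpow_add hz.2.1]; congr 1; push_cast; ring
  have ht3 := (Real.rpow_pos_of_pos hz.2.1 (((n : ℝ) + 1) / 2 - 2)).ne'
  simp only [hθ, flowOp, flowPotential]
  rw [e1, e2, show 2 * (γ + ((n : ℝ) + 1) / 2) - 3 = 2 * (γ + n / 2 - 1) by ring,
    show 2 * (((n : ℝ) + 1) / 2) - 3 = n - 2 by ring, e3]
  have htt := hz.2.1.ne'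
  field_simp

end AmbientLaplacian

/-! ### Taylor coefficients at `ρ = 0` -/

section Taylor

variable {n : ℕ} {M : Type*} [TopologicalSpace M] [ChartedSpace (E n) M] [IsManifold (𝓡 n) ∞ M]
  {φ ψ : OpenPartialHomeomorph M (E n)} {g : Metric n M} {a : AmbientMetric g}
  {z : EuclideanSpace ℝ (AmbientIndex n)} {w v : EuclideanSpace ℝ (AmbientIndex n) → ℝ}

/-- The derivative `∂_ρ`. -/
abbrev pderivRho (w : EuclideanSpace ℝ (AmbientIndex n) → ℝ) :
    EuclideanSpace ℝ (AmbientIndex n) → ℝ := pderiv (Sum.inr 1) w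

/-- The `i`-th Taylor coefficient at `ρ = 0` of a function on the ambient space, restricted to
`t = 1`. -/
def taylorCoeff (i : ℕ) (w : EuclideanSpace ℝ (AmbientIndex n) → ℝ) (y : E n) : ℝ :=
  pderivRho^[i] w (ambientPoint y 1 0) / i.factorial

namespace IsFlowFn

theorem congr (hφ : φ ∈ atlas (E n) M) (hw : IsFlowFn a φ w)
    (h : Set.EqOn v w (ambientDomain a φ)) : IsFlowFn a φ v where
  smooth z hz := (hw.smooth z hz).congr_of_eventuallyEq
    (h.eventuallyEq_of_mem ((isOpen_ambientDomain a hφ).mem_nhds hz))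
  pderiv_t z hz := by
    rw [← hw.pderiv_t z hz]
    exact pderiv_congr (h.eventuallyEq_of_mem ((isOpen_ambientDomain a hφ).mem_nhds hz)) _

theorem add (hw : IsFlowFn a φ w) (hv : IsFlowFn a φ v) : IsFlowFn a φ fun z => w z + v z where
  smooth z hz := (hw.smooth z hz).add (hv.smooth z hz)
  pderiv_t z hz := by
    rw [pderiv_add (diffAt (hw.smooth z hz)) (diffAt (hv.smooth z hz)), hw.pderiv_t z hz,
      hv.pderiv_t z hz, add_zero]

theorem sub (hw : IsFlowFn a φ w) (hv : IsFlowFn a φ v) : IsFlowFn a φ fun z => w z - v z where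
  smooth z hz := (hw.smooth z hz).sub (hv.smooth z hz)
  pderiv_t z hz := by
    rw [pderiv_sub (diffAt (hw.smooth z hz)) (diffAt (hv.smooth z hz)), hw.pderiv_t z hz,
      hv.pderiv_t z hz, sub_zero]

theorem mul (hw : IsFlowFn a φ w) (hv : IsFlowFn a φ v) : IsFlowFn a φ fun z => w z * v z where
  smooth z hz := (hw.smooth z hz).mul (hv.smooth z hz)
  pderiv_t z hz := by
    rw [pderiv_mul (diffAt (hw.smooth z hz)) (diffAt (hv.smooth z hz)), hw.pderiv_t z hz,
      hv.pderiv_t z hz, zero_mul, mul_zero, add_zero]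

theorem const (c : ℝ) : IsFlowFn a φ fun _ => c where
  smooth _ _ := contDiffAt_const
  pderiv_t _ _ := pderiv_const _ _

theorem sum {κ : Type*} (s : Finset κ) {w : κ → EuclideanSpace ℝ (AmbientIndex n) → ℝ}
    (hw : ∀ j ∈ s, IsFlowFn a φ (w j)) : IsFlowFn a φ fun z => ∑ j ∈ s, w j z := by
  induction s using Finset.cons_induction with
  | empty => simpa using const 0
  | cons j s hj ih =>
    simp only [Finset.sum_cons]
    exact (hw j (Finset.mem_cons_self _ _)).add (ih fun j hj => hw j (Finset.mem_cons_of_mem hj))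

theorem inv (hw : IsFlowFn a φ w) (h0 : ∀ z ∈ ambientDomain a φ, w z ≠ 0) :
    IsFlowFn a φ fun z => (w z)⁻¹ where
  smooth z hz := (hw.smooth z hz).inv (h0 z hz)
  pderiv_t z hz := by
    rw [pderiv_comp_deriv (f := w) (hasDerivAt_inv (h0 z hz)) (diffAt (hw.smooth z hz)),
      hw.pderiv_t z hz, mul_zero]

theorem pderiv (hφ : φ ∈ atlas (E n) M) (hw : IsFlowFn a φ w) (c : AmbientIndex n) :
    IsFlowFn a φ (GJMS.pderiv c w) where
  smooth z hz := (hw.smooth z hz).pderiv c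
  pderiv_t z hz := by
    rw [pderiv_comm (hw.smooth z hz), ← pderiv_const (y := z) c 0]
    refine pderiv_congr ?_ _
    filter_upwards [(isOpen_ambientDomain a hφ).mem_nhds hz] with z hz using hw.pderiv_t z hz

theorem iterate_pderivRho (hφ : φ ∈ atlas (E n) M) (hw : IsFlowFn a φ w) (i : ℕ) :
    IsFlowFn a φ (pderivRho^[i] w) := by
  induction i generalizing w with
  | zero => exact hw
  | succ i ih => exact ih (hw.pderiv hφ _)

theorem rho : IsFlowFn a φ fun z => z (Sum.inr 1) where
  smooth _ _ := by fun_prop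
  pderiv_t _ _ := by rw [pderiv_coord, if_neg (by simp)]

theorem comp_base {F : E n → ℝ} (hF : ∀ y ∈ φ.target, ContDiffAt ℝ ∞ F y) :
    IsFlowFn a φ fun z => F (ambientBase z) where
  smooth z hz := (hF _ hz.1).comp z contDiff_ambientBase.contDiffAt
  pderiv_t z hz := by rw [pderiv_comp_ambientBase (diffAt (hF _ hz.1))]; rfl

theorem inv_ambientH (hφ : φ ∈ atlas (E n) M) (i j : Fin n) :
    IsFlowFn a φ fun z => (ambientH a φ z)⁻¹ i j where
  smooth z hz := contDiffAt_inv_ambientH a hφ hz i j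
  pderiv_t z hz := by
    refine pderiv_eq_zero_of_const (diffAt (contDiffAt_inv_ambientH a hφ hz i j)) _ fun r => ?_
    have h1 : ambientBase (z + r • EuclideanSpace.single (Sum.inr 0) 1) = ambientBase z := by
      ext i; simp
    simp [ambientH, h1]

theorem tangentialOp (hφ : φ ∈ atlas (E n) M) (hw : IsFlowFn a φ w) :
    IsFlowFn a φ (tangentialOp a φ w) :=
  sum _ fun i _ => sum _ fun j _ => ((inv_ambientH hφ i j).mul (hw.pderiv hφ _)).pderiv hφ _

theorem radialPart (hφ : φ ∈ atlas (E n) M) (hw : IsFlowFn a φ w) :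
    IsFlowFn a φ fun z => 2 * z (Sum.inr 1) * pderivRho (pderivRho w) z :=
  ((const 2).mul rho).mul ((hw.pderiv hφ _).pderiv hφ _)

theorem flowPotential (hφ : φ ∈ atlas (E n) M) : IsFlowFn a φ (flowPotential a φ) := by
  have h := isFlowFn_ambientRoot a hφ
  exact (((h.tangentialOp hφ).sub (h.radialPart hφ)).add ((const _).mul (h.pderiv hφ _))).mul
    (h.inv fun z hz => (ambientRoot_pos a hz).ne')

theorem flowOp (hφ : φ ∈ atlas (E n) M) (hw : IsFlowFn a φ w) (s : ℝ) :
    IsFlowFn a φ (flowOp a φ s w) :=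
  (((hw.tangentialOp hφ).sub (hw.radialPart hφ)).add ((const _).mul (hw.pderiv hφ _))).sub
    ((flowPotential hφ).mul hw)

end IsFlowFn

theorem iterate_pderivRho_congr (hφ : φ ∈ atlas (E n) M) (h : Set.EqOn v w (ambientDomain a φ))
    (i : ℕ) : Set.EqOn (pderivRho^[i] v) (pderivRho^[i] w) (ambientDomain a φ) := by
  induction i generalizing v w with
  | zero => exact h
  | succ i ih =>
    exact ih fun z hz => pderiv_congr
      (h.eventuallyEq_of_mem ((isOpen_ambientDomain a hφ).mem_nhds hz)) _

section Coefficients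

variable (hφ : φ ∈ atlas (E n) M) {y : E n} (hy : y ∈ φ.target)
include hφ hy

theorem taylorCoeff_congr (h : Set.EqOn v w (ambientDomain a φ)) (i : ℕ) :
    taylorCoeff i v y = taylorCoeff i w y := by
  rw [taylorCoeff, taylorCoeff, iterate_pderivRho_congr hφ h i (ambientPoint_mem a hφ hy one_pos)]

omit hφ hy in
theorem taylorCoeff_zero (w : EuclideanSpace ℝ (AmbientIndex n) → ℝ) (y : E n) :
    taylorCoeff 0 w y = w (ambientPoint y 1 0) := by simp [taylorCoeff]

omit hφ hy in
theorem taylorCoeff_pderivRho (i : ℕ) (w : EuclideanSpace ℝ (AmbientIndex n) → ℝ) (y : E n) :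
    taylorCoeff i (pderivRho w) y = (i + 1) * taylorCoeff (i + 1) w y := by
  rw [taylorCoeff, taylorCoeff, Function.iterate_succ_apply, Nat.factorial_succ]
  have := Nat.factorial_ne_zero i
  push_cast
  field_simp

theorem taylorCoeff_add (hw : IsFlowFn a φ w) (hv : IsFlowFn a φ v) (i : ℕ) :
    taylorCoeff i (fun z => w z + v z) y = taylorCoeff i w y + taylorCoeff i v y := by
  induction i generalizing w v with
  | zero => simp [taylorCoeff_zero]
  | succ i ih =>
    have h := ih (hw.pderiv hφ (Sum.inr 1)) (hv.pderiv hφ (Sum.inr 1))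
    have h2 : Set.EqOn (pderivRho fun z => w z + v z) (fun z => pderivRho w z + pderivRho v z)
        (ambientDomain a φ) := fun z hz =>
      pderiv_add (diffAt (hw.smooth z hz)) (diffAt (hv.smooth z hz)) _
    rw [← taylorCoeff_congr hφ hy h2, taylorCoeff_pderivRho, taylorCoeff_pderivRho,
      taylorCoeff_pderivRho, ← mul_add] at h
    exact mul_left_cancel₀ (by positivity) h

omit hφ hy in
theorem taylorCoeff_const (c : ℝ) (i : ℕ) :
    taylorCoeff (n := n) i (fun _ => c) y = if i = 0 then c else 0 := by
  induction i generalizing c with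
  | zero => simp [taylorCoeff_zero]
  | succ i ih =>
    have h : pderivRho (fun _ : EuclideanSpace ℝ (AmbientIndex n) => c) = fun _ => 0 :=
      funext fun z => pderiv_const _ _
    have h2 := taylorCoeff_pderivRho i (fun _ : EuclideanSpace ℝ (AmbientIndex n) => c) y
    rw [h, ih] at h2
    have h3 : ((i : ℝ) + 1) ≠ 0 := by positivity
    rw [ite_self, eq_comm, mul_eq_zero, or_iff_right h3] at h2
    simpa using h2

theorem taylorCoeff_sum {κ : Type*} (s : Finset κ) {w : κ → EuclideanSpace ℝ (AmbientIndex n) → ℝ}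
    (hw : ∀ j ∈ s, IsFlowFn a φ (w j)) (i : ℕ) :
    taylorCoeff i (fun z => ∑ j ∈ s, w j z) y = ∑ j ∈ s, taylorCoeff i (w j) y := by
  induction s using Finset.cons_induction with
  | empty => simpa using taylorCoeff_const 0 i
  | cons j s hj ih =>
    simp only [Finset.sum_cons]
    rw [taylorCoeff_add hφ hy (hw j (Finset.mem_cons_self _ _))
      (IsFlowFn.sum _ fun j hj => hw j (Finset.mem_cons_of_mem hj)),
      ih fun j hj => hw j (Finset.mem_cons_of_mem hj)]

/-- The Leibniz rule for Taylor coefficients. -/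
theorem taylorCoeff_mul (hw : IsFlowFn a φ w) (hv : IsFlowFn a φ v) (i : ℕ) :
    taylorCoeff i (fun z => w z * v z) y =
      ∑ p ∈ Finset.HasAntidiagonal.antidiagonal i, taylorCoeff p.1 w y * taylorCoeff p.2 v y := by
  induction i generalizing w v with
  | zero => simp [taylorCoeff_zero]
  | succ i ih =>
    have hw' := hw.pderiv hφ (Sum.inr 1)
    have hv' := hv.pderiv hφ (Sum.inr 1)
    have h2 : Set.EqOn (pderivRho fun z => w z * v z)
        (fun z => pderivRho w z * v z + w z * pderivRho v z) (ambientDomain a φ) := fun z hz =>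
      pderiv_mul (diffAt (hw.smooth z hz)) (diffAt (hv.smooth z hz)) _
    have h : ((i : ℝ) + 1) * taylorCoeff (i + 1) (fun z => w z * v z) y =
        ∑ p ∈ Finset.HasAntidiagonal.antidiagonal i, (p.1 + 1) * taylorCoeff (p.1 + 1) w y * taylorCoeff p.2 v y +
        ∑ p ∈ Finset.HasAntidiagonal.antidiagonal i,
          taylorCoeff p.1 w y * ((p.2 + 1) * taylorCoeff (p.2 + 1) v y) := by
      rw [← taylorCoeff_pderivRho, taylorCoeff_congr hφ hy h2,
        taylorCoeff_add hφ hy (hw'.mul hv) (hw.mul hv'), ih hw' hv, ih hw hv']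
      simp only [taylorCoeff_pderivRho]
    have e1 := Finset.Nat.sum_antidiagonal_succ (n := i)
      (f := fun p : ℕ × ℕ => (p.1 : ℝ) * taylorCoeff p.1 w y * taylorCoeff p.2 v y)
    have e2 := Finset.Nat.sum_antidiagonal_succ' (n := i)
      (f := fun p : ℕ × ℕ => taylorCoeff p.1 w y * ((p.2 : ℝ) * taylorCoeff p.2 v y))
    simp only [Nat.cast_zero, zero_mul, zero_add, mul_zero, Nat.cast_add, Nat.cast_one] at e1 e2
    rw [← e1, ← e2, ← Finset.sum_add_distrib] at h
    have h3 : ((i : ℝ) + 1) ≠ 0 := by positivity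
    refine mul_left_cancel₀ h3 (h.trans ?_)
    rw [Finset.mul_sum]
    refine Finset.sum_congr rfl fun p hp => ?_
    have hp' : (p.1 : ℝ) + p.2 = i + 1 := by exact_mod_cast Finset.HasAntidiagonal.mem_antidiagonal.1 hp
    rw [← hp']
    ring

omit hφ hy in
theorem taylorCoeff_comp_base (F : E n → ℝ) (i : ℕ) :
    taylorCoeff i (fun z => F (ambientBase z)) y = if i = 0 then F y else 0 := by
  rcases i with _ | i
  · simp [taylorCoeff_zero]
  have h : pderivRho (fun z => F (ambientBase z)) = fun _ => 0 := by
    funext z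
    by_cases hd : DifferentiableAt ℝ (fun z => F (ambientBase z)) z
    · refine pderiv_eq_zero_of_const hd _ fun r => ?_
      have h1 : ambientBase (z + r • EuclideanSpace.single (Sum.inr 1) 1) = ambientBase z := by
        ext i; simp
      rw [h1]
    · rw [pderivRho, pderiv, fderiv_zero_of_not_differentiableAt hd]; rfl
  have h2 := taylorCoeff_pderivRho i (fun z => F (ambientBase z)) y
  rw [h, taylorCoeff_const, ite_self, eq_comm, mul_eq_zero, or_iff_right (by positivity)] at h2
  simpa using h2

theorem taylorCoeff_base_mul {F : E n → ℝ} (hF : ∀ y ∈ φ.target, ContDiffAt ℝ ∞ F y)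
    (hw : IsFlowFn a φ w) (i : ℕ) :
    taylorCoeff i (fun z => F (ambientBase z) * w z) y = F y * taylorCoeff i w y := by
  rw [taylorCoeff_mul hφ hy (IsFlowFn.comp_base hF) hw, Finset.sum_eq_single (0, i)]
  · simp only [taylorCoeff_comp_base F, if_true]
  · rintro ⟨p, q⟩ hp hne
    have : p ≠ 0 := fun h => hne (by
      have := Finset.HasAntidiagonal.mem_antidiagonal.1 hp
      simp only [Prod.mk.injEq]; omega)
    simp only [taylorCoeff_comp_base F, if_neg this, zero_mul]
  · intro h; simp at h

theorem taylorCoeff_const_mul (c : ℝ) (hw : IsFlowFn a φ w) (i : ℕ) :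
    taylorCoeff i (fun z => c * w z) y = c * taylorCoeff i w y :=
  taylorCoeff_base_mul hφ hy (F := fun _ => c) (fun _ _ => contDiffAt_const) hw i

theorem taylorCoeff_sub (hw : IsFlowFn a φ w) (hv : IsFlowFn a φ v) (i : ℕ) :
    taylorCoeff i (fun z => w z - v z) y = taylorCoeff i w y - taylorCoeff i v y := by
  have h := taylorCoeff_add hφ hy hw ((IsFlowFn.const (-1)).mul hv) i
  rw [taylorCoeff_const_mul hφ hy (-1) hv] at h
  simpa [sub_eq_add_neg] using h

theorem taylorCoeff_rho_mul (hw : IsFlowFn a φ w) (i : ℕ) :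
    taylorCoeff i (fun z => z (Sum.inr 1) * pderivRho (pderivRho w) z) y =
      i * ((i + 1) * taylorCoeff (i + 1) w y) := by
  have h1 : ∀ j, taylorCoeff j (fun z : EuclideanSpace ℝ (AmbientIndex n) => z (Sum.inr 1)) y =
      if j = 1 then 1 else 0 := by
    rintro (_ | j)
    · simp [taylorCoeff_zero]
    have h : pderivRho (fun z : EuclideanSpace ℝ (AmbientIndex n) => z (Sum.inr 1)) = fun _ => 1 :=
      funext fun z => by rw [pderivRho, pderiv_coord, if_pos rfl]
    have h2 := taylorCoeff_pderivRho j (fun z : EuclideanSpace ℝ (AmbientIndex n) => z (Sum.inr 1)) y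
    rw [h, taylorCoeff_const] at h2
    have h3 : ((j : ℝ) + 1) ≠ 0 := by positivity
    rcases j with _ | j
    · simpa using h2.symm
    · rw [if_neg (by omega), eq_comm, mul_eq_zero, or_iff_right h3] at h2
      simpa using h2
  rw [taylorCoeff_mul hφ hy IsFlowFn.rho ((hw.pderiv hφ _).pderiv hφ _)]
  rcases i with _ | i
  · simp [h1]
  rw [Finset.sum_eq_single (1, i)]
  · simp only [h1, if_true, one_mul, taylorCoeff_pderivRho]
    push_cast
    ring
  · rintro ⟨p, q⟩ hp hne
    have : p ≠ 1 := fun h => hne (by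
      have := Finset.HasAntidiagonal.mem_antidiagonal.1 hp
      simp only [Prod.mk.injEq]; omega)
    simp only [h1, if_neg this, zero_mul]
  · intro h; exact absurd (Finset.HasAntidiagonal.mem_antidiagonal.2 (by simp; omega)) h

omit hφ hy in
theorem contDiff_ambientPoint_left (t ρ : ℝ) : ContDiff ℝ ∞ fun y : E n => ambientPoint y t ρ :=
  contDiff_ambientPoint.comp (f := fun y : E n => (y, t, ρ)) (by fun_prop)

omit hy in
theorem contDiffAt_taylorCoeff (hw : IsFlowFn a φ w) (i : ℕ) :
    ∀ y ∈ φ.target, ContDiffAt ℝ ∞ (taylorCoeff i w) y := by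
  intro y hy
  exact (((hw.iterate_pderivRho hφ i).smooth _ (ambientPoint_mem a hφ hy one_pos)).comp y
    (contDiff_ambientPoint_left 1 0).contDiffAt).div_const _

theorem taylorCoeff_pderiv_inl (hw : IsFlowFn a φ w) (j : Fin n) (i : ℕ) :
    taylorCoeff i (pderiv (Sum.inl j) w) y = pderiv j (taylorCoeff i w) y := by
  have h1 : Set.EqOn (pderivRho^[i] (pderiv (Sum.inl j) w)) (pderiv (Sum.inl j) (pderivRho^[i] w))
      (ambientDomain a φ) := by
    induction i with
    | zero => exact fun _ _ => rfl
    | succ i ih =>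
      intro z hz
      rw [Function.iterate_succ_apply', Function.iterate_succ_apply', pderivRho,
        pderiv_congr (ih.eventuallyEq_of_mem ((isOpen_ambientDomain a hφ).mem_nhds hz)),
        pderiv_comm ((hw.iterate_pderivRho hφ i).smooth z hz)]
  have hm := ambientPoint_mem a hφ hy one_pos
  have hd := diffAt ((hw.iterate_pderivRho hφ i).smooth _ hm)
  have h2 : taylorCoeff i w = fun y => ((i.factorial : ℝ)⁻¹) * pderivRho^[i] w (ambientPoint y 1 0) :=
    funext fun y => by rw [taylorCoeff, div_eq_inv_mul]
  have hp := (contDiff_ambientPoint_left (n := n) 1 0).differentiable (by simp) y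
  rw [h2, pderiv_const_mul (f := fun y => pderivRho^[i] w (ambientPoint y 1 0)) _ (hd.comp y hp), taylorCoeff, h1 hm, div_eq_inv_mul,
    pderiv_comp hd hp]
  simp [Fintype.sum_sum_type, Fin.sum_univ_two, pderiv_coord, pderiv_const]

end Coefficients

end Taylor

/-! ### The flow of half-densities and its coefficient operators -/

section Flow

variable {n : ℕ} {M : Type*} [TopologicalSpace M] [ChartedSpace (E n) M] [IsManifold (𝓡 n) ∞ M]
  {φ ψ : OpenPartialHomeomorph M (E n)} {g : Metric n M} {a : AmbientMetric g}
  {z : EuclideanSpace ℝ (AmbientIndex n)} {w v : EuclideanSpace ℝ (AmbientIndex n) → ℝ}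

/-- The half-density `(det g)^{1/4}` in the chart `φ`. -/
def rootDensity (g : Metric n M) (φ : OpenPartialHomeomorph M (E n)) (y : E n) : ℝ :=
  √(volDensity g φ y)

theorem rootDensity_pos (hφ : φ ∈ atlas (E n) M) {y : E n} (hy : y ∈ φ.target) :
    0 < rootDensity g φ y := Real.sqrt_pos.2 (volDensity_pos hφ hy)

theorem rootDensity_sq (hφ : φ ∈ atlas (E n) M) {y : E n} (hy : y ∈ φ.target) :
    rootDensity g φ y ^ 2 = volDensity g φ y := Real.sq_sqrt (volDensity_pos hφ hy).le

theorem contDiffAt_rootDensity (a : AmbientMetric g) (hφ : φ ∈ atlas (E n) M) {y : E n}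
    (hy : y ∈ φ.target) : ContDiffAt ℝ ∞ (rootDensity g φ) y :=
  (contDiffAt_volDensity a hφ hy).sqrt (volDensity_pos hφ hy).ne'

/-- The function `(det h_ρ / det g)^{1/4}`, which does not depend on the chart. -/
def relRoot (a : AmbientMetric g) (φ : OpenPartialHomeomorph M (E n))
    (z : EuclideanSpace ℝ (AmbientIndex n)) : ℝ :=
  ambientRoot a φ z / rootDensity g φ (ambientBase z)

theorem relRoot_pos (hφ : φ ∈ atlas (E n) M) (hz : z ∈ ambientDomain a φ) : 0 < relRoot a φ z :=
  div_pos (ambientRoot_pos a hz) (rootDensity_pos hφ hz.1)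

theorem relRoot_ambientPoint (hφ : φ ∈ atlas (E n) M) {y : E n} (hy : y ∈ φ.target) (t : ℝ) :
    relRoot a φ (ambientPoint y t 0) = 1 := by
  rw [relRoot, ambientRoot, ambientH_zero, ambientBase_ambientPoint]
  exact div_self (rootDensity_pos hφ hy).ne'

/-- The `p`-th coefficient `∂_i (h_p^{ij} ∂_j ψ) - V_p ψ`, where `h_p^{ij}` and `V_p` are the Taylor
coefficients at `ρ = 0` of the inverse of `h_ρ` and of the potential. -/
def densityCoeffOp (a : AmbientMetric g) (φ : OpenPartialHomeomorph M (E n)) (p : ℕ)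
    (ψ : E n → ℝ) (y : E n) : ℝ :=
  ∑ i, ∑ j, pderiv i (fun y => taylorCoeff p (fun z => (ambientH a φ z)⁻¹ i j) y * pderiv j ψ y) y
    - taylorCoeff p (flowPotential a φ) y * ψ y

theorem taylorCoeff_flowOp (hφ : φ ∈ atlas (E n) M) {y : E n} (hy : y ∈ φ.target)
    (hw : IsFlowFn a φ w) (s : ℝ) (i : ℕ) : taylorCoeff i (flowOp a φ s w) y =
      2 * (i + 1) * (s - i) * taylorCoeff (i + 1) w y +
        ∑ p ∈ Finset.HasAntidiagonal.antidiagonal i,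
          densityCoeffOp a φ p.1 (taylorCoeff p.2 w) y := by
  have hT : taylorCoeff i (tangentialOp a φ w) y = ∑ p ∈ Finset.HasAntidiagonal.antidiagonal i,
      ∑ b, ∑ c, pderiv b (fun y => taylorCoeff p.1 (fun z => (ambientH a φ z)⁻¹ b c) y *
        pderiv c (taylorCoeff p.2 w) y) y := by
    have h1 : ∀ b c, IsFlowFn a φ fun z => (ambientH a φ z)⁻¹ b c * pderiv (Sum.inl c) w z :=
      fun b c => (IsFlowFn.inv_ambientH hφ b c).mul (hw.pderiv hφ _)
    have h2 : ∀ b c, taylorCoeff i (pderiv (Sum.inl b) fun z =>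
        (ambientH a φ z)⁻¹ b c * pderiv (Sum.inl c) w z) y =
        ∑ p ∈ Finset.HasAntidiagonal.antidiagonal i,
          pderiv b (fun y => taylorCoeff p.1 (fun z => (ambientH a φ z)⁻¹ b c) y *
            pderiv c (taylorCoeff p.2 w) y) y := by
      intro b c
      rw [taylorCoeff_pderiv_inl hφ hy (h1 b c), ← pderiv_sum]
      · refine pderiv_congr ?_ _
        filter_upwards [φ.open_target.mem_nhds hy] with y hy
        rw [taylorCoeff_mul hφ hy (IsFlowFn.inv_ambientH hφ b c) (hw.pderiv hφ _)]
        simp only [taylorCoeff_pderiv_inl hφ hy hw]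
      · intro p _
        exact diffAt ((contDiffAt_taylorCoeff hφ (IsFlowFn.inv_ambientH hφ b c) _ y hy).mul
          ((contDiffAt_taylorCoeff hφ hw _ y hy).pderiv _))
    calc taylorCoeff i (tangentialOp a φ w) y
        = ∑ b, ∑ c, taylorCoeff i (pderiv (Sum.inl b) fun z =>
          (ambientH a φ z)⁻¹ b c * pderiv (Sum.inl c) w z) y := by
          rw [← Finset.sum_congr rfl fun b _ => taylorCoeff_sum hφ hy Finset.univ
            (fun c _ => (h1 b c).pderiv hφ _) i]
          exact taylorCoeff_sum hφ hy Finset.univ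
            (fun b _ => IsFlowFn.sum _ fun c _ => (h1 b c).pderiv hφ _) i
      _ = _ := by
          simp only [h2]
          rw [Finset.sum_congr rfl fun b _ => Finset.sum_comm, Finset.sum_comm]
  have hA := hw.tangentialOp hφ
  have hR := hw.radialPart hφ
  have hD := (IsFlowFn.const (2 * s)).mul (hw.pderiv hφ (Sum.inr 1))
  have hV := (IsFlowFn.flowPotential (a := a) hφ).mul hw
  have e : taylorCoeff i (flowOp a φ s w) y = taylorCoeff i (tangentialOp a φ w) y
      - 2 * (i * ((i + 1) * taylorCoeff (i + 1) w y))
      + 2 * s * ((i + 1) * taylorCoeff (i + 1) w y)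
      - ∑ p ∈ Finset.HasAntidiagonal.antidiagonal i,
        taylorCoeff p.1 (flowPotential a φ) y * taylorCoeff p.2 w y := by
    rw [← taylorCoeff_pderivRho, ← taylorCoeff_const_mul hφ hy (2 * s) (hw.pderiv hφ _),
      ← taylorCoeff_mul hφ hy (IsFlowFn.flowPotential hφ) hw, taylorCoeff_pderivRho,
      ← taylorCoeff_rho_mul hφ hy hw,
      ← taylorCoeff_const_mul hφ hy 2 (IsFlowFn.rho.mul ((hw.pderiv hφ _).pderiv hφ _)),
      ← taylorCoeff_sub hφ hy hA ((IsFlowFn.const 2).mul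
        (IsFlowFn.rho.mul ((hw.pderiv hφ _).pderiv hφ _))),
      ← taylorCoeff_add hφ hy (hA.sub ((IsFlowFn.const 2).mul
        (IsFlowFn.rho.mul ((hw.pderiv hφ _).pderiv hφ _)))) hD,
      ← taylorCoeff_sub hφ hy ((hA.sub ((IsFlowFn.const 2).mul
        (IsFlowFn.rho.mul ((hw.pderiv hφ _).pderiv hφ _)))).add hD) hV]
    congr 1
    funext z
    simp only [flowOp]
    ring
  rw [e, hT]
  simp only [densityCoeffOp, Finset.sum_sub_distrib]
  ring

/-- The ambient Laplacian on functions of degree `γ` in `t`, conjugated by `(det h_ρ / det g)^{1/4}`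
and by powers of `t`. -/
def flow (a : AmbientMetric g) (φ : OpenPartialHomeomorph M (E n)) (γ : ℝ)
    (w : EuclideanSpace ℝ (AmbientIndex n) → ℝ) (z : EuclideanSpace ℝ (AmbientIndex n)) : ℝ :=
  -(z (Sum.inr 0) ^ (2 - γ) * (relRoot a φ z * localLaplacian (ambientMatrix a.form φ)
    (fun z => z (Sum.inr 0) ^ γ * ((relRoot a φ z)⁻¹ * w z)) z))

theorem localLaplacian_eq_flow (hφ : φ ∈ atlas (E n) M) (γ : ℝ) (hz : z ∈ ambientDomain a φ) :
    localLaplacian (ambientMatrix a.form φ)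
        (fun z => z (Sum.inr 0) ^ γ * ((relRoot a φ z)⁻¹ * w z)) z =
      -(z (Sum.inr 0) ^ (γ - 2) * ((relRoot a φ z)⁻¹ * flow a φ γ w z)) := by
  have h1 := (relRoot_pos hφ hz).ne'
  have h2 : z (Sum.inr 0) ^ (γ - 2) * z (Sum.inr 0) ^ (2 - γ) = 1 := by
    rw [← Real.rpow_add hz.2.1]; simp
  rw [flow]
  generalize localLaplacian (ambientMatrix a.form φ)
    (fun z => z (Sum.inr 0) ^ γ * ((relRoot a φ z)⁻¹ * w z)) z = L
  field_simp
  linear_combination (-L) * h2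

theorem IsFlowFn.rootDensity_mul (hφ : φ ∈ atlas (E n) M) (hw : IsFlowFn a φ w) :
    IsFlowFn a φ fun z => rootDensity g φ (ambientBase z) * w z :=
  (IsFlowFn.comp_base fun _ hy => contDiffAt_rootDensity a hφ hy).mul hw

theorem flow_eq (hφ : φ ∈ atlas (E n) M) (hw : IsFlowFn a φ w) (γ : ℝ) :
    Set.EqOn (flow a φ γ w) (fun z => (rootDensity g φ (ambientBase z))⁻¹ *
      flowOp a φ (γ + n / 2 - 1) (fun z => rootDensity g φ (ambientBase z) * w z) z)
      (ambientDomain a φ) := by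
  intro z hz
  have h0 := localLaplacian_ambient a hφ hz (hw.rootDensity_mul hφ) γ
  have hcongr : (fun z => z (Sum.inr 0) ^ γ * ((relRoot a φ z)⁻¹ * w z)) =ᶠ[𝓝 z] fun z =>
      z (Sum.inr 0) ^ γ * ((ambientRoot a φ z)⁻¹ * (rootDensity g φ (ambientBase z) * w z)) := by
    filter_upwards [(isOpen_ambientDomain a hφ).mem_nhds hz] with z hz
    rw [relRoot, inv_div]
    ring
  have h1 := (rootDensity_pos (g := g) hφ hz.1).ne'
  have h3 := (ambientRoot_pos a hz).ne'
  have h2 : z (Sum.inr 0) ^ (γ - 2) * z (Sum.inr 0) ^ (2 - γ) = 1 := by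
    rw [← Real.rpow_add hz.2.1]; simp
  rw [flow, localLaplacian_congr hcongr, h0, relRoot]
  beta_reduce
  generalize flowOp a φ (γ + n / 2 - 1)
    (fun z => rootDensity g φ (ambientBase z) * w z) z = L
  field_simp
  linear_combination L * h2

theorem IsFlowFn.flow (hφ : φ ∈ atlas (E n) M) (hw : IsFlowFn a φ w) (γ : ℝ) :
    IsFlowFn a φ (flow a φ γ w) :=
  IsFlowFn.congr hφ ((IsFlowFn.comp_base (F := fun y => (rootDensity g φ y)⁻¹) fun _ hy =>
    (contDiffAt_rootDensity a hφ hy).inv (rootDensity_pos hφ hy).ne').mul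
      ((hw.rootDensity_mul hφ).flowOp hφ _)) (flow_eq hφ hw γ)

/-- The operator `densityCoeffOp` transplanted from half-densities to functions. -/
def coeffOp (a : AmbientMetric g) (φ : OpenPartialHomeomorph M (E n)) (p : ℕ)
    (f : E n → ℝ) (y : E n) : ℝ :=
  (rootDensity g φ y)⁻¹ * densityCoeffOp a φ p (fun y => rootDensity g φ y * f y) y

theorem densityCoeffOp_congr {f h : E n → ℝ} {y : E n} (hfh : f =ᶠ[𝓝 y] h) (p : ℕ) :
    densityCoeffOp a φ p f y = densityCoeffOp a φ p h y := by
  have h1 : ∀ j, pderiv j f =ᶠ[𝓝 y] pderiv j h := fun j => pderiv_eventuallyEq hfh j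
  rw [densityCoeffOp, densityCoeffOp, hfh.eq_of_nhds]
  congr 1
  refine Finset.sum_congr rfl fun i _ => Finset.sum_congr rfl fun j _ => pderiv_congr ?_ _
  filter_upwards [h1 j] with z hz
  rw [hz]

theorem coeffOp_congr {f h : E n → ℝ} {y : E n} (hfh : f =ᶠ[𝓝 y] h) (p : ℕ) :
    coeffOp a φ p f y = coeffOp a φ p h y := by
  rw [coeffOp, coeffOp, densityCoeffOp_congr]
  filter_upwards [hfh] with z hz
  rw [hz]

theorem taylorCoeff_flow (hφ : φ ∈ atlas (E n) M) {y : E n} (hy : y ∈ φ.target)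
    (hw : IsFlowFn a φ w) (γ : ℝ) (i : ℕ) : taylorCoeff i (flow a φ γ w) y =
      2 * (i + 1) * (γ + n / 2 - 1 - i) * taylorCoeff (i + 1) w y +
        ∑ p ∈ Finset.HasAntidiagonal.antidiagonal i, coeffOp a φ p.1 (taylorCoeff p.2 w) y := by
  have hθ : ∀ y ∈ φ.target, ContDiffAt ℝ ∞ (rootDensity g φ) y := fun _ hy =>
    contDiffAt_rootDensity a hφ hy
  rw [taylorCoeff_congr hφ hy (flow_eq hφ hw γ), taylorCoeff_base_mul hφ hy
    (F := fun y => (rootDensity g φ y)⁻¹) (fun _ hy => (hθ _ hy).inv (rootDensity_pos hφ hy).ne')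
    ((hw.rootDensity_mul hφ).flowOp hφ _), taylorCoeff_flowOp hφ hy (hw.rootDensity_mul hφ),
    taylorCoeff_base_mul hφ hy hθ hw, mul_add, Finset.mul_sum]
  congr 1
  · have h1 := (rootDensity_pos (g := g) hφ hy).ne'
    field_simp
  · refine Finset.sum_congr rfl fun p _ => ?_
    rw [coeffOp]
    congr 1
    refine densityCoeffOp_congr ?_ _
    filter_upwards [φ.open_target.mem_nhds hy] with z hz
    exact taylorCoeff_base_mul hφ hz hθ hw _

theorem taylorCoeff_flow_base (hφ : φ ∈ atlas (E n) M) {y : E n} (hy : y ∈ φ.target)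
    {f : E n → ℝ} (hf : ∀ y ∈ φ.target, ContDiffAt ℝ ∞ f y) (γ : ℝ) (p : ℕ) :
    taylorCoeff p (flow a φ γ fun z => f (ambientBase z)) y = coeffOp a φ p f y := by
  rw [taylorCoeff_flow hφ hy (IsFlowFn.comp_base hf), taylorCoeff_comp_base, if_neg (by omega),
    mul_zero, zero_add, Finset.sum_eq_single (p, 0)]
  · congr 1
    funext y
    simp [taylorCoeff_zero]
  · rintro ⟨i, j⟩ hp hne
    have hj : j ≠ 0 := fun h => hne (by
      have := Finset.HasAntidiagonal.mem_antidiagonal.1 hp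
      simp only [Prod.mk.injEq]; omega)
    have h0 : taylorCoeff j (fun z : EuclideanSpace ℝ (AmbientIndex n) => f (ambientBase z)) =
        fun _ => 0 := by
      funext y
      rw [taylorCoeff_comp_base, if_neg hj]
    simp [h0, coeffOp, densityCoeffOp]
  · intro h; simp at h

end Flow

/-! ### Invariance under changes of charts -/

section Transition

variable {n : ℕ} {M : Type*} [TopologicalSpace M] [ChartedSpace (E n) M] [IsManifold (𝓡 n) ∞ M]
  {φ ψ : OpenPartialHomeomorph M (E n)} {g : Metric n M} {a : AmbientMetric g}
  {z : EuclideanSpace ℝ (AmbientIndex n)}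

/-- The coordinate change of the ambient space induced by a coordinate change of `M`. -/
def ambientTransition (φ ψ : OpenPartialHomeomorph M (E n)) (z : EuclideanSpace ℝ (AmbientIndex n)) :
    EuclideanSpace ℝ (AmbientIndex n) :=
  ambientPoint (φ (ψ.symm (ambientBase z))) (z (Sum.inr 0)) (z (Sum.inr 1))

/-- The part of the ambient domain of `ψ` that lies over the domain of `φ`. -/
def ambientOverlap (a : AmbientMetric g) (φ ψ : OpenPartialHomeomorph M (E n)) :
    Set (EuclideanSpace ℝ (AmbientIndex n)) :=
  {z | z ∈ ambientDomain a ψ ∧ ambientBase z ∈ overlap φ ψ}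

theorem isOpen_ambientOverlap (hψ : ψ ∈ atlas (E n) M) : IsOpen (ambientOverlap a φ ψ) :=
  (isOpen_ambientDomain a hψ).inter
    ((isOpen_overlap φ ψ).preimage contDiff_ambientBase.continuous)

/-- The Jacobian matrix of the change of coordinates. -/
def jacMatrix (φ ψ : OpenPartialHomeomorph M (E n)) (y : E n) : Matrix (Fin n) (Fin n) ℝ :=
  Matrix.of fun b i => jac (fun z => φ (ψ.symm z)) b i y

theorem det_formMatrix_transition
    (b : (x : M) → TangentSpace (𝓡 n) x →L[ℝ] TangentSpace (𝓡 n) x →L[ℝ] ℝ)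
    (hφ : φ ∈ atlas (E n) M) (hψ : ψ ∈ atlas (E n) M) {y : E n} (hy : y ∈ overlap φ ψ) :
    (formMatrix b ψ y).det =
      (jacMatrix φ ψ y).det ^ 2 * (formMatrix b φ (φ (ψ.symm y))).det := by
  have h : formMatrix b ψ y =
      (jacMatrix φ ψ y).transpose * formMatrix b φ (φ (ψ.symm y)) * jacMatrix φ ψ y := by
    ext i j
    rw [formMatrix_transition b hφ hψ hy]
    simp only [Matrix.mul_apply, Matrix.transpose_apply, Finset.sum_mul, jacMatrix, Matrix.of_apply]
    rw [Finset.sum_comm]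
    exact Finset.sum_congr rfl fun c _ => Finset.sum_congr rfl fun d _ => by ring
  rw [h, Matrix.det_mul, Matrix.det_mul, Matrix.det_transpose]
  ring

theorem det_ambientH_transition (a : AmbientMetric g) (hφ : φ ∈ atlas (E n) M)
    (hψ : ψ ∈ atlas (E n) M) (hz : ambientBase z ∈ overlap φ ψ) : (ambientH a ψ z).det =
      (jacMatrix φ ψ (ambientBase z)).det ^ 2 * (ambientH a φ (ambientTransition φ ψ z)).det :=
  det_formMatrix_transition _ hφ hψ hz

theorem jacMatrix_det_ne (a : AmbientMetric g) (hφ : φ ∈ atlas (E n) M) (hψ : ψ ∈ atlas (E n) M)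
    (hz : z ∈ ambientOverlap a φ ψ) : (jacMatrix φ ψ (ambientBase z)).det ≠ 0 := fun h => by
  have h1 := hz.1.2.2
  rw [det_ambientH_transition a hφ hψ hz.2, h] at h1
  simp at h1

theorem ambientTransition_mem (hφ : φ ∈ atlas (E n) M) (hψ : ψ ∈ atlas (E n) M)
    (hz : z ∈ ambientOverlap a φ ψ) : ambientTransition φ ψ z ∈ ambientDomain a φ := by
  refine ⟨φ.map_source hz.2.2, hz.1.2.1, ?_⟩
  have h1 := hz.1.2.2
  rw [det_ambientH_transition a hφ hψ hz.2] at h1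
  exact pos_of_mul_pos_right h1 (sq_nonneg _)

theorem relRoot_transition (hφ : φ ∈ atlas (E n) M) (hψ : ψ ∈ atlas (E n) M)
    (hz : z ∈ ambientOverlap a φ ψ) : relRoot a ψ z = relRoot a φ (ambientTransition φ ψ z) := by
  have h1 : ambientRoot a ψ z =
      √ |(jacMatrix φ ψ (ambientBase z)).det| * ambientRoot a φ (ambientTransition φ ψ z) := by
    rw [ambientRoot, det_ambientH_transition a hφ hψ hz.2, Real.sqrt_mul (sq_nonneg _),
      Real.sqrt_sq_eq_abs, Real.sqrt_mul (abs_nonneg _)]; rfl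
  have h2 : rootDensity g ψ (ambientBase z) = √ |(jacMatrix φ ψ (ambientBase z)).det| *
      rootDensity g φ (ambientBase (ambientTransition φ ψ z)) := by
    have h := det_formMatrix_transition g.inner hφ hψ hz.2
    rw [rootDensity, volDensity, coords, h, Real.sqrt_mul (sq_nonneg _),
      Real.sqrt_sq_eq_abs, Real.sqrt_mul (abs_nonneg _)]; rfl
  rw [relRoot, relRoot, h1, h2, mul_div_mul_left]
  exact (Real.sqrt_pos.2 (abs_pos.2 (jacMatrix_det_ne a hφ hψ hz))).ne'

theorem contDiffAt_ambientTransition (hφ : φ ∈ atlas (E n) M) (hψ : ψ ∈ atlas (E n) M)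
    (hz : ambientBase z ∈ overlap φ ψ) : ContDiffAt ℝ ∞ (ambientTransition φ ψ) z := by
  have h := (contDiffAt_transition hφ hψ hz).comp z contDiff_ambientBase.contDiffAt
  exact contDiff_ambientPoint.contDiffAt.comp z
    (f := fun z => (φ (ψ.symm (ambientBase z)), z (Sum.inr 0), z (Sum.inr 1)))
    (h.prodMk (ContDiffAt.prodMk (by fun_prop) (by fun_prop)))

theorem pderiv_ambientTransition (hφ : φ ∈ atlas (E n) M) (hψ : ψ ∈ atlas (E n) M)
    (hz : ambientBase z ∈ overlap φ ψ) (c e : AmbientIndex n) :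
    pderiv e (fun z => ambientTransition φ ψ z c) z =
      Matrix.fromBlocks (jacMatrix φ ψ (ambientBase z)) 0 0 1 c e := by
  have hd := (contDiffAt_transition hφ hψ hz)
  rcases c with i | i
  · have h1 : DifferentiableAt ℝ (fun y => φ (ψ.symm y) i) (ambientBase z) :=
      diffAt (by rw [contDiffAt_euclidean] at hd; exact hd i)
    have h2 := pderiv_comp_ambientBase h1 e
    refine h2.trans ?_
    rcases e with j | j <;> simp [jacMatrix, jac]
  · have h2 : (fun z => ambientTransition φ ψ z (Sum.inr i)) = fun z => z (Sum.inr i) := by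
      funext z; fin_cases i <;> rfl
    rw [h2, pderiv_coord]
    rcases e with j | j <;> simp [Matrix.one_apply]

/-- A change of charts of `M` leaves `t` and `ρ` fixed and pulls back the ambient metric. -/
theorem isCoordChange_ambient (a : AmbientMetric g) (hφ : φ ∈ atlas (E n) M)
    (hψ : ψ ∈ atlas (E n) M) : IsCoordChange (ambientMatrix a.form φ) (ambientMatrix a.form ψ)
      (ambientDomain a φ) (ambientOverlap a φ ψ) (ambientTransition φ ψ) where
  metric := isMetricOn_ambientMatrix a hφ
  metric' :=
    { isOpen := isOpen_ambientOverlap hψ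
      smooth := fun _ hz => (isMetricOn_ambientMatrix a hψ).smooth _ hz.1
      symm := fun _ hz => (isMetricOn_ambientMatrix a hψ).symm _ hz.1
      det_ne := fun _ hz => (isMetricOn_ambientMatrix a hψ).det_ne _ hz.1 }
  mapsTo _ hz := ambientTransition_mem hφ hψ hz
  smooth _ hz := contDiffAt_ambientTransition hφ hψ hz.2
  pull z hz c e := by
    simp only [jac, pderiv_ambientTransition hφ hψ hz.2, ambientMatrix_eq, Fintype.sum_sum_type]
    have hH := fun i j => formMatrix_transition (a.form (z (Sum.inr 1))) hφ hψ hz.2 i j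
    rcases c with i | i <;> rcases e with j | j
    · simp only [Matrix.fromBlocks_apply₁₁, Matrix.fromBlocks_apply₁₂, Matrix.fromBlocks_apply₂₁,
        Matrix.fromBlocks_apply₂₂, Matrix.zero_apply, zero_mul, mul_zero, Finset.sum_const_zero,
        add_zero, Matrix.smul_apply, smul_eq_mul, ambientH]
      rw [hH, Finset.mul_sum]
      refine Finset.sum_congr rfl fun b _ => ?_
      rw [Finset.mul_sum]
      refine Finset.sum_congr rfl fun c _ => ?_
      simp only [jacMatrix, Matrix.of_apply, ambientTransition, ambientPoint_inr_zero,
        ambientPoint_inr_one, ambientBase_ambientPoint]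
      ring
    · simp
    · simp
    · simp [Matrix.one_apply, ambientTransition]

/-- A family of functions, one for each chart, that represents a smooth function on a neighbourhood
of `ρ = 0` in the ambient space, independent of `t`. -/
structure IsAmbientFn (a : AmbientMetric g)
    (F : OpenPartialHomeomorph M (E n) → EuclideanSpace ℝ (AmbientIndex n) → ℝ) : Prop where
  isFlowFn : ∀ φ ∈ atlas (E n) M, IsFlowFn a φ (F φ)
  compat : ∀ φ ∈ atlas (E n) M, ∀ ψ ∈ atlas (E n) M, ∀ z ∈ ambientOverlap a φ ψ,
    F ψ z = F φ (ambientTransition φ ψ z)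

namespace IsAmbientFn

variable {F H : OpenPartialHomeomorph M (E n) → EuclideanSpace ℝ (AmbientIndex n) → ℝ}

theorem base (u : SmoothFn n M) : IsAmbientFn a fun φ z => (u ∘ φ.symm) (ambientBase z) where
  isFlowFn _ hφ := IsFlowFn.comp_base fun _ hy => u.contDiffAt hφ hy
  compat _ _ _ _ _ hz := comp_symm_transition u _ hz.2

theorem mul (hF : IsAmbientFn a F) (hH : IsAmbientFn a H) : IsAmbientFn a fun φ z => F φ z * H φ z where
  isFlowFn φ hφ := (hF.isFlowFn φ hφ).mul (hH.isFlowFn φ hφ)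
  compat φ hφ ψ hψ z hz := by rw [hF.compat φ hφ ψ hψ z hz, hH.compat φ hφ ψ hψ z hz]

theorem relRoot : IsAmbientFn a (relRoot a) where
  isFlowFn _ hφ := (isFlowFn_ambientRoot a hφ).mul
    (IsFlowFn.comp_base (F := fun y => (rootDensity g _ y)⁻¹) fun _ hy =>
      (contDiffAt_rootDensity a hφ hy).inv (rootDensity_pos hφ hy).ne')
  compat _ hφ _ hψ _ hz := relRoot_transition hφ hψ hz

theorem flow (hF : IsAmbientFn a F) (γ : ℝ) : IsAmbientFn a fun φ => flow a φ γ (F φ) where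
  isFlowFn _ hφ := (hF.isFlowFn _ hφ).flow hφ γ
  compat φ hφ ψ hψ z hz := by
    have hs : ∀ z ∈ ambientDomain a φ, ContDiffAt ℝ ∞
        (fun z => z (Sum.inr 0) ^ γ * ((GJMS.relRoot a φ z)⁻¹ * F φ z)) z := fun z hz =>
      (contDiffAt_weight hz.2.1 γ).mul ((((relRoot (a := a)).isFlowFn φ hφ).smooth z hz).inv
        (relRoot_pos hφ hz).ne' |>.mul ((hF.isFlowFn φ hφ).smooth z hz))
    have h := (isCoordChange_ambient a hφ hψ).localLaplacian_comp hs z hz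
    rw [GJMS.flow, GJMS.flow, ← h, relRoot_transition hφ hψ hz]
    have hc : (fun z : EuclideanSpace ℝ (AmbientIndex n) =>
        z (Sum.inr 0) ^ γ * ((GJMS.relRoot a ψ z)⁻¹ * F ψ z)) =ᶠ[𝓝 z]
        fun z => ambientTransition φ ψ z (Sum.inr 0) ^ γ *
          ((GJMS.relRoot a φ (ambientTransition φ ψ z))⁻¹ * F φ (ambientTransition φ ψ z)) := by
      filter_upwards [(isOpen_ambientOverlap hψ).mem_nhds hz] with z hz
      rw [relRoot_transition hφ hψ hz, hF.compat φ hφ ψ hψ z hz]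
      rfl
    rw [localLaplacian_congr hc]
    rfl

/-- Taylor coefficients at `ρ = 0` are invariant under changes of charts. -/
theorem taylorCoeff_transition (hF : IsAmbientFn a F) (hφ : φ ∈ atlas (E n) M)
    (hψ : ψ ∈ atlas (E n) M) {y : E n} (hy : y ∈ overlap φ ψ) (i : ℕ) :
    taylorCoeff i (F ψ) y = taylorCoeff i (F φ) (φ (ψ.symm y)) := by
  have h : ∀ i, ∀ z ∈ ambientOverlap a φ ψ,
      pderivRho^[i] (F ψ) z = pderivRho^[i] (F φ) (ambientTransition φ ψ z) := by
    intro i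
    induction i with
    | zero => exact hF.compat φ hφ ψ hψ
    | succ i ih =>
      intro z hz
      rw [Function.iterate_succ_apply', Function.iterate_succ_apply', pderivRho, pderiv_congr
        (Set.EqOn.eventuallyEq_of_mem ih ((isOpen_ambientOverlap hψ).mem_nhds hz)),
        pderiv_comp (diffAt (((hF.isFlowFn φ hφ).iterate_pderivRho hφ i).smooth _
          (ambientTransition_mem hφ hψ hz))) ((contDiffAt_ambientTransition hφ hψ hz.2).differentiableAt (by simp))]
      simp [pderiv_ambientTransition hφ hψ hz.2, Fintype.sum_sum_type, Matrix.one_apply]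
  rw [taylorCoeff, taylorCoeff, h i _ ⟨ambientPoint_mem a hψ hy.1 one_pos, hy⟩]
  rfl

/-- The `i`-th Taylor coefficient at `ρ = 0`, as a function on `M`. -/
def taylorFn (hF : IsAmbientFn a F) (i : ℕ) : SmoothFn n M :=
  ⟨fun x => taylorCoeff i (F (chartAt (E n) x)) (chartAt (E n) x x),
    contMDiff_of_charts (F := fun φ => taylorCoeff i (F φ))
      (fun φ hφ => contDiffAt_taylorCoeff hφ (hF.isFlowFn φ hφ) i) fun φ hφ x hx => by
        rw [hF.taylorCoeff_transition hφ (chart_mem_atlas (E n) x)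
          (mem_overlap hx (mem_chart_source _ x)), (chartAt (E n) x).left_inv (mem_chart_source _ x)]⟩

theorem taylorFn_apply (hF : IsAmbientFn a F) (i : ℕ) (hφ : φ ∈ atlas (E n) M) {x : M}
    (hx : x ∈ φ.source) : hF.taylorFn i x = taylorCoeff i (F φ) (φ x) := by
  refine (hF.taylorCoeff_transition hφ (chart_mem_atlas (E n) x)
    (mem_overlap hx (mem_chart_source _ x)) i).trans ?_
  rw [(chartAt (E n) x).left_inv (mem_chart_source _ x)]

theorem taylorFn_comp_symm (hF : IsAmbientFn a F) (i : ℕ) (hφ : φ ∈ atlas (E n) M) :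
    Set.EqOn (hF.taylorFn i ∘ φ.symm) (taylorCoeff i (F φ)) φ.target := fun y hy => by
  rw [Function.comp_apply, hF.taylorFn_apply i hφ (φ.map_target hy), φ.right_inv hy]

end IsAmbientFn

end Transition

/-! ### The GJMS operator as a chain of ladder operators -/

section Chain

variable {n : ℕ} {M : Type*} [TopologicalSpace M] [ChartedSpace (E n) M] [IsManifold (𝓡 n) ∞ M]
  {φ ψ : OpenPartialHomeomorph M (E n)} {g : Metric n M} {a : AmbientMetric g}
  {z : EuclideanSpace ℝ (AmbientIndex n)}

theorem coeffOp_linear (a : AmbientMetric g) (hφ : φ ∈ atlas (E n) M) {y : E n} (hy : y ∈ φ.target)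
    {f h : E n → ℝ} (hf : ∀ y ∈ φ.target, ContDiffAt ℝ ∞ f y)
    (hh : ∀ y ∈ φ.target, ContDiffAt ℝ ∞ h y) (c : ℝ) (p : ℕ) :
    coeffOp a φ p (fun y => c * f y + h y) y = c * coeffOp a φ p f y + coeffOp a φ p h y := by
  set θ := rootDensity g φ with hθdef
  have hθ : ∀ y ∈ φ.target, ContDiffAt ℝ ∞ θ y := fun _ hy => contDiffAt_rootDensity a hφ hy
  have hF : ∀ y ∈ φ.target, ContDiffAt ℝ ∞ (fun y => θ y * f y) y := fun y hy =>
    (hθ y hy).mul (hf y hy)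
  have hH : ∀ y ∈ φ.target, ContDiffAt ℝ ∞ (fun y => θ y * h y) y := fun y hy =>
    (hθ y hy).mul (hh y hy)
  have hG : ∀ i j, ∀ y ∈ φ.target,
      ContDiffAt ℝ ∞ (taylorCoeff p fun z => (ambientH a φ z)⁻¹ i j) y := fun i j =>
    contDiffAt_taylorCoeff hφ (IsFlowFn.inv_ambientH hφ i j) p
  have key : ∀ i j, pderiv i (fun y => taylorCoeff p (fun z => (ambientH a φ z)⁻¹ i j) y *
      pderiv j (fun y => θ y * (c * f y + h y)) y) y =
      c * pderiv i (fun y => taylorCoeff p (fun z => (ambientH a φ z)⁻¹ i j) y *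
        pderiv j (fun y => θ y * f y) y) y +
      pderiv i (fun y => taylorCoeff p (fun z => (ambientH a φ z)⁻¹ i j) y *
        pderiv j (fun y => θ y * h y) y) y := by
    intro i j
    have d1 := diffAt ((hG i j y hy).mul ((hF y hy).pderiv j))
    have d2 := diffAt ((hG i j y hy).mul ((hH y hy).pderiv j))
    rw [← pderiv_const_mul c d1, ← pderiv_add (d1.const_mul c) d2]
    refine pderiv_congr ?_ _
    filter_upwards [φ.open_target.mem_nhds hy] with y hy
    have e : (fun y => θ y * (c * f y + h y)) = fun y => c * (θ y * f y) + θ y * h y := by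
      funext y; ring
    rw [e, pderiv_add ((diffAt (hF y hy)).const_mul c) (diffAt (hH y hy)),
      pderiv_const_mul c (diffAt (hF y hy))]
    ring
  simp only [coeffOp, densityCoeffOp, ← hθdef]
  simp only [key, Finset.sum_add_distrib, ← Finset.mul_sum]
  ring

/-- The operator `M_p` on functions: the `p`-th Taylor coefficient at `ρ = 0` of the flow. -/
def coeffEnd (a : AmbientMetric g) (p : ℕ) : Module.End ℝ (SmoothFn n M) :=
  endOfPointwise (fun u => ((IsAmbientFn.base (a := a) u).flow 0).taylorFn p) fun c u v x => by
    have h : ∀ u : SmoothFn n M, ((IsAmbientFn.base (a := a) u).flow 0).taylorFn p x =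
        coeffOp a (chartAt (E n) x) p (u ∘ (chartAt (E n) x).symm) (chartAt (E n) x x) := fun u =>
      taylorCoeff_flow_base (chart_mem_atlas _ x) (mem_chart_target _ x)
        (fun _ hy => u.contDiffAt (chart_mem_atlas _ x) hy) 0 p
    rw [h, h, h, ← coeffOp_linear a (chart_mem_atlas _ x) (mem_chart_target _ x)
      (fun _ hy => u.contDiffAt (chart_mem_atlas _ x) hy)
      (fun _ hy => v.contDiffAt (chart_mem_atlas _ x) hy)]
    rfl

theorem coeffEnd_apply (a : AmbientMetric g) (p : ℕ) (u : SmoothFn n M) (hφ : φ ∈ atlas (E n) M)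
    {x : M} (hx : x ∈ φ.source) : coeffEnd a p u x = coeffOp a φ p (u ∘ φ.symm) (φ x) :=
  (((IsAmbientFn.base (a := a) u).flow 0).taylorFn_apply p hφ hx).trans
    (taylorCoeff_flow_base hφ (φ.map_source hx) (fun _ hy => u.contDiffAt hφ hy) 0 p)

/-- In terms of Taylor coefficients at `ρ = 0`, the flow acts as the operator
`-2ρ∂² + 2s∂ + ∑ ρ^p M_p` with `s = γ + n/2 - 1`. -/
theorem IsAmbientFn.taylorFn_flow
    {F : OpenPartialHomeomorph M (E n) → EuclideanSpace ℝ (AmbientIndex n) → ℝ}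
    (hF : IsAmbientFn a F) (γ : ℝ) (i : ℕ) : (hF.flow γ).taylorFn i =
      (2 * (i + 1) * (γ + n / 2 - 1 - i) : ℝ) • hF.taylorFn (i + 1) +
        ∑ p ∈ Finset.HasAntidiagonal.antidiagonal i, coeffEnd a p.1 (hF.taylorFn p.2) := by
  ext x
  have hφ := chart_mem_atlas (E n) x
  have hx := mem_chart_source (E n) x
  have h1 : ((2 * (i + 1) * (γ + n / 2 - 1 - i) : ℝ) • hF.taylorFn (i + 1) +
      ∑ p ∈ Finset.HasAntidiagonal.antidiagonal i, coeffEnd a p.1 (hF.taylorFn p.2)) x =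
      (2 * (i + 1) * (γ + n / 2 - 1 - i) : ℝ) * hF.taylorFn (i + 1) x +
      ∑ p ∈ Finset.HasAntidiagonal.antidiagonal i, coeffEnd a p.1 (hF.taylorFn p.2) x := by
    simp only [← evalAt_apply, map_add, map_smul, map_sum, smul_eq_mul]
  rw [h1, (hF.flow γ).taylorFn_apply i hφ hx, hF.taylorFn_apply (i + 1) hφ hx,
    taylorCoeff_flow hφ (mem_chart_target _ x) (hF.isFlowFn _ hφ)]
  congr 1
  refine Finset.sum_congr rfl fun p _ => ?_
  rw [coeffEnd_apply a p.1 _ hφ hx]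
  refine coeffOp_congr ?_ _
  exact ((hF.taylorFn_comp_symm p.2 hφ).eventuallyEq_of_mem
    ((chartAt (E n) x).open_target.mem_nhds (mem_chart_target _ x))).symm

/-- The functions `G_m` with `Δ̃^m (t^γ u) = (-1)^m t^{γ-2m} (det h_ρ / det g)^{-1/4} G_m`. -/
def flowIter (a : AmbientMetric g) (γ : ℝ) (u : M → ℝ) :
    ℕ → OpenPartialHomeomorph M (E n) → EuclideanSpace ℝ (AmbientIndex n) → ℝ
  | 0 => fun φ z => relRoot a φ z * (u ∘ φ.symm) (ambientBase z)
  | m + 1 => fun φ => flow a φ (γ - 2 * m) (flowIter a γ u m φ)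

theorem isAmbientFn_flowIter (a : AmbientMetric g) (γ : ℝ) (u : SmoothFn n M) (m : ℕ) :
    IsAmbientFn a (flowIter a γ u m) := by
  induction m with
  | zero => exact IsAmbientFn.relRoot.mul (IsAmbientFn.base u)
  | succ m ih => exact ih.flow _

theorem localLaplacian_const_mul {ι : Type} [Fintype ι] [DecidableEq ι]
    (G : EuclideanSpace ℝ ι → Matrix ι ι ℝ) (c : ℝ) (f : EuclideanSpace ℝ ι → ℝ)
    (y : EuclideanSpace ℝ ι) :
    localLaplacian G (fun z => c * f z) y = c * localLaplacian G f y := by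
  have h : ∀ i (f : EuclideanSpace ℝ ι → ℝ),
      pderiv i (fun z => c * f z) = fun y => c * pderiv i f y := by
    intro i f
    funext y
    simp only [pderiv]
    rw [show (fun z => c * f z) = c • f from rfl, fderiv_const_smul_field]
    rfl
  simp only [localLaplacian_eq_sum, h, mul_left_comm _ c, ← mul_sub, ← Finset.mul_sum, mul_neg]

theorem iterate_localLaplacian (a : AmbientMetric g) (hφ : φ ∈ atlas (E n) M) (γ : ℝ) (u : M → ℝ)
    (m : ℕ) : Set.EqOn ((localLaplacian (ambientMatrix a.form φ))^[m]
        (fun z => z (Sum.inr 0) ^ γ * u (φ.symm (ambientBase z))))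
      (fun z => (-1) ^ m * (z (Sum.inr 0) ^ (γ - 2 * m) *
        ((relRoot a φ z)⁻¹ * flowIter a γ u m φ z))) (ambientDomain a φ) := by
  induction m with
  | zero =>
    intro z hz
    have := (relRoot_pos hφ hz).ne'
    simp only [Function.iterate_zero, id, pow_zero, one_mul, Nat.cast_zero, mul_zero, sub_zero,
      flowIter, Function.comp_apply]
    rw [inv_mul_cancel_left₀ this]
  | succ m ih =>
    intro z hz
    rw [Function.iterate_succ_apply', localLaplacian_congr
      (ih.eventuallyEq_of_mem ((isOpen_ambientDomain a hφ).mem_nhds hz)), localLaplacian_const_mul,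
      localLaplacian_eq_flow hφ _ hz, flowIter]
    have e : γ - 2 * m - 2 = γ - 2 * ((m + 1 : ℕ) : ℝ) := by push_cast; ring
    rw [e]
    ring

theorem gjms_eq_taylorFn (a : AmbientMetric g) (k : ℕ) (u : SmoothFn n M) (x : M) :
    gjms a k u x =
      (-1) ^ k * (isAmbientFn_flowIter a ((k : ℝ) - n / 2) u k).taylorFn 0 x := by
  have hφ := chart_mem_atlas (E n) x
  have hy := mem_chart_target (E n) x
  rw [gjms, iterate_localLaplacian a hφ _ _ k (ambientPoint_mem a hφ hy one_pos)]
  simp only [relRoot_ambientPoint hφ hy, ambientPoint_inr_zero, Real.one_rpow, inv_one, one_mul]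
  rw [IsAmbientFn.taylorFn_apply _ 0 hφ (mem_chart_source _ x), taylorCoeff_zero]

/-- The Taylor coefficients of `flowIter` are those of a chain of ladder operators. Each step consumes
one derivative in `ρ`, so a truncation `f` of the Taylor expansion at order `k` suffices. -/
theorem taylorFn_flowIter (a : AmbientMetric g) (k : ℕ) (u : SmoothFn n M) (f : ℤ →₀ SmoothFn n M)
    (hf : ∀ i : ℕ, i ≤ k → f i = (isAmbientFn_flowIter a ((k : ℝ) - n / 2) u 0).taylorFn i)
    (hneg : ∀ i < 0, f i = 0) (m : ℕ) : ∀ i : ℕ, i + m ≤ k →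
      (isAmbientFn_flowIter a ((k : ℝ) - n / 2) u m).taylorFn i =
        ladderChain (coeffEnd a) (k + 1) (k - 1) m f i := by
  induction m with
  | zero => exact fun i hi => (hf i hi).symm
  | succ m ih =>
    intro i hi
    have h := (isAmbientFn_flowIter a ((k : ℝ) - n / 2) u m).taylorFn_flow
      ((k : ℝ) - n / 2 - 2 * m) i
    refine h.trans ?_
    rw [ladderChain, LinearMap.comp_apply, ladder_apply]
    congr 1
    · rw [ih (i + 1) (by omega)]
      push_cast
      congr 1
      ring
    · rw [Finset.Nat.sum_antidiagonal_eq_sum_range_succ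
        (fun p q => coeffEnd a p ((isAmbientFn_flowIter a ((k : ℝ) - n / 2) u m).taylorFn q))]
      refine Finset.sum_subset_zero_on_sdiff (Finset.range_subset_range.2 (by omega))
        (fun j hj => ?_) (fun j hj => ?_)
      · rw [Finset.mem_sdiff, Finset.mem_range, Finset.mem_range] at hj
        rw [ladderChain_nonneg _ _ _ _ hneg _ (by omega), map_zero]
      · rw [Finset.mem_range] at hj
        rw [ih (i - j) (by omega), Nat.cast_sub (by omega)]

/-- The GJMS operator through the coefficient operators `M_p`. The factor `(det h_ρ / det g)^{1/4}`
does not contribute, since only the value at `ρ = 0` of the initial function matters. -/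
theorem gjms_eq_ladderCoeff (a : AmbientMetric g) (k : ℕ) (u : SmoothFn n M) (x : M) :
    gjms a k u x = ((-1 : ℝ) ^ k • ladderCoeff (coeffEnd a) (k + 1) (k - 1) k 0) u x := by
  set h0 := isAmbientFn_flowIter a ((k : ℝ) - n / 2) u 0
  set f : ℤ →₀ SmoothFn n M :=
    ∑ i ∈ Finset.range (k + 1), Finsupp.single (i : ℤ) (h0.taylorFn i) with hfdef
  have hfi : ∀ i : ℤ, f i = ∑ j ∈ Finset.range (k + 1), if (j : ℤ) = i then h0.taylorFn j else 0 := by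
    intro i
    simp [hfdef, Finsupp.single_apply]
  have hf : ∀ i : ℕ, i ≤ k → f i = h0.taylorFn i := by
    intro i hi
    rw [hfi, Finset.sum_eq_single i]
    · simp
    · intro j _ hj
      rw [if_neg (by exact_mod_cast hj)]
    · intro h; exact absurd (Finset.mem_range.2 (by omega)) h
  have hneg : ∀ i < 0, f i = 0 := by
    intro i hi
    rw [hfi]
    exact Finset.sum_eq_zero fun j _ => if_neg (by omega)
  have hz : f 0 = u := by
    have := hf 0 (Nat.zero_le _)
    rw [Nat.cast_zero] at this
    rw [this]
    ext x
    have hφ := chart_mem_atlas (E n) x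
    rw [h0.taylorFn_apply 0 hφ (mem_chart_source _ x), taylorCoeff_zero]
    simp only [flowIter]
    rw [relRoot_ambientPoint hφ (mem_chart_target _ x), one_mul, ambientBase_ambientPoint,
      Function.comp_apply, (chartAt (E n) x).left_inv (mem_chart_source _ x)]
  rw [gjms_eq_taylorFn, taylorFn_flowIter a k u f hf hneg k 0 (by omega), Nat.cast_zero,
    ladderChain_apply_zero _ _ _ hneg, hz]
  rfl

end Chain

/-! ### Self-adjointness and order of the coefficient operators -/

section CoefficientOperators

variable {n : ℕ} {M : Type*} [TopologicalSpace M] [ChartedSpace (E n) M] [IsManifold (𝓡 n) ∞ M]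
  {φ ψ : OpenPartialHomeomorph M (E n)} {g : Metric n M} {a : AmbientMetric g}

theorem taylorCoeff_inv_symm (a : AmbientMetric g) (hφ : φ ∈ atlas (E n) M) {y : E n}
    (hy : y ∈ φ.target) (p : ℕ) (i j : Fin n) :
    taylorCoeff p (fun z => (ambientH a φ z)⁻¹ i j) y =
      taylorCoeff p (fun z => (ambientH a φ z)⁻¹ j i) y := by
  refine taylorCoeff_congr (a := a) hφ hy (fun z _ => ?_) p
  have h : (ambientH a φ z).transpose = ambientH a φ z := by
    ext i j
    simp only [Matrix.transpose_apply, ambientH, formMatrix, Matrix.of_apply]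
    exact a.symm _ _ _ _
  change (ambientH a φ z)⁻¹ i j = ((ambientH a φ z)⁻¹).transpose i j
  rw [Matrix.transpose_nonsing_inv, h]

theorem contDiffAt_taylorCoeff_inv (a : AmbientMetric g) (hφ : φ ∈ atlas (E n) M) (p : ℕ)
    (i j : Fin n) : ∀ y ∈ φ.target,
      ContDiffAt ℝ ∞ (taylorCoeff p fun z => (ambientH a φ z)⁻¹ i j) y :=
  contDiffAt_taylorCoeff hφ (IsFlowFn.inv_ambientH hφ i j) p

/-- Green's identity for `densityCoeffOp`. -/
theorem densityCoeffOp_green (a : AmbientMetric g) (hφ : φ ∈ atlas (E n) M) {y : E n}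
    (hy : y ∈ φ.target) {U V : E n → ℝ} (hU : ContDiffAt ℝ ∞ U y) (hV : ContDiffAt ℝ ∞ V y)
    (p : ℕ) : densityCoeffOp a φ p U y * V y - U y * densityCoeffOp a φ p V y =
      ∑ i, ∑ j, pderiv i (fun y => taylorCoeff p (fun z => (ambientH a φ z)⁻¹ i j) y *
        (pderiv j U y * V y - U y * pderiv j V y)) y := by
  have hb := fun i j => contDiffAt_taylorCoeff_inv a hφ p i j y hy
  set b : Fin n → Fin n → E n → ℝ := fun i j => taylorCoeff p fun z => (ambientH a φ z)⁻¹ i j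
    with hbdef
  have key : ∀ i j, pderiv i (fun y => b i j y * (pderiv j U y * V y - U y * pderiv j V y)) y =
      pderiv i (fun y => b i j y * pderiv j U y) y * V y
        - U y * pderiv i (fun y => b i j y * pderiv j V y) y
        + (b i j y * pderiv j U y * pderiv i V y - b i j y * pderiv i U y * pderiv j V y) := by
    intro i j
    have d1 := diffAt ((hb i j).mul (hU.pderiv j))
    have d2 := diffAt ((hb i j).mul (hV.pderiv j))
    have e : (fun y => b i j y * (pderiv j U y * V y - U y * pderiv j V y)) = fun y =>
        (b i j y * pderiv j U y) * V y - U y * (b i j y * pderiv j V y) := by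
      funext y; ring
    rw [e, pderiv_sub (d1.fun_mul (diffAt hV)) ((diffAt hU).fun_mul d2), pderiv_mul d1 (diffAt hV),
      pderiv_mul (diffAt hU) d2]
    ring
  have hsym : ∑ i, ∑ j, b i j y * pderiv j U y * pderiv i V y =
      ∑ i, ∑ j, b i j y * pderiv i U y * pderiv j V y := by
    rw [Finset.sum_comm]
    refine Finset.sum_congr rfl fun i _ => Finset.sum_congr rfl fun j _ => ?_
    rw [show b j i y = b i j y from taylorCoeff_inv_symm a hφ hy p j i]
  change _ = ∑ i, ∑ j, pderiv i (fun y => b i j y * (pderiv j U y * V y - U y * pderiv j V y)) y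
  simp only [key, Finset.sum_add_distrib, Finset.sum_sub_distrib]
  rw [hsym, sub_self, add_zero]
  simp only [densityCoeffOp, sub_mul, mul_sub, Finset.sum_mul, Finset.mul_sum]
  ring

variable [CompactSpace M] [T2Space M]

/-- The coefficient operators do not increase supports. -/
theorem coeffEnd_apply_eq_zero (a : AmbientMetric g) (p : ℕ) (u : SmoothFn n M) {t : Set M}
    (ht : IsClosed t) (hu : ∀ z ∉ t, u z = 0) {x : M} (hx : x ∉ t) : coeffEnd a p u x = 0 := by
  have hxs := mem_chart_source (E n) x
  rw [coeffEnd_apply a p u (chart_mem_atlas (E n) x) hxs,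
    coeffOp_congr (h := fun _ => 0)]
  · simp [coeffOp, densityCoeffOp]
  · have h1 : ∀ᶠ z in 𝓝 x, u z = 0 := by
      filter_upwards [ht.isOpen_compl.mem_nhds hx] with z hz using hu z hz
    exact (tendsto_symm_nhds hxs).eventually h1

section SelfAdjoint

variable [MeasurableSpace M] [BorelSpace M]

/-- The coefficient operators are formally self-adjoint on functions: on half-densities they have the
form `∂_i (h_p^{ij} ∂_j) - V_p`. -/
theorem coeffEnd_selfAdjoint (a : AmbientMetric g) (p : ℕ) (u v : SmoothFn n M) :
    l2Pairing a (coeffEnd a p u) v = l2Pairing a u (coeffEnd a p v) := by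
  suffices h : ((l2Pairing a).comp (coeffEnd a p)).flip v - (l2Pairing a).flip (coeffEnd a p v) = 0 by
    exact sub_eq_zero.1 (LinearMap.congr_fun h u)
  ext u
  refine eq_zero_of_forall_chart _ (fun φ hφ t ht htφ u hu => ?_) u
  change ∫ x, coeffEnd a p u x * v x ∂(vol g) - ∫ x, u x * coeffEnd a p v x ∂(vol g) = 0
  have c1 : Continuous fun x => coeffEnd a p u x * v x :=
    (coeffEnd a p u).contMDiff.continuous.mul v.contMDiff.continuous
  have c2 : Continuous fun x => u x * coeffEnd a p v x :=
    u.contMDiff.continuous.mul (coeffEnd a p v).contMDiff.continuous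
  rw [← integral_sub (integrable_of_continuous a c1) (integrable_of_continuous a c2),
    integral_vol_eq a hφ (f := fun x => coeffEnd a p u x * v x - u x * coeffEnd a p v x) (c1.sub c2)
      fun z hz => by
      have hz' : z ∉ t := fun h => hz (htφ h)
      rw [coeffEnd_apply_eq_zero a p u ht hu hz', hu z hz', zero_mul, zero_mul, sub_zero]]
  have hC := isCompact_image_chart ht htφ
  have hCt : φ '' t ⊆ φ.target := by
    rintro _ ⟨z, hz, rfl⟩; exact φ.map_source (htφ hz)
  set U : E n → ℝ := fun y => rootDensity g φ y * (u ∘ φ.symm) y with hUdef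
  set V : E n → ℝ := fun y => rootDensity g φ y * (v ∘ φ.symm) y with hVdef
  have hU : ∀ y ∈ φ.target, ContDiffAt ℝ ∞ U y := fun y hy =>
    (contDiffAt_rootDensity a hφ hy).mul (u.contDiffAt hφ hy)
  have hV : ∀ y ∈ φ.target, ContDiffAt ℝ ∞ V y := fun y hy =>
    (contDiffAt_rootDensity a hφ hy).mul (v.contDiffAt hφ hy)
  have hU0 : ∀ y ∈ φ.target, y ∉ φ '' t → U y = 0 := fun y hy hyt => by
    rw [hUdef]
    have : u (φ.symm y) = 0 := hu _ fun h => hyt ⟨_, h, φ.right_inv hy⟩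
    simp [this]
  have hU1 : ∀ y ∈ φ.target, y ∉ φ '' t → ∀ j, pderiv j U y = 0 := fun y hy hyt j => by
    rw [← pderiv_const (y := y) j 0]
    refine pderiv_congr ?_ j
    filter_upwards [φ.open_target.mem_nhds hy, hC.isClosed.isOpen_compl.mem_nhds hyt] with z hz hz'
    exact hU0 z hz hz'
  set X : Fin n → Fin n → E n → ℝ := fun i j y =>
    taylorCoeff p (fun z => (ambientH a φ z)⁻¹ i j) y * (pderiv j U y * V y - U y * pderiv j V y)
    with hXdef
  have hX : ∀ i j, ∀ y ∈ φ.target, ContDiffAt ℝ ∞ (X i j) y := fun i j y hy =>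
    (contDiffAt_taylorCoeff_inv a hφ p i j y hy).mul
      ((((hU y hy).pderiv j).mul (hV y hy)).sub ((hU y hy).mul ((hV y hy).pderiv j)))
  have hX0 : ∀ i j, ∀ y ∈ φ.target, y ∉ φ '' t → X i j y = 0 := fun i j y hy hyt => by
    simp only [hXdef, hU0 y hy hyt, hU1 y hy hyt, zero_mul, sub_zero, mul_zero]
  have hX1 : ∀ i j, ∀ y ∈ φ.target, y ∉ φ '' t → pderiv i (X i j) y = 0 := fun i j y hy hyt => by
    rw [← pderiv_const (y := y) i 0]
    refine pderiv_congr ?_ i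
    filter_upwards [φ.open_target.mem_nhds hy, hC.isClosed.isOpen_compl.mem_nhds hyt] with z hz hz'
    exact hX0 i j z hz hz'
  have hI : ∀ i j, IntegrableOn (pderiv i (X i j)) φ.target := fun i j =>
    integrableOn_of_compact φ.open_target (fun y hy => ((hX i j y hy).pderiv i).continuousAt)
      hC hCt (hX1 i j)
  have hpt : ∀ y ∈ φ.target, volDensity g φ y * (coeffEnd a p u (φ.symm y) * v (φ.symm y) -
      u (φ.symm y) * coeffEnd a p v (φ.symm y)) = ∑ i, ∑ j, pderiv i (X i j) y := by
    intro y hy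
    have hs := φ.map_target hy
    have hr := (rootDensity_pos (g := g) hφ hy).ne'
    rw [← densityCoeffOp_green a hφ hy (hU y hy) (hV y hy) p, coeffEnd_apply a p u hφ hs,
      coeffEnd_apply a p v hφ hs, φ.right_inv hy, coeffOp, coeffOp, ← rootDensity_sq hφ hy]
    simp only [hUdef, hVdef, Function.comp_apply]
    field_simp
  rw [setIntegral_congr_fun φ.open_target.measurableSet hpt,
    integral_finsetSum _ fun i _ => integrable_finsetSum _ fun j _ => hI i j]
  refine Finset.sum_eq_zero fun i _ => ?_
  rw [integral_finsetSum _ fun j _ => hI i j]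
  exact Finset.sum_eq_zero fun j _ =>
    setIntegral_pderiv_eq_zero φ.open_target (hX i j) hC hCt (hX0 i j) i

end SelfAdjoint

/-- The coefficient operators are differential operators of order at most two. -/
theorem isOrd_coeffEnd (a : AmbientMetric g) (p : ℕ) :
    IsOrd (evalAt (n := n) (M := M)) 3 (coeffEnd a p) := by
  refine isOrd_of_pow fun x f hf => ?_
  have hφ := chart_mem_atlas (E n) x
  have hx := mem_chart_source (E n) x
  have hy := mem_chart_target (E n) x
  rw [evalAt_apply, coeffEnd_apply a p _ hφ hx]
  set φ := chartAt (E n) x with hφdef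
  set F : E n → ℝ := f ∘ φ.symm with hFdef
  have hF : ∀ y ∈ φ.target, ContDiffAt ℝ ∞ F y := fun y hy => f.contDiffAt hφ hy
  have hF0 : F (φ x) = 0 := by rw [hFdef, Function.comp_apply, φ.left_inv hx]; exact hf
  have hpow : ((f ^ (2 + 1) : SmoothFn n M) : M → ℝ) ∘ φ.symm = fun y => F y ^ 3 := by
    funext y
    change evalAt (φ.symm y) (f ^ 3) = _
    rw [map_pow]; rfl
  have hθ : ∀ y ∈ φ.target, ContDiffAt ℝ ∞ (rootDensity g φ) y := fun _ hy =>
    contDiffAt_rootDensity a hφ hy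
  -- each term of the divergence is the derivative of a multiple of `F²`
  have key : ∀ i j, pderiv i (fun y => taylorCoeff p (fun z => (ambientH a φ z)⁻¹ i j) y *
      pderiv j (fun y => rootDensity g φ y * F y ^ 3) y) (φ x) = 0 := by
    intro i j
    set K : E n → ℝ := fun y => taylorCoeff p (fun z => (ambientH a φ z)⁻¹ i j) y *
      (pderiv j (rootDensity g φ) y * F y + 3 * rootDensity g φ y * pderiv j F y) with hK
    have hKd : DifferentiableAt ℝ K (φ x) :=
      diffAt ((contDiffAt_taylorCoeff_inv a hφ p i j _ hy).mul
      ((((hθ _ hy).pderiv j).mul (hF _ hy)).add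
        ((contDiffAt_const.mul (hθ _ hy)).mul ((hF _ hy).pderiv j))))
    have hFd := diffAt (hF _ hy)
    have e : (fun y => taylorCoeff p (fun z => (ambientH a φ z)⁻¹ i j) y *
      pderiv j (fun y => rootDensity g φ y * F y ^ 3) y) =ᶠ[𝓝 (φ x)] fun y => F y * (F y * K y) := by
      filter_upwards [φ.open_target.mem_nhds hy] with y hy
      have hd := diffAt (hF y hy)
      have h3 : (fun y => rootDensity g φ y * F y ^ 3) =
          fun y => rootDensity g φ y * (F y * (F y * F y)) := by funext y; ring
      rw [h3, pderiv_mul (diffAt (hθ y hy)) (hd.fun_mul (hd.fun_mul hd)), pderiv_mul hd (hd.fun_mul hd),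
        pderiv_mul hd hd, hK]
      ring
    rw [pderiv_congr e, pderiv_mul hFd (hFd.fun_mul hKd), pderiv_mul hFd hKd, hF0]
    ring
  rw [hpow, coeffOp, densityCoeffOp]
  simp only [key, hF0]
  simp

/-- The leading coefficient operator is the Laplacian up to sign and a zeroth-order term. -/
theorem isOrd_coeffEnd_zero_add (a : AmbientMetric g) :
    IsOrd (evalAt (n := n) (M := M)) 1 (coeffEnd a 0 + laplacianEnd a) := by
  refine isOrd_of_pow (m := 0) fun x f hf => ?_
  have hφ := chart_mem_atlas (E n) x
  have hx := mem_chart_source (E n) x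
  have hy := mem_chart_target (E n) x
  have hθ : ∀ y ∈ (chartAt (E n) x).target, ContDiffAt ℝ ∞ (rootDensity g (chartAt (E n) x)) y :=
    fun _ hy => contDiffAt_rootDensity a hφ hy
  rw [zero_add, pow_one, LinearMap.add_apply, map_add, evalAt_apply, evalAt_apply,
    coeffEnd_apply a 0 f hφ hx, laplacianEnd_apply, laplacian_eq a hφ hx]
  set φ := chartAt (E n) x with hφdef
  set F : E n → ℝ := f ∘ φ.symm with hFdef
  have hF : ∀ y ∈ φ.target, ContDiffAt ℝ ∞ F y := fun y hy => f.contDiffAt hφ hy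
  have hF0 : F (φ x) = 0 := by rw [hFdef, Function.comp_apply, φ.left_inv hx]; exact hf
  have hdens : IsDensityOn (coords g φ) φ.target fun z => rootDensity g φ z ^ 2 := by
    refine (coords_isMetricOn a hφ).isDensityOn (ε := 1) fun y hy => ⟨(hθ y hy).pow 2,
      pow_pos (rootDensity_pos hφ hy) 2, ?_⟩
    rw [rootDensity_sq hφ hy, volDensity, Real.sq_sqrt (coords_posDef g hφ hy).det_pos.le, one_mul]
  have h := (coords_isMetricOn a hφ).localLaplacian_halfDensity hdens
    (fun y hy => ⟨hθ y hy, rootDensity_pos hφ hy⟩) hy ((hθ _ hy).mul (hF _ hy))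
  have hcongr : (fun z => (rootDensity g φ z)⁻¹ * (rootDensity g φ z * F z)) =ᶠ[𝓝 (φ x)] F := by
    filter_upwards [φ.open_target.mem_nhds hy] with z hz
    exact inv_mul_cancel_left₀ (rootDensity_pos hφ hz).ne' _
  have hr := (rootDensity_pos (g := g) hφ hy).ne'
  have h0 : ∀ i j, taylorCoeff 0 (fun z => (ambientH a φ z)⁻¹ i j) =
      fun y => (coords g φ y)⁻¹ i j := fun i j => funext fun y => by
    rw [taylorCoeff_zero, ambientH_zero]
  rw [localLaplacian_congr hcongr, hF0, mul_zero, mul_zero, sub_zero] at h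
  simp only [coeffOp, densityCoeffOp, h0, hF0, mul_zero, sub_zero]
  refine mul_left_cancel₀ hr ?_
  rw [mul_add, h, mul_inv_cancel_left₀ hr, mul_zero, add_neg_cancel]

/-- `Δ + M_0` is multiplication by a function, so `Δ` is self-adjoint because `M_0` is. -/
theorem laplacianEnd_selfAdjoint [MeasurableSpace M] [BorelSpace M] (a : AmbientMetric g)
    (u v : SmoothFn n M) : l2Pairing a (laplacianEnd a u) v = l2Pairing a u (laplacianEnd a v) := by
  set D := coeffEnd a 0 + laplacianEnd a with hD
  have h1 : ∀ u, D u = D 1 * u := fun u => by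
    have := LinearMap.congr_fun ((isOrd_zero_iff eq_zero_of_evalAt).1
      (isOrd_succ_iff.1 (isOrd_coeffEnd_zero_add a) u)) 1
    rw [mulComm_apply, mul_one] at this
    rw [mul_comm]
    exact sub_eq_zero.1 this
  have h2 : ∀ u, laplacianEnd a u = D 1 * u - coeffEnd a 0 u := fun u => by
    rw [← h1, hD, LinearMap.add_apply, add_sub_cancel_left]
  rw [h2 u, h2 v, map_sub, map_sub, LinearMap.sub_apply, l2Pairing_mul, coeffEnd_selfAdjoint]

end CoefficientOperators

/-! ### Powers of the Laplacian -/

section Laplacian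

variable {n : ℕ} {M : Type*} [TopologicalSpace M] [ChartedSpace (E n) M] [IsManifold (𝓡 n) ∞ M]
  {g : Metric n M}

/-- Polarization of `(∇u, ∇u)_g = u Δu - ½ Δ(u²)`. -/
theorem gradInner_eq (a : AmbientMetric g) (u v : SmoothFn n M) (x : M) : gradInner g u v x =
    2⁻¹ * (u x * laplacianEnd a v x + v x * laplacianEnd a u x - laplacianEnd a (u * v) x) := by
  have hφ := chart_mem_atlas (E n) x
  have hx := mem_chart_source (E n) x
  have hy := mem_chart_target (E n) x
  simp only [laplacianEnd_apply, laplacian, gradInner, localLaplacian_eq_sum]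
  have hu : ∀ y ∈ (chartAt (E n) x).target, ContDiffAt ℝ ∞ (u ∘ (chartAt (E n) x).symm) y :=
    fun y hy => u.contDiffAt hφ hy
  have hv : ∀ y ∈ (chartAt (E n) x).target, ContDiffAt ℝ ∞ (v ∘ (chartAt (E n) x).symm) y :=
    fun y hy => v.contDiffAt hφ hy
  have hxu : u x = (u ∘ (chartAt (E n) x).symm) (chartAt (E n) x x) := by
    rw [Function.comp_apply, (chartAt (E n) x).left_inv hx]
  have hxv : v x = (v ∘ (chartAt (E n) x).symm) (chartAt (E n) x x) := by
    rw [Function.comp_apply, (chartAt (E n) x).left_inv hx]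
  have huv : ((u * v : SmoothFn n M) : M → ℝ) ∘ (chartAt (E n) x).symm = fun y =>
    (u ∘ (chartAt (E n) x).symm) y * (v ∘ (chartAt (E n) x).symm) y := rfl
  have hsymm := fun i j => (coords_isMetricOn a hφ).inv_symm hy i j
  rw [hxu, hxv, huv]
  set U : E n → ℝ := u ∘ (chartAt (E n) x).symm
  set V : E n → ℝ := v ∘ (chartAt (E n) x).symm
  set φ := chartAt (E n) x with hφdef
  set y := φ x with hydef
  set G := (coords g φ y)⁻¹
  have h1 : ∀ i, ∀ y ∈ φ.target, pderiv i (fun y => U y * V y) y =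
      pderiv i U y * V y + U y * pderiv i V y := fun i y hy =>
    pderiv_mul (diffAt (hu y hy)) (diffAt (hv y hy)) i
  have h2 : ∀ i j, pderiv i (pderiv j fun y => U y * V y) y =
      pderiv i (pderiv j U) y * V y + pderiv j U y * pderiv i V y +
        (pderiv i U y * pderiv j V y + U y * pderiv i (pderiv j V) y) := by
    intro i j
    have e : pderiv j (fun y => U y * V y) =ᶠ[𝓝 y] fun y => pderiv j U y * V y + U y * pderiv j V y := by
      filter_upwards [φ.open_target.mem_nhds hy] with z hz using h1 j z hz
    have d1 := diffAt ((hu y hy).pderiv j)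
    have d2 := diffAt ((hv y hy).pderiv j)
    rw [pderiv_congr e, pderiv_add (d1.fun_mul (diffAt (hv y hy))) ((diffAt (hu y hy)).fun_mul d2),
      pderiv_mul d1 (diffAt (hv y hy)), pderiv_mul (diffAt (hu y hy)) d2]
  have h3 : ∑ i, ∑ j, G i j * (pderiv j U y * pderiv i V y) =
      ∑ i, ∑ j, G i j * pderiv i U y * pderiv j V y := by
    rw [Finset.sum_comm]
    refine Finset.sum_congr rfl fun i _ => Finset.sum_congr rfl fun j _ => ?_
    rw [hsymm]; ring
  have h4 : ∑ i, ∑ j, G i j * (pderiv i (pderiv j fun y => U y * V y) y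
      - ∑ m, christoffel (coords g φ) m i j y * pderiv m (fun y => U y * V y) y) =
      (∑ i, ∑ j, G i j * (pderiv i (pderiv j U) y
        - ∑ m, christoffel (coords g φ) m i j y * pderiv m U y)) * V y +
      U y * (∑ i, ∑ j, G i j * (pderiv i (pderiv j V) y
        - ∑ m, christoffel (coords g φ) m i j y * pderiv m V y)) +
      (∑ i, ∑ j, G i j * (pderiv j U y * pderiv i V y)
        + ∑ i, ∑ j, G i j * pderiv i U y * pderiv j V y) := by
    simp only [Finset.sum_mul, Finset.mul_sum, ← Finset.sum_add_distrib]
    refine Finset.sum_congr rfl fun i _ => Finset.sum_congr rfl fun j _ => ?_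
    have h5 : ∑ m, christoffel (coords g φ) m i j y * pderiv m (fun y => U y * V y) y =
        (∑ m, christoffel (coords g φ) m i j y * pderiv m U y) * V y +
        U y * ∑ m, christoffel (coords g φ) m i j y * pderiv m V y := by
      simp only [Finset.sum_mul, Finset.mul_sum, ← Finset.sum_add_distrib]
      exact Finset.sum_congr rfl fun m _ => by rw [h1 m y hy]; ring
    rw [h2, h5]
    ring
  rw [h4, h3]
  ring

variable [CompactSpace M] [T2Space M] [MeasurableSpace M] [BorelSpace M]

theorem laplacianEnd_one (a : AmbientMetric g) : laplacianEnd (M := M) a 1 = 0 := by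
  ext x
  have h : ((1 : SmoothFn n M) : M → ℝ) ∘ (chartAt (E n) x).symm = fun _ => 1 := rfl
  have h1 : ∀ i, pderiv i (fun _ : E n => (1 : ℝ)) = fun _ => 0 := fun i =>
    funext fun y => pderiv_const _ _
  change laplacian g (1 : SmoothFn n M) x = 0
  rw [laplacian, h, localLaplacian_eq_sum]
  simp [h1, pderiv_const]

theorem laplacianEnd_pow_selfAdjoint (a : AmbientMetric g) (m : ℕ) (u v : SmoothFn n M) :
    l2Pairing a ((laplacianEnd a ^ m) u) v = l2Pairing a u ((laplacianEnd a ^ m) v) := by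
  induction m generalizing u with
  | zero => rfl
  | succ m ih =>
    rw [pow_succ, Module.End.mul_apply, ih, laplacianEnd_selfAdjoint, ← Module.End.mul_apply,
      ← pow_succ', ← pow_succ]

theorem integral_laplacianEnd (a : AmbientMetric g) (u : SmoothFn n M) :
    ∫ x, laplacianEnd a u x ∂(vol g) = 0 := by
  have h := laplacianEnd_selfAdjoint a u 1
  rw [laplacianEnd_one, map_zero, l2Pairing_apply] at h
  rw [← h]
  exact integral_congr_ae (Filter.Eventually.of_forall fun x => (mul_one _).symm)

theorem integral_gradInner (a : AmbientMetric g) (u v : SmoothFn n M) :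
    Integrable (fun x => gradInner g u v x) (vol g) ∧
      ∫ x, gradInner g u v x ∂(vol g) = l2Pairing a u (laplacianEnd a v) := by
  simp only [gradInner_eq a]
  have i1 : Integrable (fun x => u x * laplacianEnd a v x) (vol g) :=
    integrable_of_continuous a (u.contMDiff.continuous.mul (laplacianEnd a v).contMDiff.continuous)
  have i2 : Integrable (fun x => v x * laplacianEnd a u x) (vol g) :=
    integrable_of_continuous a (v.contMDiff.continuous.mul (laplacianEnd a u).contMDiff.continuous)
  have i3 : Integrable (fun x => laplacianEnd a (u * v) x) (vol g) :=
    integrable_of_continuous a (laplacianEnd a (u * v)).contMDiff.continuous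
  have i12 : Integrable (fun x => u x * laplacianEnd a v x + v x * laplacianEnd a u x) (vol g) :=
    i1.add i2
  refine ⟨(i12.sub i3).const_mul _, ?_⟩
  rw [integral_const_mul, integral_sub i12 i3, integral_add i1 i2, integral_laplacianEnd,
    ← l2Pairing_apply a u, ← l2Pairing_apply a v, l2Pairing_comm a v, laplacianEnd_selfAdjoint]
  ring

/-- `∫ u Δ^k v = ∫ Δ^{k/2} u Δ^{k/2} v`. -/
theorem integral_halfPowerProduct (a : AmbientMetric g) (k : ℕ) (u v : SmoothFn n M) :
    Integrable (fun x => halfPowerProduct g k u v x) (vol g) ∧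
      ∫ x, halfPowerProduct g k u v x ∂(vol g) = l2Pairing a u ((laplacianEnd a ^ k) v) := by
  simp only [halfPowerProduct, ← laplacianEnd_pow_apply a]
  rcases Nat.even_or_odd k with hk | hk
  · simp only [if_pos hk]
    obtain ⟨m, rfl⟩ := hk
    rw [show (m + m) / 2 = m by omega]
    refine ⟨integrable_of_continuous a (((laplacianEnd a ^ m) u).contMDiff.continuous.mul
      ((laplacianEnd a ^ m) v).contMDiff.continuous), ?_⟩
    rw [← l2Pairing_apply a, laplacianEnd_pow_selfAdjoint, ← Module.End.mul_apply, ← pow_add]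
  · simp only [if_neg (Nat.not_even_iff_odd.2 hk)]
    obtain ⟨m, rfl⟩ := hk
    rw [show (2 * m + 1 - 1) / 2 = m by omega]
    refine ⟨(integral_gradInner a _ _).1, ?_⟩
    rw [(integral_gradInner a _ _).2, laplacianEnd_pow_selfAdjoint, ← Module.End.mul_apply,
      ← Module.End.mul_apply, ← pow_succ, ← pow_add]
    congr 3
    omega

end Laplacian

/-! ### The GJMS operator -/

section GJMSOperator

variable {n : ℕ} {M : Type*} [TopologicalSpace M] [ChartedSpace (E n) M] [IsManifold (𝓡 n) ∞ M]
  [CompactSpace M] [T2Space M] {g : Metric n M}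

/-- The GJMS operator as an endomorphism of the space of smooth functions. -/
def gjmsEnd (a : AmbientMetric g) (k : ℕ) : Module.End ℝ (SmoothFn n M) :=
  (-1 : ℝ) ^ k • ladderCoeff (coeffEnd a) (k + 1) (k - 1) k 0

theorem gjmsEnd_apply (a : AmbientMetric g) (k : ℕ) (u : SmoothFn n M) (x : M) :
    gjmsEnd a k u x = gjms a k u x := (gjms_eq_ladderCoeff a k u x).symm

/-- `P - Δ^k` has order at most `2(k-1)`. -/
theorem isOrd_gjmsEnd_sub (a : AmbientMetric g) (m : ℕ) : IsOrd (evalAt (n := n) (M := M))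
    (m + m + 1) (gjmsEnd a (m + 1) - laplacianEnd a ^ (m + 1)) := by
  have h1 := (isOrd_ladderCoeff_sub_pow (N := m + 1 + 1) eq_zero_of_evalAt (isOrd_coeffEnd a)
    (by omega) (((m + 1 : ℕ) : ℤ) - 1) m).smul ((-1 : ℝ) ^ (m + 1))
  have h2 := isOrd_pow_sub_pow eq_zero_of_evalAt (P := (-1 : ℝ) • coeffEnd a 0)
    (D := laplacianEnd a) ((isOrd_coeffEnd a 0).smul (-1)) (by
      have h := (isOrd_coeffEnd_zero_add a).smul (-1 : ℝ)
      rwa [smul_add, neg_one_smul ℝ (laplacianEnd a), ← sub_eq_add_neg] at h) m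
  have h := h1.add h2
  rw [smul_pow, smul_sub, sub_add_sub_cancel] at h
  rwa [← two_mul]

variable [MeasurableSpace M] [BorelSpace M]

/-- The GJMS operators are formally self-adjoint. -/
theorem gjmsEnd_selfAdjoint (a : AmbientMetric g) (k : ℕ) (u v : SmoothFn n M) :
    l2Pairing a (gjmsEnd a k u) v = l2Pairing a u (gjmsEnd a k v) := by
  simp only [gjmsEnd, LinearMap.smul_apply, map_smul]
  congr 1
  exact ladderChain_selfAdjoint (coeffEnd_selfAdjoint a) k u v

end GJMSOperator

end GJMS

end

theorem proposition2p1 {n : ℕ} (hn : 3 ≤ n) {M : Type*} [TopologicalSpace M]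
    [ChartedSpace (GJMS.E n) M] [IsManifold (𝓡 n) ∞ M] [CompactSpace M] [T2Space M]
    [MeasurableSpace M] [BorelSpace M]
    (k : ℕ) (hk : 1 ≤ k) (hkn : Even n → 2 * k ≤ n)
    (g : GJMS.Metric n M) (a : GJMS.AmbientMetric g) :
    ∃ A : (l : ℕ) → GJMS.CovTensorField n M (l + l),
      (∀ l < k, (A l).IsSymm) ∧
      (∀ u : M → ℝ, ContMDiff (𝓡 n) 𝓘(ℝ, ℝ) ∞ u → ∀ x : M,
        GJMS.gjms a k u x = (GJMS.laplacian g)^[k] u x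
          + ∑ l ∈ Finset.range k, (-1 : ℝ) ^ l * GJMS.divForm g (A l) u x) ∧
      (∀ u v : M → ℝ, ContMDiff (𝓡 n) 𝓘(ℝ, ℝ) ∞ u → ContMDiff (𝓡 n) 𝓘(ℝ, ℝ) ∞ v →
        MeasureTheory.Integrable (fun x => u x * GJMS.gjms a k v x) (GJMS.vol g) ∧
        MeasureTheory.Integrable (fun x => GJMS.halfPowerProduct g k u v x
          + ∑ l ∈ Finset.range k, GJMS.pairNabla g (A l) u v x) (GJMS.vol g) ∧
        ∫ x, u x * GJMS.gjms a k v x ∂(GJMS.vol g) =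
          ∫ x, (GJMS.halfPowerProduct g k u v x
            + ∑ l ∈ Finset.range k, GJMS.pairNabla g (A l) u v x) ∂(GJMS.vol g)) := by
  obtain ⟨m, rfl⟩ : ∃ m, k = m + 1 := ⟨k - 1, by omega⟩
  obtain ⟨A, hA, hQ⟩ := GJMS.exists_divergence_form a m (GJMS.isOrd_gjmsEnd_sub a m) fun u v => by
    rw [LinearMap.sub_apply, LinearMap.sub_apply, map_sub, map_sub, LinearMap.sub_apply,
      GJMS.gjmsEnd_selfAdjoint, GJMS.laplacianEnd_pow_selfAdjoint]
  have hP : GJMS.gjmsEnd a (m + 1) = GJMS.laplacianEnd a ^ (m + 1) +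
      ∑ l ∈ Finset.range (m + 1), (-1 : ℝ) ^ l • GJMS.divFormEnd a (A l) :=
    sub_eq_iff_eq_add'.1 hQ
  refine ⟨A, fun l hl => hA l (by omega), fun u hu x => ?_, fun u v hu hv => ?_⟩
  · obtain ⟨u, rfl⟩ : ∃ w : GJMS.SmoothFn n M, ⇑w = u := ⟨⟨u, hu⟩, rfl⟩
    rw [← GJMS.gjmsEnd_apply, hP, ← GJMS.laplacianEnd_pow_apply a]
    simp only [← GJMS.divFormEnd_apply a, ← GJMS.evalAt_apply, LinearMap.add_apply,
      LinearMap.sum_apply, LinearMap.smul_apply, map_add, map_sum, map_smul, smul_eq_mul]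
  · obtain ⟨u, rfl⟩ : ∃ w : GJMS.SmoothFn n M, ⇑w = u := ⟨⟨u, hu⟩, rfl⟩
    obtain ⟨v, rfl⟩ : ∃ w : GJMS.SmoothFn n M, ⇑w = v := ⟨⟨v, hv⟩, rfl⟩
    simp only [← GJMS.gjmsEnd_apply]
    have hi : ∀ l, MeasureTheory.Integrable (fun x => GJMS.pairNabla g (A l) u v x) (GJMS.vol g) :=
      fun l => GJMS.integrable_of_continuous a (GJMS.contMDiff_pairNabla a (A l) u v).continuous
    have hs := MeasureTheory.integrable_finsetSum (Finset.range (m + 1)) fun l _ => hi l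
    obtain ⟨h1, h2⟩ := GJMS.integral_halfPowerProduct a (m + 1) u v
    refine ⟨GJMS.integrable_of_continuous a (u.contMDiff.continuous.mul
      (GJMS.gjmsEnd a (m + 1) v).contMDiff.continuous), h1.add hs, ?_⟩
    rw [MeasureTheory.integral_add h1 hs, h2, MeasureTheory.integral_finsetSum _ fun l _ => hi l,
      ← GJMS.l2Pairing_apply a, hP, LinearMap.add_apply, map_add, LinearMap.sum_apply, map_sum]
    congr 1
    refine Finset.sum_congr rfl fun l hl => ?_
    have hsymm := hA l (by rw [Finset.mem_range] at hl; omega)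
    rw [LinearMap.smul_apply, map_smul, GJMS.l2Pairing_divFormEnd, smul_eq_mul, ← mul_assoc,
      ← mul_pow, neg_one_mul, neg_neg, one_pow, one_mul]
    simp only [GJMS.pairNabla_comm hsymm u v]
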